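/- **Conventions.** Graphs are finite multigraphs, considered up to isomorphism; loops and parallel edges are allowed. In addition a graph may carry *special self-loops*, each contributing $1$ (not $2$) to the degree of its vertex. Given vertices with prescribed degrees (numbers of half-edges), the *configuration model* matches all half-edges by a uniformly random perfect matching. If the total number of half-edges is odd, it first turns one uniformly chosen half-edge into a special self-loop, and then matches the remaining half-edges uniformly. Let $\epsilon=\epsilon(n)\to 0$ with $\epsilon^3 n\to\infty$. Let $p=\frac{1+\epsilon}{n}$, and let $\mu=\mu(n)<1$ satisfy $\mu e^{-\mu}=(1+\epsilon)e^{-(1+\epsilon)}$. Both models below start from $\Lambda\sim\mathcal N\big(1+\epsilon-\mu,\frac1{\epsilon n}\big)$ and, given $\Lambda$, i.i.d. variables $D_u\sim\mathrm{Poisson}(\Lambda)$, $u\in[n]$ (where $D_u=0$ if $\Lambda<0$, an event of probability $o(1)$). * **Poisson-configuration model.** Take the configuration model on the vertices $u$ with $D_u\ge 2$, where $u$ has degree $D_u$. Let $H$ be the resulting multigraph with all its disjoint cycles (connected components that are cycles, including components consisting of a single ordinary loop) deleted. * **Poisson-geometric model.** Take the configuration model $\mathcal K$ on the vertices $u$ with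 $D_u\ge 3$, where $u$ has degree $D_u$. Let $\tilde H$ be obtained from $\mathcal K$ by replacing its edges by paths whose lengths are i.i.d. $\mathrm{Geom}(1-\mu)$, i.e. $\mathbb P(L=k)=\mu^{k-1}(1-\mu)$ for $k\ge1$. Here a special self-loop at $u$ also counts as an edge; it is replaced by a path of $L-1$ ordinary edges starting at $u$, with a special self-loop at its last vertex (so the new vertices have degree $2$ and the old degrees do not change). **Theorem.** The model $H$ is contiguous to $\tilde H$: for every sequence $\mathcal A=\mathcal A_n$ of sets of graphs (closed under isomorphism), if $\mathbb P(\tilde H\in\mathcal A_n)\to0$ as $n\to\infty$, then $\mathbb P(H\in\mathcal A_n)\to0$. -/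

import Mathlib

open MeasureTheory ProbabilityTheory Filter Topology
open scoped ENNReal

/-- A finite multigraph, possibly with loops and parallel edges, which may in addition carry
*special self-loops*. An ordinary edge `e` joins the two (possibly equal) endpoints in `ends e`.
A special self-loop `s` sits at the vertex `at_ s` and contributes only `1` to its degree. -/
structure MultiGraph : Type 1 where
  V : Type
  E : Type
  S : Type
  finV : Finite V
  finE : Finite E
  finS : Finite S
  ends : E → Sym2 V
  at_ : S → V

namespace MultiGraph

attribute [instance] MultiGraph.finV MultiGraph.finE MultiGraph.finS

/-- Isomorphism of multigraphs. -/
def Iso (G H : MultiGraph) : Prop :=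
  ∃ (f : G.V ≃ H.V) (g : G.E ≃ H.E) (h : G.S ≃ H.S),
    (∀ e, H.ends (g e) = (G.ends e).map f) ∧ ∀ s, H.at_ (h s) = f (G.at_ s)

/-- The degree of a vertex: an ordinary loop counts twice, a special self-loop counts once. -/
noncomputable def degree (G : MultiGraph) (v : G.V) : ℕ :=
  Nat.card {e // v ∈ G.ends e} + Nat.card {e // G.ends e = s(v, v)} + Nat.card {s // G.at_ s = v}

/-- `w` lies in the connected component of `v`. -/
def Reachable (G : MultiGraph) : G.V → G.V → Prop :=
  Relation.ReflTransGen fun v w => ∃ e, G.ends e = s(v, w)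

/-- The connected component of `v` is a cycle (of length at least one): all of its vertices have
degree two and it has no special self-loop. -/
def OnDisjointCycle (G : MultiGraph) (v : G.V) : Prop :=
  ∀ w, G.Reachable v w → G.degree w = 2 ∧ ∀ s, G.at_ s ≠ w

/-- The multigraph obtained by deleting all disjoint cycles, that is, all connected components
which are cycles. -/
def deleteCycles (G : MultiGraph) : MultiGraph where
  V := {v // ¬ G.OnDisjointCycle v}
  E := {e // ∀ v ∈ G.ends e, ¬ G.OnDisjointCycle v}
  S := {s // ¬ G.OnDisjointCycle (G.at_ s)}
  finV := inferInstance
  finE := inferInstance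
  finS := inferInstance
  ends := fun e => (G.ends e.1).attachWith e.2
  at_ := fun s => ⟨G.at_ s.1, s.2⟩

/-- The multigraph obtained from `G` by replacing every ordinary edge `e` by a path with `ℓ e`
edges and every special self-loop `s`, sitting at `u`, by a path `u = v₀, …, v_k` with
`k = ℓ s - 1` ordinary edges, followed by a special self-loop at `v_k`. Here all `ℓ` are meant to
be at least `1`. The `ℓ - 1` inserted vertices have degree two, and the degrees of the old vertices
do not change. An ordinary edge is traversed in an arbitrarily chosen direction, which is
irrelevant up to isomorphism. -/
noncomputable def subdivide (G : MultiGraph) (ℓ : G.E ⊕ G.S → ℕ) : MultiGraph where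
  V := G.V ⊕ (Σ a : G.E ⊕ G.S, Fin (ℓ a - 1))
  E := (Σ e : G.E, Fin (ℓ (.inl e))) ⊕ (Σ s : G.S, Fin (ℓ (.inr s) - 1))
  S := G.S
  finV := inferInstance
  finE := inferInstance
  finS := inferInstance
  ends
    | .inl ⟨e, i⟩ =>
      -- position `j` on the path replacing `e`, for `0 ≤ j ≤ ℓ e`
      let pos : ℕ → G.V ⊕ (Σ a : G.E ⊕ G.S, Fin (ℓ a - 1)) := fun j =>
        if j = 0 then .inl (Quot.out (G.ends e)).1
        else if h : j - 1 < ℓ (.inl e) - 1 then .inr ⟨.inl e, ⟨j - 1, h⟩⟩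
        else .inl (Quot.out (G.ends e)).2
      s(pos i, pos (i + 1))
    | .inr ⟨s, i⟩ =>
      -- the `i`-th edge on the path starting at the base of `s`
      s(if h : i.1 = 0 then .inl (G.at_ s)
        else .inr ⟨.inr s, ⟨i.1 - 1, by have := i.2; omega⟩⟩, .inr ⟨.inr s, i⟩)
  at_ := fun s =>
    if h : ℓ (.inr s) - 1 = 0 then .inl (G.at_ s)
    else .inr ⟨.inr s, ⟨ℓ (.inr s) - 2, by omega⟩⟩

end MultiGraph

/-- The half-edges, when the vertex `v` is given `d v` of them. -/
abbrev HalfEdge {V : Type} (d : V → ℕ) : Type := Σ v : V, Fin (d v)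

/-- The pairings of the points of `D`: involutions without a fixed point if the number of points
is even, with exactly one fixed point if it is odd. -/
def Pairing (D : Type) : Type :=
  {σ : Equiv.Perm D // Function.Involutive σ ∧ Nat.card {a // σ a = a} = Nat.card D % 2}

/-- The multigraph of the configuration model. Each pair of matched half-edges becomes an
edge, and an unmatched half-edge becomes a special self-loop. -/
def configGraph {V : Type} [Finite V] (d : V → ℕ) (σ : Pairing (HalfEdge d)) : MultiGraph where
  V := V
  E := {e : Sym2 (HalfEdge d) // ∃ a, σ.1 a ≠ a ∧ e = s(a, σ.1 a)}
  S := {a : HalfEdge d // σ.1 a = a}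
  finV := inferInstance
  finE := inferInstance
  finS := inferInstance
  ends := fun e => e.1.map Sigma.fst
  at_ := fun a => a.1.1

/-- The expectation of `f` at a uniformly chosen point of a finite nonempty type. -/
noncomputable def unifExp {X : Type} (f : X → ℝ≥0∞) : ℝ≥0∞ :=
  (∑' x, f x) / (Nat.card X : ℝ≥0∞)

/-- The expectation of `f d`, where `Λ` is normal with mean `1 + ε - μ` and variance `1 / (ε n)`
and, given `Λ`, the coordinates of `d = (D_u)` are i.i.d. Poisson of mean `Λ` (of mean `0` on the
event that `Λ` is negative). -/
noncomputable def degreeExp (n : ℕ) (ε μ : ℝ) (f : (Fin n → ℕ) → ℝ≥0∞) : ℝ≥0∞ :=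
  ∫⁻ x, ∫⁻ d, f d ∂(Measure.pi fun _ : Fin n => poissonMeasure x.toNNReal)
    ∂(gaussianReal (1 + ε - μ) (1 / (ε * n)).toNNReal)

/-- The sequence of those degrees `d u` which are at least `k`. -/
def degreesFrom {n : ℕ} (k : ℕ) (d : Fin n → ℕ) : {u // k ≤ d u} → ℕ := fun u => d u.1

/-- The probability that the Poisson-configuration model, with its disjoint cycles deleted,
belongs to `A`. Given the degrees, the model is the multigraph of a uniform pairing of the
half-edges of the vertices of degree at least two. -/
noncomputable def poissonConfigurationProb (n : ℕ) (ε μ : ℝ) (A : Set MultiGraph) : ℝ≥0∞ :=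
  degreeExp n ε μ fun d => unifExp fun σ : Pairing (HalfEdge (degreesFrom 2 d)) =>
    A.indicator 1 (configGraph (degreesFrom 2 d) σ).deleteCycles

/-- The geometric distribution on `{1, 2, …}` with success probability `q ∈ (0, 1]`. -/
noncomputable def geomLaw (q : ℝ) : Measure ℕ :=
  (geometricMeasure (Set.projIcc 0 1 zero_le_one q)).map (· + 1)

open Classical in
/-- The probability that `G`, with its edges replaced by paths of i.i.d. `geomLaw q` lengths,
belongs to `A`. -/
noncomputable def geomExpansionProb (q : ℝ) (G : MultiGraph) (A : Set MultiGraph) : ℝ≥0∞ :=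
  letI : Fintype (G.E ⊕ G.S) := Fintype.ofFinite _
  (Measure.pi fun _ : G.E ⊕ G.S => geomLaw q) {ℓ | G.subdivide ℓ ∈ A}

/-- The probability that the Poisson-geometric model belongs to `A`. Given the degrees, the
kernel is the multigraph of a uniform pairing of the half-edges of the vertices of degree at
least three, and its edges are replaced by paths of i.i.d. geometric lengths of mean
`1 / (1 - μ)`. -/
noncomputable def poissonGeometricProb (n : ℕ) (ε μ : ℝ) (A : Set MultiGraph) : ℝ≥0∞ :=
  degreeExp n ε μ fun d => unifExp fun σ : Pairing (HalfEdge (degreesFrom 3 d)) =>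
    geomExpansionProb (1 - μ) (configGraph (degreesFrom 3 d) σ) A

/-! Fix the degrees. Let κ be the degrees that are at least three, M their sum, m = ⌈M/2⌉ the number
of links (edges and special self-loops) of the kernel, and j the number of vertices of degree two. A
uniform pairing can be built by adding the vertices of degree two one at a time: the new vertex
subdivides each present link with weight 2 and becomes an isolated loop with weight 1. A vertex put
on a disjoint cycle disappears with that cycle. So only the number k of vertices on kernel links
matters, and k is an urn process: with j vertices inserted, it rises with weight 2(m + k) and stays
with weight 2(j - k) + 1. Given k, all arrangements of the k vertices on the m links are equally
likely (`expansionSum_insertionSum`, `tsum_deleteCycles_eq`). Independent geometric lengths have the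
same property, each arrangement having probability (1 - μ)^m μ^k (`geomExpansionProb_eq`). Hence
both models are mixtures of the same laws, indexed by (κ, k), and only the laws of (κ, k) must be
compared.

In the geometric model k is negative binomial given κ. In the configuration model the mass of (κ, k)
is the sum over j of an urn probability times P(κ, j). For typical (κ, k) it is at most a constant
times the geometric mass, by three estimates. (1) The urn spends at most two steps on average at
level k (`sum_insertionProb_le`). (2) P(κ, j, Λ typical) ≤ C P(κ) / √(εn) for every j
(`Regime.lintegral_kernelLaw_le`). Given κ, the variable Λ has density at most of order √(εn), since
moving Λ by 1/√(εn) in both directions costs only a constant factor. Given Λ and κ, j is binomial,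
and a binomial probability integrated over its parameter is at most of order 1/(εn). (3) Typical
values k have negative binomial probability at least c / √(εn) (`Regime.le_multichoose`), by
Stirling's formula.

It remains to see that atypical parameters are rare. Chebyshev's inequality controls Λ, M ≍ ε³n, and
j. The duality of μ and 1 + ε makes the expected number of vertices of degree two agree with the
negative binomial mean (`IsDual.meanDiff_eq_zero`). On average j / (2m + 1) vertices end up on
disjoint cycles (`sum_insertionProb_mul_sub`), which is of order 1/ε and thus negligible against
√(εn). Altogether P(H ∈ A) ≤ 4/K² + C(K) P(H̃ ∈ A) for every K, once ε³n is large
(`Regime.poissonConfigurationProb_le`), and contiguity follows. -/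

namespace MultiGraph

/-! ### Isomorphism of multigraphs -/

theorem Iso.refl (G : MultiGraph) : Iso G G :=
  ⟨Equiv.refl _, Equiv.refl _, Equiv.refl _, fun e => by simp, fun _ => rfl⟩

theorem Iso.symm {G H : MultiGraph} : Iso G H → Iso H G := by
  rintro ⟨f, g, h, hE, hS⟩
  refine ⟨f.symm, g.symm, h.symm, fun e => ?_, fun s => ?_⟩
  · have := hE (g.symm e)
    rw [Equiv.apply_symm_apply] at this
    rw [this, Sym2.map_map, Equiv.symm_comp_self, Sym2.map_id, id]
  · rw [Equiv.eq_symm_apply, ← hS, Equiv.apply_symm_apply]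

theorem Iso.trans {G H K : MultiGraph} : Iso G H → Iso H K → Iso G K := by
  rintro ⟨f, g, h, hE, hS⟩ ⟨f', g', h', hE', hS'⟩
  refine ⟨f.trans f', g.trans g', h.trans h', fun e => ?_, fun s => ?_⟩
  · simp [hE, hE', Sym2.map_map]
  · simp [hS, hS']

theorem Iso.of_bijective {G H : MultiGraph} (f : G.V → H.V) (g : G.E → H.E) (h : G.S → H.S)
    (hf : f.Bijective) (hg : g.Bijective) (hh : h.Bijective)
    (hE : ∀ e, H.ends (g e) = (G.ends e).map f) (hS : ∀ s, H.at_ (h s) = f (G.at_ s)) :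
    Iso G H :=
  ⟨Equiv.ofBijective f hf, Equiv.ofBijective g hg, Equiv.ofBijective h hh, hE, hS⟩

/-! ### Degrees -/

open Classical in
/-- How often `v` occurs among the two endpoints `z`. -/
noncomputable def mult {V : Type} (v : V) (z : Sym2 V) : ℕ :=
  (if v ∈ z then 1 else 0) + if z = s(v, v) then 1 else 0

open Classical in
theorem mult_mk {V : Type} (v x y : V) :
    mult v s(x, y) = (if x = v then 1 else 0) + if y = v then 1 else 0 := by
  unfold mult
  by_cases hx : x = v <;> by_cases hy : y = v <;>
    simp_all [eq_comm]

theorem mult_map {V W : Type} {f : V → W} (hf : f.Injective) (v : V) (z : Sym2 V) :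
    mult (f v) (z.map f) = mult v z := by
  classical
  induction z with
  | _ x y =>
    simp only [Sym2.map_mk, mult_mk, hf.eq_iff]

theorem mult_map_of_forall_ne {V W : Type} {f : V → W} {w : W} (hw : ∀ v, f v ≠ w) (z : Sym2 V) :
    mult w (z.map f) = 0 := by
  induction z with
  | _ x y => simp [mult_mk, hw]

-- In this form the degree is additive over edges and special self-loops, so the effect of changing
-- a single link can be read off term by term.
open Classical in
theorem degree_eq_sum (G : MultiGraph) [Fintype G.E] [Fintype G.S] (v : G.V) :
    G.degree v = ∑ e, mult v (G.ends e) + ∑ s, if G.at_ s = v then 1 else 0 := by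
  simp only [degree, mult, Finset.sum_add_distrib, Finset.sum_boole, Nat.card_eq_fintype_card,
    Fintype.card_subtype, Nat.cast_id]

theorem degree_eq_of_iso {G H : MultiGraph} (f : G.V ≃ H.V) (g : G.E ≃ H.E) (h : G.S ≃ H.S)
    (hE : ∀ e, H.ends (g e) = (G.ends e).map f) (hS : ∀ s, H.at_ (h s) = f (G.at_ s)) (v : G.V) :
    H.degree (f v) = G.degree v := by
  classical
  let _ := Fintype.ofFinite G.E
  let _ := Fintype.ofFinite H.E
  let _ := Fintype.ofFinite G.S
  let _ := Fintype.ofFinite H.S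
  rw [degree_eq_sum, degree_eq_sum, ← g.sum_comp, ← h.sum_comp]
  simp [hE, hS, mult_map f.injective]

/-! ### Connectivity and disjoint cycles -/

theorem Reachable.single {G : MultiGraph} {v w : G.V} {e : G.E} (h : G.ends e = s(v, w)) :
    G.Reachable v w :=
  Relation.ReflTransGen.single ⟨e, h⟩

theorem OnDisjointCycle.of_reachable {G : MultiGraph} {v w : G.V} (h : G.OnDisjointCycle v)
    (hvw : G.Reachable v w) : G.OnDisjointCycle w :=
  fun u hu => h u (hvw.trans hu)

theorem onDisjointCycle_iff_of_ends {G : MultiGraph} {v w : G.V} {e : G.E}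
    (h : G.ends e = s(v, w)) : G.OnDisjointCycle v ↔ G.OnDisjointCycle w :=
  ⟨fun hv => hv.of_reachable (.single h), fun hw => hw.of_reachable (.single (h.trans Sym2.eq_swap))⟩

theorem onDisjointCycle_of_iso {G H : MultiGraph} (f : G.V ≃ H.V) (g : G.E ≃ H.E) (h : G.S ≃ H.S)
    (hE : ∀ e, H.ends (g e) = (G.ends e).map f) (hS : ∀ s, H.at_ (h s) = f (G.at_ s)) {v : G.V}
    (hv : H.OnDisjointCycle (f v)) : G.OnDisjointCycle v := by
  intro w hw
  have hr : H.Reachable (f v) (f w) := by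
    refine Relation.ReflTransGen.lift f ?_ _ _ hw
    rintro a b ⟨e, he⟩
    exact ⟨g e, by rw [hE, he, Sym2.map_mk]⟩
  obtain ⟨h1, h2⟩ := hv _ hr
  refine ⟨by rwa [degree_eq_of_iso f g h hE hS] at h1, fun s hs => h2 (h s) ?_⟩
  rw [hS, hs]

/-- A criterion for a multigraph to be isomorphic to `G` with its disjoint cycles deleted. -/
theorem iso_deleteCycles {G H : MultiGraph} (f : H.V → G.V) (g : H.E → G.E) (h : H.S → G.S)
    (hf : f.Injective) (hg : g.Injective) (hh : h.Injective)
    (hE : ∀ e, G.ends (g e) = (H.ends e).map f) (hS : ∀ s, G.at_ (h s) = f (H.at_ s))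
    (hf' : ∀ v, ¬ G.OnDisjointCycle (f v)) (hV : ∀ w, ¬ G.OnDisjointCycle w → ∃ v, f v = w)
    (hg' : ∀ e, (∀ v ∈ G.ends e, ¬ G.OnDisjointCycle v) → ∃ e', g e' = e)
    (hh' : ∀ s, ¬ G.OnDisjointCycle (G.at_ s) → ∃ s', h s' = s) :
    Iso H G.deleteCycles := by
  refine Iso.of_bijective (H := G.deleteCycles) (fun v => ⟨f v, hf' v⟩)
    (fun e => ⟨g e, fun v hv => ?_⟩) (fun s => ⟨h s, ?_⟩)
    ⟨fun a b hab => hf (Subtype.ext_iff.1 hab), fun w => ?_⟩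
    ⟨fun a b hab => hg (Subtype.ext_iff.1 hab), fun e => ?_⟩
    ⟨fun a b hab => hh (Subtype.ext_iff.1 hab), fun s => ?_⟩ (fun e => ?_) fun s => ?_
  · rw [hE, Sym2.mem_map] at hv
    obtain ⟨w, -, rfl⟩ := hv
    exact hf' w
  · rw [hS]; exact hf' _
  · obtain ⟨v, hv⟩ := hV _ w.2
    exact ⟨v, Subtype.ext hv⟩
  · obtain ⟨v, hv⟩ := hg' _ e.2
    exact ⟨v, Subtype.ext hv⟩
  · obtain ⟨v, hv⟩ := hh' _ s.2
    exact ⟨v, Subtype.ext hv⟩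
  · refine Sym2.map.injective Subtype.val_injective ?_
    simp only [deleteCycles, Sym2.attachWith_map_subtypeVal, Sym2.map_map, hE]
    rfl
  · exact Subtype.ext (hS s)

theorem map_val_ends_deleteCycles (G : MultiGraph) (e : G.deleteCycles.E) :
    (G.deleteCycles.ends e).map Subtype.val = G.ends e.1 := by
  simp only [deleteCycles, Sym2.attachWith_map_subtypeVal]

theorem Iso.deleteCycles {G H : MultiGraph} : Iso G H → Iso G.deleteCycles H.deleteCycles := by
  rintro ⟨f, g, h, hE, hS⟩
  have key : ∀ v, H.OnDisjointCycle (f v) ↔ G.OnDisjointCycle v := fun v => by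
    refine ⟨onDisjointCycle_of_iso f g h hE hS, fun hv => ?_⟩
    refine onDisjointCycle_of_iso f.symm g.symm h.symm (fun e => ?_) (fun s => ?_) (by simpa using hv)
    · have := hE (g.symm e)
      rw [Equiv.apply_symm_apply] at this
      rw [this, Sym2.map_map, Equiv.symm_comp_self, Sym2.map_id, id]
    · rw [Equiv.eq_symm_apply, ← hS, Equiv.apply_symm_apply]
  refine iso_deleteCycles (H := G.deleteCycles) (fun v => f v.1) (fun e => g e.1) (fun s => h s.1)
    (f.injective.comp Subtype.val_injective) (g.injective.comp Subtype.val_injective)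
    (h.injective.comp Subtype.val_injective) (fun e => ?_) (fun s => hS _)
    (fun v => by rw [key]; exact v.2) (fun w hw => ?_) (fun e he => ?_) fun s hs => ?_
  · rw [hE, ← map_val_ends_deleteCycles]
    exact Sym2.map_map _
  · obtain ⟨v, rfl⟩ := f.surjective w
    exact ⟨⟨v, by rwa [← key]⟩, rfl⟩
  · obtain ⟨e, rfl⟩ := g.surjective e
    refine ⟨⟨e, fun v hv => ?_⟩, rfl⟩
    rw [← key]
    exact he _ (by rw [hE]; exact Sym2.mem_map.2 ⟨v, hv, rfl⟩)
  · obtain ⟨s, rfl⟩ := h.surjective s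
    rw [hS, key] at hs
    exact ⟨⟨s, hs⟩, rfl⟩

theorem iso_deleteCycles_self {G : MultiGraph} (h : ∀ v, ¬ G.OnDisjointCycle v) :
    Iso G G.deleteCycles :=
  iso_deleteCycles id id id Function.injective_id Function.injective_id Function.injective_id
    (fun e => by simp) (fun _ => rfl) h (fun w _ => ⟨w, rfl⟩) (fun e _ => ⟨e, rfl⟩)
    fun s _ => ⟨s, rfl⟩

/-! ### Inserting a vertex of degree two -/

/-- The disjoint union of `G` and a vertex with a loop. -/
abbrev addLoop (G : MultiGraph) : MultiGraph where
  V := Option G.V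
  E := Option G.E
  S := G.S
  finV := inferInstance
  finE := inferInstance
  finS := inferInstance
  ends
    | none => s(none, none)
    | some e => (G.ends e).map some
  at_ := fun s => some (G.at_ s)

open Classical in
/-- Put a new vertex on the edge `e`, which is meant to join `x` and `y`. -/
noncomputable abbrev insertEdge (G : MultiGraph) (e : G.E) (x y : G.V) : MultiGraph where
  V := Option G.V
  E := Option G.E
  S := G.S
  finV := inferInstance
  finE := inferInstance
  finS := inferInstance
  ends
    | none => s(none, some y)
    | some e' => if e' = e then s(some x, none) else (G.ends e').map some
  at_ := fun s => some (G.at_ s)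

open Classical in
/-- Put a new vertex on the special self-loop `s`. -/
noncomputable abbrev insertSpecial (G : MultiGraph) (s : G.S) : MultiGraph where
  V := Option G.V
  E := Option G.E
  S := G.S
  finV := inferInstance
  finE := inferInstance
  finS := inferInstance
  ends
    | none => s(some (G.at_ s), none)
    | some e => (G.ends e).map some
  at_ := fun s' => if s' = s then none else some (G.at_ s')

/-- Put a new vertex on an edge or on a special self-loop. -/
noncomputable def insertVertex (G : MultiGraph) : G.E ⊕ G.S → MultiGraph
  | .inl e => G.insertEdge e (Quot.out (G.ends e)).1 (Quot.out (G.ends e)).2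
  | .inr s => G.insertSpecial s

theorem ends_eq_out (G : MultiGraph) (e : G.E) :
    G.ends e = s((Quot.out (G.ends e)).1, (Quot.out (G.ends e)).2) :=
  (Quot.out_eq (G.ends e)).symm

theorem Iso.insertEdge {G H : MultiGraph} (f : G.V ≃ H.V) (g : G.E ≃ H.E) (h : G.S ≃ H.S)
    (hE : ∀ e, H.ends (g e) = (G.ends e).map f) (hS : ∀ s, H.at_ (h s) = f (G.at_ s))
    (e : G.E) (x y : G.V) : Iso (G.insertEdge e x y) (H.insertEdge (g e) (f x) (f y)) := by
  refine ⟨f.optionCongr, g.optionCongr, h, fun e' => ?_, fun s => ?_⟩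
  · rcases e' with _ | e'
    · rfl
    · by_cases he : e' = e
      · simp [he]
      · simp only [Equiv.optionCongr_apply, Option.map_some,
          EmbeddingLike.apply_eq_iff_eq, he, if_false, hE, Sym2.map_map]
        rfl
  · simp [hS]

/-- Exchanging the endpoints only exchanges the names of the two halves of the cut edge. Hence the
orientation picked by `Quot.out` in `insertVertex` does not matter. -/
theorem insertEdge_swap (G : MultiGraph) (e : G.E) (x y : G.V) :
    Iso (G.insertEdge e x y) (G.insertEdge e y x) := by
  classical
  refine ⟨Equiv.refl _, Equiv.swap none (some e), Equiv.refl _, fun e' => ?_, fun s => rfl⟩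
  rcases e' with _ | e'
  · simp [Sym2.eq_swap]
  · by_cases he : e' = e
    · simp [he, Sym2.eq_swap]
    · rw [Equiv.swap_apply_of_ne_of_ne (by simp) (by simpa using he)]
      simp [he]

theorem insertEdge_iso_insertVertex {G : MultiGraph} {e : G.E} {x y : G.V}
    (h : G.ends e = s(x, y)) : Iso (G.insertEdge e x y) (G.insertVertex (.inl e)) := by
  have h' := h.symm.trans (G.ends_eq_out e)
  rw [Sym2.eq_iff] at h'
  rcases h' with ⟨h1, h2⟩ | ⟨h1, h2⟩
  · rw [insertVertex, ← h1, ← h2]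
    exact Iso.refl _
  · rw [insertVertex, ← h1, ← h2]
    exact insertEdge_swap _ _ _ _

theorem Iso.insertSpecial {G H : MultiGraph} (f : G.V ≃ H.V) (g : G.E ≃ H.E) (h : G.S ≃ H.S)
    (hE : ∀ e, H.ends (g e) = (G.ends e).map f) (hS : ∀ s, H.at_ (h s) = f (G.at_ s))
    (s : G.S) : Iso (G.insertSpecial s) (H.insertSpecial (h s)) := by
  refine ⟨f.optionCongr, g.optionCongr, h, fun e' => ?_, fun s' => ?_⟩
  · rcases e' with _ | e'
    · simp [hS]
    · simp only [Equiv.optionCongr_apply, Option.map_some, hE, Sym2.map_map]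
      rfl
  · by_cases hs : s' = s <;> simp [hs, hS]

theorem Iso.insertVertex {G H : MultiGraph} (f : G.V ≃ H.V) (g : G.E ≃ H.E) (h : G.S ≃ H.S)
    (hE : ∀ e, H.ends (g e) = (G.ends e).map f) (hS : ∀ s, H.at_ (h s) = f (G.at_ s))
    (a : G.E ⊕ G.S) : Iso (G.insertVertex a) (H.insertVertex (g.sumCongr h a)) := by
  rcases a with e | s
  · refine (Iso.insertEdge f g h hE hS _ _ _).trans (insertEdge_iso_insertVertex ?_)
    rw [hE]
    conv_lhs => rw [G.ends_eq_out e]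
    rw [Sym2.map_mk]
  · exact Iso.insertSpecial f g h hE hS s

/-! ### Disjoint cycles after the insertion of a vertex -/

theorem degree_addLoop_some (G : MultiGraph) (v : G.V) :
    G.addLoop.degree (some v) = G.degree v := by
  classical
  let _ := Fintype.ofFinite G.E
  let _ := Fintype.ofFinite G.S
  rw [degree_eq_sum, degree_eq_sum, Fintype.sum_option]
  simp [mult_mk, mult_map (Option.some_injective _)]

theorem degree_addLoop_none (G : MultiGraph) : G.addLoop.degree none = 2 := by
  classical
  let _ := Fintype.ofFinite G.E
  let _ := Fintype.ofFinite G.S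
  rw [degree_eq_sum, Fintype.sum_option]
  simp [mult_mk, mult_map_of_forall_ne]

theorem degree_insertEdge_some {G : MultiGraph} {e : G.E} {x y : G.V} (he : G.ends e = s(x, y))
    (v : G.V) : (G.insertEdge e x y).degree (some v) = G.degree v := by
  classical
  let _ := Fintype.ofFinite G.E
  let _ := Fintype.ofFinite G.S
  rw [degree_eq_sum, degree_eq_sum, Fintype.sum_option, ← Finset.add_sum_erase _ _ (Finset.mem_univ e),
    ← Finset.add_sum_erase _ (fun e => mult v (G.ends e)) (Finset.mem_univ e)]
  have h : ∀ e' ∈ Finset.univ.erase e, mult (some v)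
      (if e' = e then s(some x, none) else (G.ends e').map some) = mult v (G.ends e') := by
    intro e' he'
    rw [if_neg (Finset.ne_of_mem_erase he'), mult_map (Option.some_injective _)]
  rw [Finset.sum_congr rfl h]
  simp [mult_mk, he]
  ring

theorem degree_insertEdge_none (G : MultiGraph) (e : G.E) (x y : G.V) :
    (G.insertEdge e x y).degree none = 2 := by
  classical
  let _ := Fintype.ofFinite G.E
  let _ := Fintype.ofFinite G.S
  rw [degree_eq_sum, Fintype.sum_option, ← Finset.add_sum_erase _ _ (Finset.mem_univ e)]
  have h : ∀ e' ∈ Finset.univ.erase e, mult (none : Option G.V)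
      (if e' = e then s(some x, none) else (G.ends e').map some) = 0 := by
    intro e' he'
    rw [if_neg (Finset.ne_of_mem_erase he'), mult_map_of_forall_ne (by simp)]
  rw [Finset.sum_congr rfl h]
  simp [mult_mk]

theorem degree_insertSpecial_some (G : MultiGraph) (s : G.S) (v : G.V) :
    (G.insertSpecial s).degree (some v) = G.degree v := by
  classical
  let _ := Fintype.ofFinite G.E
  let _ := Fintype.ofFinite G.S
  rw [degree_eq_sum, degree_eq_sum, Fintype.sum_option, ← Finset.add_sum_erase _ _ (Finset.mem_univ s),
    ← Finset.add_sum_erase _ (fun s => if G.at_ s = v then 1 else 0) (Finset.mem_univ s)]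
  have h : ∀ s' ∈ Finset.univ.erase s, (@ite ℕ ((G.insertSpecial s).at_ s' = some v)
      (Classical.propDecidable _) 1 0) = if G.at_ s' = v then 1 else 0 := by
    intro s' hs'
    simp [if_neg (Finset.ne_of_mem_erase hs')]
  rw [Finset.sum_congr rfl h]
  simp [mult_mk, mult_map (Option.some_injective _)]
  ring

theorem exists_of_map_some_eq {V : Type} {z : Sym2 V} {a : V} {w : Option V}
    (h : z.map some = s(some a, w)) : ∃ b, w = some b ∧ z = s(a, b) := by
  induction z with
  | _ x y =>
    rw [Sym2.map_mk, Sym2.eq_iff] at h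
    rcases h with ⟨h1, rfl⟩ | ⟨rfl, h1⟩
    · exact ⟨y, rfl, by rw [Option.some_inj.1 h1]⟩
    · exact ⟨x, rfl, by rw [Option.some_inj.1 h1, Sym2.eq_swap]⟩

theorem map_some_ne {V : Type} {z : Sym2 V} {w : Option V} : z.map some ≠ s(none, w) := by
  induction z with
  | _ x y => simp

theorem onDisjointCycle_addLoop_some {G : MultiGraph} {v : G.V} :
    G.addLoop.OnDisjointCycle (some v) ↔ G.OnDisjointCycle v := by
  have h1 {w} (h : G.Reachable v w) : G.addLoop.Reachable (some v) (some w) :=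
    Relation.ReflTransGen.lift some (fun a b ⟨e, he⟩ => ⟨some e, by simp [he]⟩) _ _ h
  have h2 {z : Option G.V} (h : G.addLoop.Reachable (some v) z) :
      ∃ w, z = some w ∧ G.Reachable v w := by
    induction h with
    | refl => exact ⟨v, rfl, .refl⟩
    | tail _ hs ih =>
      obtain ⟨w, rfl, hw⟩ := ih
      obtain ⟨e, he⟩ := hs
      rcases e with _ | e
      · simp at he
      · obtain ⟨b, rfl, hb⟩ := exists_of_map_some_eq he
        exact ⟨b, rfl, hw.tail ⟨e, hb⟩⟩
  constructor
  · intro h w hw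
    obtain ⟨ha, hb⟩ := h _ (h1 hw)
    exact ⟨by rwa [degree_addLoop_some] at ha, fun s hs => hb s (by simp [hs])⟩
  · intro h z hz
    obtain ⟨w, rfl, hw⟩ := h2 hz
    obtain ⟨ha, hb⟩ := h _ hw
    exact ⟨by rwa [degree_addLoop_some], fun s hs => hb s (by simpa using hs)⟩

theorem onDisjointCycle_addLoop_none (G : MultiGraph) : G.addLoop.OnDisjointCycle none := by
  intro z hz
  have : z = none := by
    induction hz with
    | refl => rfl
    | tail _ hs ih =>
      subst ih
      obtain ⟨e, he⟩ := hs
      rcases e with _ | e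
      · simpa [Sym2.eq_iff, eq_comm] using he
      · exact absurd he map_some_ne
  subst this
  exact ⟨degree_addLoop_none G, fun s hs => by simp at hs⟩

theorem deleteCycles_addLoop (G : MultiGraph) : Iso G.deleteCycles G.addLoop.deleteCycles := by
  refine iso_deleteCycles (H := G.deleteCycles) (fun v => some v.1) (fun e => some e.1) (fun s => s.1)
    (fun a b h => Subtype.ext (Option.some_inj.1 h)) (fun a b h => Subtype.ext (Option.some_inj.1 h))
    Subtype.val_injective (fun e => ?_) (fun s => rfl)
    (fun v => by rw [onDisjointCycle_addLoop_some]; exact v.2) (fun w hw => ?_) (fun e he => ?_)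
    fun s hs => ?_
  · change (G.ends e.1).map some = _
    rw [← map_val_ends_deleteCycles]
    exact Sym2.map_map _
  · rcases w with _ | w
    · exact absurd (onDisjointCycle_addLoop_none G) hw
    · exact ⟨⟨w, by rwa [onDisjointCycle_addLoop_some] at hw⟩, rfl⟩
  · rcases e with _ | e
    · exact absurd (onDisjointCycle_addLoop_none G) (he none (by simp))
    · refine ⟨⟨e, fun v hv => ?_⟩, rfl⟩
      rw [← onDisjointCycle_addLoop_some]
      exact he _ (Sym2.mem_map.2 ⟨v, hv, rfl⟩)
  · rw [onDisjointCycle_addLoop_some] at hs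
    exact ⟨⟨s, hs⟩, rfl⟩

section InsertEdge

variable {G : MultiGraph} {e : G.E} {x y : G.V}

theorem ends_insertEdge_of_ne (x y : G.V) {e' : G.E} (h : e' ≠ e) :
    (G.insertEdge e x y).ends (some e') = (G.ends e').map some :=
  if_neg h

theorem ends_insertEdge_self (e : G.E) (x y : G.V) :
    (G.insertEdge e x y).ends (some e) = s(some x, none) :=
  if_pos rfl

theorem reachable_insertEdge (he : G.ends e = s(x, y)) {v w : G.V} (h : G.Reachable v w) :
    (G.insertEdge e x y).Reachable (some v) (some w) := by
  have hxy : (G.insertEdge e x y).Reachable (some x) (some y) :=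
    (Reachable.single (ends_insertEdge_self e x y)).trans (Reachable.single (e := none) rfl)
  have hyx : (G.insertEdge e x y).Reachable (some y) (some x) :=
    (Reachable.single (e := none) Sym2.eq_swap).trans
      (Reachable.single ((ends_insertEdge_self e x y).trans Sym2.eq_swap))
  induction h with
  | refl => exact .refl
  | tail _ hs ih =>
    refine ih.trans ?_
    obtain ⟨e', he'⟩ := hs
    by_cases h : e' = e
    · rw [h, he, Sym2.eq_iff] at he'
      rcases he' with ⟨rfl, rfl⟩ | ⟨rfl, rfl⟩
      exacts [hxy, hyx]
    · exact Reachable.single ((ends_insertEdge_of_ne x y h).trans (by rw [he', Sym2.map_mk]))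

theorem reachable_of_reachable_insertEdge (he : G.ends e = s(x, y)) {v : G.V} {z : Option G.V}
    (h : (G.insertEdge e x y).Reachable (some v) z) :
    (∃ w, z = some w ∧ G.Reachable v w) ∨ z = none := by
  have hx : (∃ w, z = some w ∧ G.Reachable v w) ∨ (z = none ∧ G.Reachable v x) := by
    induction h with
    | refl => exact .inl ⟨v, rfl, .refl⟩
    | tail _ hs ih =>
      obtain ⟨e', he'⟩ := hs
      rcases e' with _ | e'
      · change s(none, some y) = _ at he'
        rw [Sym2.eq_iff] at he'
        rcases he' with ⟨rfl, rfl⟩ | ⟨rfl, rfl⟩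
        · obtain ⟨w, hw, -⟩ | ⟨-, h⟩ := ih
          · simp at hw
          · exact .inl ⟨y, rfl, h.trans (Reachable.single he)⟩
        · obtain ⟨w, hw, h⟩ | ⟨h, -⟩ := ih
          · obtain rfl := Option.some_inj.1 hw
            exact .inr ⟨rfl, h.trans (Reachable.single (he.trans Sym2.eq_swap))⟩
          · simp at h
      · by_cases h : e' = e
        · rw [h, ends_insertEdge_self, Sym2.eq_iff] at he'
          rcases he' with ⟨rfl, rfl⟩ | ⟨rfl, rfl⟩
          · obtain ⟨w, hw, h⟩ | ⟨h, -⟩ := ih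
            · obtain rfl := Option.some_inj.1 hw
              exact .inr ⟨rfl, h⟩
            · simp at h
          · obtain ⟨w, hw, -⟩ | ⟨-, h⟩ := ih
            · simp at hw
            · exact .inl ⟨x, rfl, h⟩
        · rw [ends_insertEdge_of_ne x y h] at he'
          obtain ⟨w, rfl, hw⟩ | ⟨rfl, -⟩ := ih
          · obtain ⟨b, rfl, hb⟩ := exists_of_map_some_eq he'
            exact .inl ⟨b, rfl, hw.tail ⟨e', hb⟩⟩
          · exact absurd he' map_some_ne
  exact hx.imp_right And.left

/-- Old degrees are unchanged, the new vertex has degree two, and components correspond. So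
subdividing an edge neither creates nor destroys disjoint cycles. -/
theorem onDisjointCycle_insertEdge_some (he : G.ends e = s(x, y)) {v : G.V} :
    (G.insertEdge e x y).OnDisjointCycle (some v) ↔ G.OnDisjointCycle v := by
  constructor
  · intro h w hw
    obtain ⟨ha, hb⟩ := h _ (reachable_insertEdge he hw)
    exact ⟨by rwa [degree_insertEdge_some he] at ha, fun s hs => hb s (by simp [hs])⟩
  · intro h z hz
    obtain ⟨w, rfl, hw⟩ | rfl := reachable_of_reachable_insertEdge he hz
    · obtain ⟨ha, hb⟩ := h _ hw
      exact ⟨by rwa [degree_insertEdge_some he], fun s hs => hb s (by simpa using hs)⟩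
    · exact ⟨degree_insertEdge_none G e x y, fun s hs => by simp at hs⟩

theorem onDisjointCycle_insertEdge_none (he : G.ends e = s(x, y)) :
    (G.insertEdge e x y).OnDisjointCycle none ↔ G.OnDisjointCycle x := by
  rw [← onDisjointCycle_insertEdge_some he (v := x)]
  exact (onDisjointCycle_iff_of_ends (ends_insertEdge_self e x y)).symm

/-- The new vertex joins the disjoint cycle through `e` and is deleted together with it. -/
theorem deleteCycles_insertEdge_of_onDisjointCycle (he : G.ends e = s(x, y))
    (hx : G.OnDisjointCycle x) : Iso G.deleteCycles (G.insertEdge e x y).deleteCycles := by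
  have hne (e' : G.deleteCycles.E) : e'.1 ≠ e := by
    rintro h
    exact e'.2 x (by rw [h, he]; simp) hx
  refine iso_deleteCycles (H := G.deleteCycles) (fun v => some v.1) (fun e => some e.1) (fun s => s.1)
    (fun a b h => Subtype.ext (Option.some_inj.1 h)) (fun a b h => Subtype.ext (Option.some_inj.1 h))
    Subtype.val_injective (fun e' => ?_) (fun s => rfl)
    (fun v => by rw [onDisjointCycle_insertEdge_some he]; exact v.2) (fun w hw => ?_)
    (fun e' he' => ?_) fun s hs => ?_
  · rw [ends_insertEdge_of_ne x y (hne e'), ← map_val_ends_deleteCycles]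
    exact Sym2.map_map _
  · rcases w with _ | w
    · exact absurd ((onDisjointCycle_insertEdge_none he).2 hx) hw
    · exact ⟨⟨w, by rwa [onDisjointCycle_insertEdge_some he] at hw⟩, rfl⟩
  · have hnone : (none : Option G.V) ∉ (G.insertEdge e x y).ends e' := fun h =>
      he' _ h ((onDisjointCycle_insertEdge_none he).2 hx)
    rcases e' with _ | e'
    · exact absurd (by simp) hnone
    · by_cases h : e' = e
      · rw [h, ends_insertEdge_self] at hnone
        simp at hnone
      · refine ⟨⟨e', fun v hv => ?_⟩, rfl⟩
        rw [← onDisjointCycle_insertEdge_some he]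
        exact he' _ (by rw [ends_insertEdge_of_ne x y h]; exact Sym2.mem_map.2 ⟨v, hv, rfl⟩)
  · rw [onDisjointCycle_insertEdge_some he] at hs
    exact ⟨⟨s, hs⟩, rfl⟩

theorem deleteCycles_insertEdge (he : G.ends e = s(x, y)) (hx : ¬ G.OnDisjointCycle x)
    (hy : ¬ G.OnDisjointCycle y) (he' : ∀ v ∈ G.ends e, ¬ G.OnDisjointCycle v) :
    Iso (G.deleteCycles.insertEdge ⟨e, he'⟩ ⟨x, hx⟩ ⟨y, hy⟩)
      (G.insertEdge e x y).deleteCycles := by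
  refine iso_deleteCycles (H := G.deleteCycles.insertEdge ⟨e, he'⟩ ⟨x, hx⟩ ⟨y, hy⟩)
    (Option.map Subtype.val) (Option.map Subtype.val) Subtype.val
    (Option.map_injective Subtype.val_injective) (Option.map_injective Subtype.val_injective)
    Subtype.val_injective (fun a => ?_) (fun s => rfl)
    (fun v => ?_) (fun w hw => ?_) (fun a ha => ?_) fun s hs => ?_
  · rcases a with _ | a
    · rfl
    · by_cases h : a = ⟨e, he'⟩
      · subst h
        exact (ends_insertEdge_self e x y).trans
          (congrArg (Sym2.map (Option.map Subtype.val))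
            (ends_insertEdge_self (G := G.deleteCycles) ⟨e, he'⟩ ⟨x, hx⟩ ⟨y, hy⟩).symm)
      · refine Eq.trans ?_ (congrArg _ (ends_insertEdge_of_ne (G := G.deleteCycles) _ _ h).symm)
        refine (ends_insertEdge_of_ne x y fun h' => h (Subtype.ext h')).trans ?_
        rw [← map_val_ends_deleteCycles]
        exact (Sym2.map_map _).trans (Sym2.map_map (f := some)
          (g := Option.map Subtype.val) (G.deleteCycles.ends a)).symm
  · rcases v with _ | v
    · exact (onDisjointCycle_insertEdge_none he).not.2 hx
    · exact (onDisjointCycle_insertEdge_some he).not.2 v.2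
  · rcases w with _ | w
    · exact ⟨none, rfl⟩
    · exact ⟨some ⟨w, (onDisjointCycle_insertEdge_some he).not.1 hw⟩, rfl⟩
  · rcases a with _ | a
    · exact ⟨none, rfl⟩
    · by_cases h : a = e
      · exact ⟨some ⟨e, he'⟩, by rw [h]; rfl⟩
      · refine ⟨some ⟨a, fun v hv => ?_⟩, rfl⟩
        rw [← onDisjointCycle_insertEdge_some he]
        exact ha _ (by rw [ends_insertEdge_of_ne x y h]; exact Sym2.mem_map.2 ⟨v, hv, rfl⟩)
  · rw [onDisjointCycle_insertEdge_some he] at hs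
    exact ⟨⟨s, hs⟩, rfl⟩

end InsertEdge

section InsertSpecial

variable {G : MultiGraph} {s : G.S}

theorem at_insertSpecial_of_ne {s' : G.S} (h : s' ≠ s) :
    (G.insertSpecial s).at_ s' = some (G.at_ s') :=
  if_neg h

theorem at_insertSpecial_self (s : G.S) : (G.insertSpecial s).at_ s = none :=
  if_pos rfl

theorem not_onDisjointCycle_at (s : G.S) : ¬ G.OnDisjointCycle (G.at_ s) :=
  fun h => (h _ .refl).2 s rfl

theorem not_onDisjointCycle_insertSpecial_none :
    ¬ (G.insertSpecial s).OnDisjointCycle none :=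
  fun h => (h _ .refl).2 s (at_insertSpecial_self s)

/-- A component with a special self-loop is never a cycle. Therefore a walk from a vertex on a
disjoint cycle cannot meet the base of `s`, and never uses the new edge. -/
theorem onDisjointCycle_insertSpecial_some {v : G.V} :
    (G.insertSpecial s).OnDisjointCycle (some v) ↔ G.OnDisjointCycle v := by
  have hs : ¬ (G.insertSpecial s).OnDisjointCycle (some (G.at_ s)) :=
    (onDisjointCycle_iff_of_ends (G := G.insertSpecial s) (e := none) rfl).not.2
      not_onDisjointCycle_insertSpecial_none
  have h1 {w} (h : G.Reachable v w) : (G.insertSpecial s).Reachable (some v) (some w) :=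
    Relation.ReflTransGen.lift some (fun a b ⟨e, he⟩ => ⟨some e, by simp [he]⟩) _ _ h
  constructor
  · intro h w hw
    have hw' := h1 hw
    obtain ⟨ha, hb⟩ := h _ hw'
    refine ⟨by rwa [degree_insertSpecial_some] at ha, fun s' hs' => ?_⟩
    by_cases h' : s' = s
    · subst h'
      exact hs (by rw [hs']; exact h.of_reachable hw')
    · exact hb s' (by rw [at_insertSpecial_of_ne h', hs'])
  · intro h
    have h2 {z : Option G.V} (hz : (G.insertSpecial s).Reachable (some v) z) :
        ∃ w, z = some w ∧ G.Reachable v w := by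
      induction hz with
      | refl => exact ⟨v, rfl, .refl⟩
      | tail _ hstep ih =>
        obtain ⟨w, rfl, hw⟩ := ih
        obtain ⟨e, he⟩ := hstep
        rcases e with _ | e
        · change s(some (G.at_ s), none) = _ at he
          rw [Sym2.eq_iff] at he
          rcases he with ⟨h', -⟩ | ⟨-, h'⟩
          · obtain rfl := Option.some_inj.1 h'
            exact absurd (h.of_reachable hw) (not_onDisjointCycle_at s)
          · simp at h'
        · obtain ⟨b, rfl, hb⟩ := exists_of_map_some_eq he
          exact ⟨b, rfl, hw.tail ⟨e, hb⟩⟩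
    intro z hz
    obtain ⟨w, rfl, hw⟩ := h2 hz
    obtain ⟨ha, hb⟩ := h _ hw
    refine ⟨by rwa [degree_insertSpecial_some], fun s' hs' => ?_⟩
    by_cases h' : s' = s
    · rw [h', at_insertSpecial_self] at hs'
      simp at hs'
    · exact hb s' (Option.some_inj.1 ((at_insertSpecial_of_ne (G := G) h').symm.trans hs'))

theorem deleteCycles_insertSpecial (s : G.S) :
    Iso (G.deleteCycles.insertSpecial ⟨s, not_onDisjointCycle_at s⟩)
      (G.insertSpecial s).deleteCycles := by
  refine iso_deleteCycles (H := G.deleteCycles.insertSpecial ⟨s, not_onDisjointCycle_at s⟩)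
    (Option.map Subtype.val) (Option.map Subtype.val) Subtype.val
    (Option.map_injective Subtype.val_injective) (Option.map_injective Subtype.val_injective)
    Subtype.val_injective (fun a => ?_) (fun s' => ?_)
    (fun v => ?_) (fun w hw => ?_) (fun a ha => ?_) fun s' hs => ?_
  · rcases a with _ | a
    · rfl
    · change (G.ends a.1).map some = (Sym2.map some (G.deleteCycles.ends a)).map _
      rw [← map_val_ends_deleteCycles]
      exact (Sym2.map_map _).trans (Sym2.map_map (f := some)
        (g := Option.map Subtype.val) (G.deleteCycles.ends a)).symm
  · by_cases h : s' = ⟨s, not_onDisjointCycle_at s⟩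
    · subst h
      exact (at_insertSpecial_self s).trans
        (congrArg (Option.map Subtype.val) (at_insertSpecial_self (G := G.deleteCycles) _).symm)
    · exact (at_insertSpecial_of_ne fun h' => h (Subtype.ext h')).trans
        (congrArg (Option.map Subtype.val) (at_insertSpecial_of_ne (G := G.deleteCycles) h).symm)
  · rcases v with _ | v
    · exact not_onDisjointCycle_insertSpecial_none
    · exact onDisjointCycle_insertSpecial_some.not.2 v.2
  · rcases w with _ | w
    · exact ⟨none, rfl⟩
    · exact ⟨some ⟨w, onDisjointCycle_insertSpecial_some.not.1 hw⟩, rfl⟩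
  · rcases a with _ | a
    · exact ⟨none, rfl⟩
    · refine ⟨some ⟨a, fun v hv => ?_⟩, rfl⟩
      rw [← onDisjointCycle_insertSpecial_some (s := s)]
      exact ha _ (Sym2.mem_map.2 ⟨v, hv, rfl⟩)
  · exact ⟨⟨s', not_onDisjointCycle_at (G := G) s'⟩, rfl⟩

end InsertSpecial

/-! ### Subdivisions -/

theorem sigmaFin_mk_inj {α : Type} {n : α → ℕ} {a b : α} {i : Fin (n a)} {j : Fin (n b)} :
    (⟨a, i⟩ : Σ a, Fin (n a)) = ⟨b, j⟩ ↔ a = b ∧ i.1 = j.1 := by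
  constructor
  · intro h
    cases h
    exact ⟨rfl, rfl⟩
  · rintro ⟨rfl, h⟩
    rw [Fin.ext h]

/-- The vertex of the subdivision in position `j` on the path which replaces `a`. -/
noncomputable def pathVertex (G : MultiGraph) (ℓ : G.E ⊕ G.S → ℕ) (a : G.E ⊕ G.S) (j : ℕ) :
    G.V ⊕ (Σ a : G.E ⊕ G.S, Fin (ℓ a - 1)) :=
  if j = 0 then .inl (a.elim (fun e => (Quot.out (G.ends e)).1) G.at_)
  else if h : j - 1 < ℓ a - 1 then .inr ⟨a, ⟨j - 1, h⟩⟩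
  else .inl (a.elim (fun e => (Quot.out (G.ends e)).2) G.at_)

section Subdivide

variable {G : MultiGraph} {ℓ ℓ' : G.E ⊕ G.S → ℕ}

theorem ends_subdivide_inl (e : G.E) (i : Fin (ℓ (.inl e))) :
    (G.subdivide ℓ).ends (.inl ⟨e, i⟩) =
      s(G.pathVertex ℓ (.inl e) i, G.pathVertex ℓ (.inl e) (i + 1)) :=
  rfl

theorem ends_subdivide_inr (s : G.S) (i : Fin (ℓ (.inr s) - 1)) :
    (G.subdivide ℓ).ends (.inr ⟨s, i⟩) =
      s(G.pathVertex ℓ (.inr s) i, G.pathVertex ℓ (.inr s) (i + 1)) := by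
  have h1 := i.2
  have h2 : i.1 - 1 < ℓ (.inr s) - 1 := by omega
  simp [subdivide, pathVertex, h2]

theorem at_subdivide (s : G.S) :
    (G.subdivide ℓ).at_ s = G.pathVertex ℓ (.inr s) (ℓ (.inr s) - 1) := by
  by_cases h : ℓ (.inr s) - 1 = 0
  · simp [subdivide, pathVertex, h]
  · have h2 : ℓ (.inr s) - 1 - 1 < ℓ (.inr s) - 1 := by omega
    simp only [subdivide, pathVertex, h, h2, dif_pos, dif_neg, if_false, not_false_eq_true]
    rfl

/-- The effect on an index of making room for a new index `i₀` on the path which replaces `a₀`. -/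
noncomputable def shift (a₀ : G.E ⊕ G.S) (i₀ : ℕ) (a : G.E ⊕ G.S) (j : ℕ) : ℕ :=
  open Classical in if a = a₀ ∧ i₀ ≤ j then j + 1 else j

theorem shift_of_ne {a₀ a : G.E ⊕ G.S} (h : a ≠ a₀) (i₀ j : ℕ) : shift a₀ i₀ a j = j :=
  if_neg fun h' => h h'.1

theorem shift_self_of_le {a₀ : G.E ⊕ G.S} {i₀ j : ℕ} (h : i₀ ≤ j) :
    shift a₀ i₀ a₀ j = j + 1 :=
  if_pos ⟨rfl, h⟩

theorem shift_self_of_lt {a₀ : G.E ⊕ G.S} {i₀ j : ℕ} (h : j < i₀) : shift a₀ i₀ a₀ j = j :=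
  if_neg fun h' => by omega

theorem shift_injective (a₀ : G.E ⊕ G.S) (i₀ : ℕ) (a : G.E ⊕ G.S) :
    (shift a₀ i₀ a).Injective := by
  intro j k h
  unfold shift at h
  grind

theorem shift_self_ne (a₀ : G.E ⊕ G.S) (i₀ j : ℕ) : shift a₀ i₀ a₀ j ≠ i₀ := by
  unfold shift
  split_ifs with h <;> simp at h <;> omega

theorem exists_shift_eq {a₀ a : G.E ⊕ G.S} {i₀ k : ℕ} (h : ¬ (a = a₀ ∧ k = i₀)) :
    ∃ j, shift a₀ i₀ a j = k := by
  by_cases ha : a = a₀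
  · subst ha
    rcases lt_or_gt_of_ne (fun hk => h ⟨rfl, hk⟩ : k ≠ i₀) with hk | hk
    · exact ⟨k, shift_self_of_lt hk⟩
    · exact ⟨k - 1, (shift_self_of_le (by omega)).trans (by omega)⟩
  · exact ⟨k, shift_of_ne ha _ _⟩

/-- `ℓ'` arises from `ℓ` by lengthening the path which replaces `a₀` by one. -/
def Lengthens (a₀ : G.E ⊕ G.S) (ℓ ℓ' : G.E ⊕ G.S → ℕ) : Prop :=
  (∀ a, 1 ≤ ℓ a) ∧ ℓ' a₀ = ℓ a₀ + 1 ∧ ∀ a, a ≠ a₀ → ℓ' a = ℓ a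

theorem Lengthens.shift_lt {a₀ : G.E ⊕ G.S} (h : Lengthens a₀ ℓ ℓ') {i₀ : ℕ}
    {a : G.E ⊕ G.S} {j : ℕ} (hj : j < ℓ a) : shift a₀ i₀ a j < ℓ' a := by
  by_cases ha : a = a₀
  · subst ha
    have := h.2.1
    unfold shift; split_ifs <;> omega
  · rw [shift_of_ne ha, h.2.2 a ha]
    exact hj

theorem Lengthens.shift_lt_sub {a₀ : G.E ⊕ G.S} (h : Lengthens a₀ ℓ ℓ') {i₀ : ℕ}
    {a : G.E ⊕ G.S} {j : ℕ} (hj : j < ℓ a - 1) : shift a₀ i₀ a j < ℓ' a - 1 := by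
  by_cases ha : a = a₀
  · subst ha
    have := h.2.1
    unfold shift; split_ifs <;> omega
  · rw [shift_of_ne ha, h.2.2 a ha]
    exact hj

theorem Lengthens.lt_sub {a₀ : G.E ⊕ G.S} (h : Lengthens a₀ ℓ ℓ') {i₀ : ℕ} (hi : i₀ < ℓ a₀) :
    i₀ < ℓ' a₀ - 1 := by
  have := h.2.1
  omega

/-- The vertices of the subdivision, after insertion of a vertex behind position `i₀` of the path
which replaces `a₀`. -/
noncomputable def shiftVertex {a₀ : G.E ⊕ G.S} (h : Lengthens a₀ ℓ ℓ') {i₀ : ℕ} (hi : i₀ < ℓ a₀) :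
    Option (G.V ⊕ (Σ a : G.E ⊕ G.S, Fin (ℓ a - 1))) → G.V ⊕ (Σ a : G.E ⊕ G.S, Fin (ℓ' a - 1))
  | none => .inr ⟨a₀, ⟨i₀, h.lt_sub hi⟩⟩
  | some (.inl v) => .inl v
  | some (.inr ⟨a, j⟩) => .inr ⟨a, ⟨shift a₀ i₀ a j, h.shift_lt_sub j.2⟩⟩

theorem shiftVertex_bijective {a₀ : G.E ⊕ G.S} (h : Lengthens a₀ ℓ ℓ') {i₀ : ℕ} (hi : i₀ < ℓ a₀) :
    (shiftVertex h hi).Bijective := by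
  constructor
  · rintro (_ | v | ⟨a, j⟩) (_ | w | ⟨b, k⟩) hab <;>
      simp only [shiftVertex, Sum.inl.injEq, Sum.inr.injEq, reduceCtorEq] at hab
    · rfl
    · obtain ⟨rfl, hk⟩ := (sigmaFin_mk_inj (n := fun a => ℓ' a - 1)).1 hab
      exact absurd hk.symm (shift_self_ne _ _ _)
    · rw [hab]
    · obtain ⟨rfl, hk⟩ := (sigmaFin_mk_inj (n := fun a => ℓ' a - 1)).1 hab
      exact absurd hk (shift_self_ne _ _ _)
    · obtain ⟨rfl, hk⟩ := (sigmaFin_mk_inj (n := fun a => ℓ' a - 1)).1 hab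
      rw [Fin.ext (shift_injective _ _ _ hk)]
  · rintro (v | ⟨a, k⟩)
    · exact ⟨some (.inl v), rfl⟩
    · by_cases hk : a = a₀ ∧ k.1 = i₀
      · refine ⟨none, ?_⟩
        exact congrArg Sum.inr
          ((sigmaFin_mk_inj (n := fun a => ℓ' a - 1)).2 ⟨hk.1.symm, hk.2.symm⟩)
      · obtain ⟨j, hj⟩ := exists_shift_eq hk
        have hlt : j < ℓ a - 1 := by
          have hk2 := k.2
          by_cases ha : a = a₀
          · subst ha
            have := h.2.1
            rcases lt_or_ge j i₀ with hji | hji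
            · omega
            · rw [shift_self_of_le hji] at hj
              omega
          · rw [shift_of_ne ha] at hj
            have := h.2.2 a ha
            omega
        refine ⟨some (.inr ⟨a, ⟨j, hlt⟩⟩), ?_⟩
        exact congrArg Sum.inr ((sigmaFin_mk_inj (n := fun a => ℓ' a - 1)).2 ⟨rfl, hj⟩)

/-- Interior vertices are indexed from 0 but sit at positions from 1 on. Making room at index `i₀`
thus means shifting the positions from `i₀ + 1` on. Position `ℓ a` is the far end of an ordinary
edge; for a special self-loop it is a junk value that is treated consistently. -/
theorem shiftVertex_pathVertex {a₀ : G.E ⊕ G.S} (h : Lengthens a₀ ℓ ℓ') {i₀ : ℕ}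
    (hi : i₀ < ℓ a₀) (a : G.E ⊕ G.S) {j : ℕ} (hj : j ≤ ℓ a) :
    shiftVertex h hi (some (G.pathVertex ℓ a j)) = G.pathVertex ℓ' a (shift a₀ (i₀ + 1) a j) := by
  have h1 := h.1 a
  have h0 := h.2.1
  rcases Nat.eq_zero_or_pos j with rfl | hj0
  · have : shift a₀ (i₀ + 1) a 0 = 0 := if_neg fun h => by omega
    rw [this]
    rfl
  · by_cases hj1 : j - 1 < ℓ a - 1
    · have e1 : G.pathVertex ℓ a j = .inr ⟨a, ⟨j - 1, hj1⟩⟩ := by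
        simp [pathVertex, hj0.ne', hj1]
      have hs : shift a₀ (i₀ + 1) a j = shift a₀ i₀ a (j - 1) + 1 := by
        unfold shift; grind
      have hs' := h.shift_lt_sub (i₀ := i₀) hj1
      rw [e1, hs]
      simp [pathVertex, shiftVertex, hs']
    · have hja : j = ℓ a := by omega
      have hs : shift a₀ (i₀ + 1) a j = ℓ' a := by
        by_cases ha : a = a₀
        · subst ha
          rw [shift_self_of_le (by omega), hja, h0]
        · rw [shift_of_ne ha, hja, h.2.2 a ha]
      have h2 : ℓ' a ≠ 0 := by rw [← hs]; unfold shift; split_ifs <;> omega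
      rw [hs]
      simp [pathVertex, shiftVertex, hj0.ne', hj1, h2]

theorem shiftVertex_none {a₀ : G.E ⊕ G.S} (h : Lengthens a₀ ℓ ℓ') {i₀ : ℕ} (hi : i₀ < ℓ a₀) :
    shiftVertex h hi none = G.pathVertex ℓ' a₀ (i₀ + 1) := by
  have := h.lt_sub hi
  simp [pathVertex, shiftVertex, this]

/-- The edges of the subdivision, after the edges from position `i₀` on, on the path which replaces
`a₀`, have been moved by one. -/
noncomputable def shiftEdge {a₀ : G.E ⊕ G.S} (h : Lengthens a₀ ℓ ℓ') (i₀ : ℕ) :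
    (Σ e : G.E, Fin (ℓ (.inl e))) ⊕ (Σ s : G.S, Fin (ℓ (.inr s) - 1)) →
      (Σ e : G.E, Fin (ℓ' (.inl e))) ⊕ (Σ s : G.S, Fin (ℓ' (.inr s) - 1))
  | .inl ⟨e, i⟩ => .inl ⟨e, ⟨shift a₀ i₀ (.inl e) i, h.shift_lt i.2⟩⟩
  | .inr ⟨s, i⟩ => .inr ⟨s, ⟨shift a₀ i₀ (.inr s) i, h.shift_lt_sub i.2⟩⟩

theorem shiftEdge_injective {a₀ : G.E ⊕ G.S} (h : Lengthens a₀ ℓ ℓ') (i₀ : ℕ) :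
    (shiftEdge h i₀).Injective := by
  rintro (⟨e, i⟩ | ⟨s, i⟩) (⟨e', j⟩ | ⟨s', j⟩) hab <;>
    simp only [shiftEdge, Sum.inl.injEq, Sum.inr.injEq, reduceCtorEq] at hab
  · rw [sigmaFin_mk_inj (n := fun e => ℓ' (.inl e))] at hab
    obtain ⟨rfl, hk⟩ := hab
    rw [Fin.ext (shift_injective _ _ _ hk)]
  · rw [sigmaFin_mk_inj (n := fun e => ℓ' (.inr e) - 1)] at hab
    obtain ⟨rfl, hk⟩ := hab
    rw [Fin.ext (shift_injective _ _ _ hk)]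

theorem exists_shiftEdge_inl {a₀ : G.E ⊕ G.S} (h : Lengthens a₀ ℓ ℓ') {i₀ : ℕ}
    (hi : i₀ ≤ ℓ a₀) {e : G.E} {k : Fin (ℓ' (.inl e))} (hk : ¬ (Sum.inl e = a₀ ∧ k.1 = i₀)) :
    ∃ i, shiftEdge h i₀ i = .inl ⟨e, k⟩ := by
  obtain ⟨j, hj⟩ := exists_shift_eq hk
  have hlt : j < ℓ (.inl e) := by
    have hk2 := k.2
    by_cases ha : .inl e = a₀
    · subst ha
      have := h.2.1
      rcases lt_or_ge j i₀ with hji | hji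
      · omega
      · rw [shift_self_of_le hji] at hj
        omega
    · rw [shift_of_ne ha] at hj
      have := h.2.2 _ ha
      omega
  refine ⟨.inl ⟨e, ⟨j, hlt⟩⟩, ?_⟩
  simp only [shiftEdge, Sum.inl.injEq]
  exact (sigmaFin_mk_inj (n := fun e => ℓ' (.inl e))).2 ⟨rfl, hj⟩

theorem exists_shiftEdge_inr {a₀ : G.E ⊕ G.S} (h : Lengthens a₀ ℓ ℓ') {i₀ : ℕ}
    {s : G.S} {k : Fin (ℓ' (.inr s) - 1)} (hi : Sum.inr s = a₀ → i₀ ≤ ℓ a₀ - 1)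
    (hk : ¬ (Sum.inr s = a₀ ∧ k.1 = i₀)) :
    ∃ i, shiftEdge h i₀ i = .inr ⟨s, k⟩ := by
  obtain ⟨j, hj⟩ := exists_shift_eq hk
  have hlt : j < ℓ (.inr s) - 1 := by
    have hk2 := k.2
    by_cases ha : .inr s = a₀
    · have := hi ha
      subst ha
      have := h.2.1
      rcases lt_or_ge j i₀ with hji | hji
      · omega
      · rw [shift_self_of_le hji] at hj
        omega
    · rw [shift_of_ne ha] at hj
      have := h.2.2 _ ha
      omega
  refine ⟨.inr ⟨s, ⟨j, hlt⟩⟩, ?_⟩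
  simp only [shiftEdge, Sum.inr.injEq]
  exact (sigmaFin_mk_inj (n := fun e => ℓ' (.inr e) - 1)).2 ⟨rfl, hj⟩

/-- Every edge other than the one being split keeps both endpoints on the same side of the new
vertex, so both positions shift alike. -/
theorem ends_shiftEdge {a₀ : G.E ⊕ G.S} (h : Lengthens a₀ ℓ ℓ') {i₀ : ℕ} (hi : i₀ < ℓ a₀)
    (e : (G.subdivide ℓ).E)
    (he : ∀ j, (∃ k : Fin (ℓ (.inl j)), e = .inl ⟨j, k⟩ ∧ k.1 = i₀) → Sum.inl j ≠ a₀)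
    (he' : ∀ j, (∃ k : Fin (ℓ (.inr j) - 1), e = .inr ⟨j, k⟩ ∧ k.1 = i₀) → Sum.inr j ≠ a₀) :
    (G.subdivide ℓ').ends (shiftEdge h (i₀ + 1) e) =
      (((G.subdivide ℓ).ends e).map some).map (shiftVertex h hi) := by
  rcases e with ⟨e, i⟩ | ⟨s, i⟩
  · have h1 : shift a₀ (i₀ + 1) (.inl e) (i + 1) = shift a₀ (i₀ + 1) (.inl e) i + 1 := by
      by_cases h2 : Sum.inl e = a₀
      · have h3 : i.1 ≠ i₀ := fun h3 => he e ⟨i, rfl, h3⟩ h2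
        subst h2
        rcases lt_or_gt_of_ne h3 with h3 | h3
        · rw [shift_self_of_lt (by omega), shift_self_of_lt (by omega)]
        · rw [shift_self_of_le (by omega), shift_self_of_le (by omega)]
      · rw [shift_of_ne h2, shift_of_ne h2]
    change _ = s(shiftVertex h hi (some (G.pathVertex ℓ (.inl e) i)),
      shiftVertex h hi (some (G.pathVertex ℓ (.inl e) (i + 1))))
    rw [shiftVertex_pathVertex h hi _ i.2.le, shiftVertex_pathVertex h hi _ i.2, h1]
    rfl
  · have h1 : shift a₀ (i₀ + 1) (.inr s) (i + 1) = shift a₀ (i₀ + 1) (.inr s) i + 1 := by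
      by_cases h2 : Sum.inr s = a₀
      · have h3 : i.1 ≠ i₀ := fun h3 => he' s ⟨i, rfl, h3⟩ h2
        subst h2
        rcases lt_or_gt_of_ne h3 with h3 | h3
        · rw [shift_self_of_lt (by omega), shift_self_of_lt (by omega)]
        · rw [shift_self_of_le (by omega), shift_self_of_le (by omega)]
      · rw [shift_of_ne h2, shift_of_ne h2]
    have hi' := i.2
    rw [ends_subdivide_inr]
    change _ = s(shiftVertex h hi (some (G.pathVertex ℓ (.inr s) i)),
      shiftVertex h hi (some (G.pathVertex ℓ (.inr s) (i + 1))))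
    rw [shiftVertex_pathVertex h hi _ (by omega), shiftVertex_pathVertex h hi _ (by omega), h1]
    exact ends_subdivide_inr _ _

theorem at_subdivide_shift {a₀ : G.E ⊕ G.S} (h : Lengthens a₀ ℓ ℓ') {i₀ : ℕ} (hi : i₀ < ℓ a₀)
    (s : G.S) (hs : Sum.inr s = a₀ → i₀ + 1 < ℓ (.inr s)) :
    (G.subdivide ℓ').at_ s = shiftVertex h hi (some ((G.subdivide ℓ).at_ s)) := by
  rw [at_subdivide, at_subdivide, shiftVertex_pathVertex h hi _ (by omega)]
  congr 1
  by_cases ha : Sum.inr s = a₀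
  · have := hs ha
    subst ha
    rw [shift_self_of_le (by omega), h.2.1]
    omega
  · rw [shift_of_ne ha, h.2.2 _ ha]

/-- The split edge keeps its index for its first half. The second half receives the index `i₀ + 1`,
and all later edges of the path move up by one. -/
theorem insertEdge_subdivide_inl {e₀ : G.E} (h : Lengthens (.inl e₀) ℓ ℓ')
    (i₀ : Fin (ℓ (.inl e₀))) :
    Iso ((G.subdivide ℓ).insertEdge (.inl ⟨e₀, i₀⟩) (G.pathVertex ℓ (.inl e₀) i₀)
      (G.pathVertex ℓ (.inl e₀) (i₀ + 1))) (G.subdivide ℓ') := by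
  have hlt : i₀.1 + 1 < ℓ' (.inl e₀) := by have := h.2.1; omega
  refine Iso.of_bijective (H := G.subdivide ℓ') (shiftVertex h i₀.2)
    (fun o => o.elim (.inl ⟨e₀, ⟨i₀ + 1, hlt⟩⟩) (shiftEdge h (i₀ + 1))) id
    (shiftVertex_bijective h i₀.2) ⟨?_, ?_⟩ Function.bijective_id (fun o => ?_) (fun s => ?_)
  · have key : ∀ o, shiftEdge h (i₀ + 1) o ≠ .inl ⟨e₀, ⟨i₀ + 1, hlt⟩⟩ := by
      rintro (⟨e, i⟩ | ⟨s, i⟩) ho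
      · obtain ⟨rfl, hk⟩ := (sigmaFin_mk_inj (n := fun e => ℓ' (.inl e))).1 (Sum.inl_injective ho)
        exact shift_self_ne _ _ _ hk
      · simp [shiftEdge] at ho
    rintro (_ | o) (_ | o') ho
    · rfl
    · exact absurd ho.symm (key _)
    · exact absurd ho (key _)
    · exact congrArg some (shiftEdge_injective h _ ho)
  · rintro (⟨e, k⟩ | ⟨s, k⟩)
    · by_cases hk : Sum.inl (β := G.S) e = .inl e₀ ∧ k.1 = i₀ + 1
      · refine ⟨none, ?_⟩
        exact congrArg Sum.inl ((sigmaFin_mk_inj (n := fun e => ℓ' (.inl e))).2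
          ⟨(Sum.inl_injective hk.1).symm, hk.2.symm⟩)
      · obtain ⟨o, ho⟩ := exists_shiftEdge_inl h i₀.2 hk
        exact ⟨some o, ho⟩
    · obtain ⟨o, ho⟩ := exists_shiftEdge_inr h (i₀ := i₀ + 1) (s := s) (k := k) (by simp) (by simp)
      exact ⟨some o, ho⟩
  · rcases o with _ | o
    · change s(G.pathVertex ℓ' (.inl e₀) (i₀ + 1), G.pathVertex ℓ' (.inl e₀) (i₀ + 1 + 1)) =
        s(shiftVertex h i₀.2 none, shiftVertex h i₀.2 (some (G.pathVertex ℓ (.inl e₀) (i₀ + 1))))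
      rw [shiftVertex_none, shiftVertex_pathVertex h i₀.2 _ i₀.2, shift_self_of_le le_rfl]
    · by_cases ho : o = .inl ⟨e₀, i₀⟩
      · subst ho
        refine Eq.trans ?_ (congrArg (Sym2.map (shiftVertex h i₀.2))
          (ends_insertEdge_self (G := G.subdivide ℓ) (.inl ⟨e₀, i₀⟩) _ _).symm)
        change s(G.pathVertex ℓ' (.inl e₀) (shift (.inl e₀) (i₀ + 1) (.inl e₀) i₀),
          G.pathVertex ℓ' (.inl e₀) (shift (.inl e₀) (i₀ + 1) (.inl e₀) i₀ + 1)) =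
          s(shiftVertex h i₀.2 (some (G.pathVertex ℓ (.inl e₀) i₀)), shiftVertex h i₀.2 none)
        rw [shiftVertex_none, shiftVertex_pathVertex h i₀.2 _ i₀.2.le,
          shift_self_of_lt (Nat.lt_succ_self _)]
      · refine Eq.trans ?_ (congrArg (Sym2.map (shiftVertex h i₀.2))
          (ends_insertEdge_of_ne (G := G.subdivide ℓ) _ _ ho).symm)
        refine ends_shiftEdge h i₀.2 o ?_ (by simp)
        rintro j ⟨k, rfl, hk⟩ hj
        obtain rfl := Sum.inl_injective hj
        exact ho (by rw [Fin.ext hk])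
  · exact at_subdivide_shift h i₀.2 s (by simp)

theorem insertEdge_subdivide_inr {s₀ : G.S} (h : Lengthens (.inr s₀) ℓ ℓ')
    (i₀ : Fin (ℓ (.inr s₀) - 1)) :
    Iso ((G.subdivide ℓ).insertEdge (.inr ⟨s₀, i₀⟩) (G.pathVertex ℓ (.inr s₀) i₀)
      (G.pathVertex ℓ (.inr s₀) (i₀ + 1))) (G.subdivide ℓ') := by
  have hi := i₀.2
  have hi₀ : i₀.1 < ℓ (.inr s₀) := by omega
  have hlt : i₀.1 + 1 < ℓ' (.inr s₀) - 1 := by have := h.2.1; omega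
  refine Iso.of_bijective (H := G.subdivide ℓ') (shiftVertex h hi₀)
    (fun o => o.elim (.inr ⟨s₀, ⟨i₀ + 1, hlt⟩⟩) (shiftEdge h (i₀ + 1))) id
    (shiftVertex_bijective h hi₀) ⟨?_, ?_⟩ Function.bijective_id (fun o => ?_) (fun s => ?_)
  · have key : ∀ o, shiftEdge h (i₀ + 1) o ≠ .inr ⟨s₀, ⟨i₀ + 1, hlt⟩⟩ := by
      rintro (⟨e, i⟩ | ⟨s, i⟩) ho
      · simp [shiftEdge] at ho
      · obtain ⟨rfl, hk⟩ := (sigmaFin_mk_inj (n := fun e => ℓ' (.inr e) - 1)).1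
          (Sum.inr_injective ho)
        exact shift_self_ne _ _ _ hk
    rintro (_ | o) (_ | o') ho
    · rfl
    · exact absurd ho.symm (key _)
    · exact absurd ho (key _)
    · exact congrArg some (shiftEdge_injective h _ ho)
  · rintro (⟨e, k⟩ | ⟨s, k⟩)
    · obtain ⟨o, ho⟩ := exists_shiftEdge_inl h (i₀ := i₀ + 1) (by omega) (e := e) (k := k) (by simp)
      exact ⟨some o, ho⟩
    · by_cases hk : Sum.inr (α := G.E) s = .inr s₀ ∧ k.1 = i₀ + 1
      · refine ⟨none, ?_⟩
        exact congrArg Sum.inr ((sigmaFin_mk_inj (n := fun e => ℓ' (.inr e) - 1)).2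
          ⟨(Sum.inr_injective hk.1).symm, hk.2.symm⟩)
      · obtain ⟨o, ho⟩ := exists_shiftEdge_inr h (i₀ := i₀ + 1) (fun _ => by omega) hk
        exact ⟨some o, ho⟩
  · rcases o with _ | o
    · refine (ends_subdivide_inr (ℓ := ℓ') s₀ ⟨i₀ + 1, hlt⟩).trans ?_
      change s(G.pathVertex ℓ' (.inr s₀) (i₀ + 1), G.pathVertex ℓ' (.inr s₀) (i₀ + 1 + 1)) =
        s(shiftVertex h hi₀ none, shiftVertex h hi₀ (some (G.pathVertex ℓ (.inr s₀) (i₀ + 1))))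
      rw [shiftVertex_none, shiftVertex_pathVertex h hi₀ _ hi₀, shift_self_of_le le_rfl]
    · by_cases ho : o = .inr ⟨s₀, i₀⟩
      · subst ho
        refine Eq.trans ?_ (congrArg (Sym2.map (shiftVertex h hi₀))
          (ends_insertEdge_self (G := G.subdivide ℓ) (.inr ⟨s₀, i₀⟩) _ _).symm)
        refine (ends_subdivide_inr (ℓ := ℓ') s₀ _).trans ?_
        change s(G.pathVertex ℓ' (.inr s₀) (shift (.inr s₀) (i₀ + 1) (.inr s₀) i₀),
          G.pathVertex ℓ' (.inr s₀) (shift (.inr s₀) (i₀ + 1) (.inr s₀) i₀ + 1)) =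
          s(shiftVertex h hi₀ (some (G.pathVertex ℓ (.inr s₀) i₀)), shiftVertex h hi₀ none)
        rw [shiftVertex_none, shiftVertex_pathVertex h hi₀ _ hi₀.le,
          shift_self_of_lt (Nat.lt_succ_self _)]
      · refine Eq.trans ?_ (congrArg (Sym2.map (shiftVertex h hi₀))
          (ends_insertEdge_of_ne (G := G.subdivide ℓ) _ _ ho).symm)
        refine ends_shiftEdge h hi₀ o (by simp) ?_
        rintro j ⟨k, rfl, hk⟩ hj
        obtain rfl := Sum.inr_injective hj
        exact ho (by rw [Fin.ext hk])
  · refine at_subdivide_shift h hi₀ s fun hs => ?_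
    rw [hs]
    omega

/-- The new vertex extends the tail at its far end. The new edge takes the first unused index, and
no old edge on this path moves. -/
theorem insertSpecial_subdivide {s₀ : G.S} (h : Lengthens (.inr s₀) ℓ ℓ') :
    Iso ((G.subdivide ℓ).insertSpecial s₀) (G.subdivide ℓ') := by
  have h1 := h.1 (.inr s₀)
  have hi₀ : ℓ (.inr s₀) - 1 < ℓ (.inr s₀) := by omega
  have hlt : ℓ (.inr s₀) - 1 < ℓ' (.inr s₀) - 1 := by have := h.2.1; omega
  have hend : shiftVertex h hi₀ (some ((G.subdivide ℓ).at_ s₀)) =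
      G.pathVertex ℓ' (.inr s₀) (ℓ (.inr s₀) - 1) := by
    rw [at_subdivide, shiftVertex_pathVertex h hi₀ _ hi₀.le, shift_self_of_lt (Nat.lt_succ_self _)]
  refine Iso.of_bijective (H := G.subdivide ℓ') (shiftVertex h hi₀)
    (fun o => o.elim (.inr ⟨s₀, ⟨ℓ (.inr s₀) - 1, hlt⟩⟩) (shiftEdge h (ℓ (.inr s₀) - 1 + 1))) id
    (shiftVertex_bijective h hi₀) ⟨?_, ?_⟩ Function.bijective_id (fun o => ?_) (fun (s : G.S) => ?_)
  · have key : ∀ o, shiftEdge h (ℓ (.inr s₀) - 1 + 1) o ≠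
        .inr ⟨s₀, ⟨ℓ (.inr s₀) - 1, hlt⟩⟩ := by
      rintro (⟨e, i⟩ | ⟨s, i⟩) ho
      · simp [shiftEdge] at ho
      · obtain ⟨rfl, hk⟩ := (sigmaFin_mk_inj (n := fun e => ℓ' (.inr e) - 1)).1
          (Sum.inr_injective ho)
        have := i.2
        change shift _ _ _ i.1 = ℓ (.inr s) - 1 at hk
        rw [shift_self_of_lt (by omega)] at hk
        omega
    rintro (_ | o) (_ | o') ho
    · rfl
    · exact absurd ho.symm (key _)
    · exact absurd ho (key _)
    · exact congrArg some (shiftEdge_injective h _ ho)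
  · rintro (⟨e, k⟩ | ⟨s, k⟩)
    · obtain ⟨o, ho⟩ := exists_shiftEdge_inl h (i₀ := ℓ (.inr s₀) - 1 + 1) (by omega) (e := e)
        (k := k) (by simp)
      exact ⟨some o, ho⟩
    · by_cases hs : s = s₀
      · subst hs
        by_cases hk : k.1 = ℓ (.inr s) - 1
        · exact ⟨none, congrArg Sum.inr ((sigmaFin_mk_inj (n := fun e => ℓ' (.inr e) - 1)).2
            ⟨rfl, hk.symm⟩)⟩
        · have hk2 := k.2
          have hk3 := h.2.1
          refine ⟨some (.inr ⟨s, ⟨k, by omega⟩⟩), ?_⟩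
          refine congrArg Sum.inr ((sigmaFin_mk_inj (n := fun e => ℓ' (.inr e) - 1)).2 ⟨rfl, ?_⟩)
          exact shift_self_of_lt (by omega)
      · obtain ⟨o, ho⟩ := exists_shiftEdge_inr h (i₀ := ℓ (.inr s₀) - 1 + 1) (s := s) (k := k)
          (fun h => absurd (Sum.inr_injective h) hs) (fun h => hs (Sum.inr_injective h.1))
        exact ⟨some o, ho⟩
  · rcases o with _ | o
    · refine (ends_subdivide_inr (ℓ := ℓ') s₀ ⟨ℓ (.inr s₀) - 1, hlt⟩).trans ?_
      change _ = s(shiftVertex h hi₀ (some ((G.subdivide ℓ).at_ s₀)), shiftVertex h hi₀ none)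
      rw [shiftVertex_none, hend]
    · refine ends_shiftEdge h hi₀ o (by simp) ?_
      rintro j ⟨k, rfl, hk⟩ hj
      obtain rfl := Sum.inr_injective hj
      have := k.2
      omega
  · by_cases hs : s = s₀
    · subst hs
      refine Eq.trans ?_ (congrArg (shiftVertex h hi₀)
        (at_insertSpecial_self (G := G.subdivide ℓ) s).symm)
      refine (at_subdivide (ℓ := ℓ') s).trans ?_
      refine Eq.trans ?_ (shiftVertex_none h hi₀).symm
      congr 1
      have := h.2.1
      omega
    · refine Eq.trans ?_ (congrArg (shiftVertex h hi₀)
        (at_insertSpecial_of_ne (G := G.subdivide ℓ) hs).symm)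
      exact at_subdivide_shift h hi₀ s fun h => absurd (Sum.inr_injective h) hs

/-- Subdividing every edge into a single one changes nothing. -/
theorem subdivide_one (h : ∀ a, ℓ a = 1) : Iso G (G.subdivide ℓ) := by
  refine Iso.of_bijective (H := G.subdivide ℓ) Sum.inl
    (fun e => .inl ⟨e, ⟨0, by rw [h]; exact one_pos⟩⟩) id ⟨Sum.inl_injective, ?_⟩
    ⟨fun a b hab => (congrArg Sigma.fst (Sum.inl_injective hab)), ?_⟩ Function.bijective_id
    (fun e => ?_) (fun s => ?_)
  · rintro (v | ⟨a, k⟩)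
    · exact ⟨v, rfl⟩
    · have := k.2
      have := h a
      omega
  · rintro (⟨e, k⟩ | ⟨s, k⟩)
    · refine ⟨e, congrArg Sum.inl ((sigmaFin_mk_inj (n := fun e => ℓ (.inl e))).2 ⟨rfl, ?_⟩)⟩
      have := k.2
      have := h (.inl e)
      simp only
      omega
    · have := k.2
      have := h (.inr s)
      omega
  · refine Eq.trans ?_ (congrArg (Sym2.map Sum.inl) (G.ends_eq_out e).symm)
    change s(_, _) = s(_, _)
    simp [h]
  · refine (at_subdivide (ℓ := ℓ) s).trans ?_
    simp only [pathVertex, h]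
    rfl

end Subdivide

end MultiGraph

/-! ### Splitting sums in the extended nonnegative reals -/

theorem ENNReal.tsum_sumType {α β : Type*} (f : α ⊕ β → ℝ≥0∞) :
    ∑' x, f x = ∑' a, f (.inl a) + ∑' b, f (.inr b) :=
  Summable.tsum_sum ENNReal.summable ENNReal.summable

theorem ENNReal.tsum_const_of_finite (α : Type*) [Finite α] (c : ℝ≥0∞) :
    ∑' _ : α, c = Nat.card α * c := by
  have := Fintype.ofFinite α
  rw [tsum_fintype, Finset.sum_const, nsmul_eq_mul, Finset.card_univ, Nat.card_eq_fintype_card]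

theorem ENNReal.tsum_subtype_add_tsum_subtype_not {α : Type*} (p : α → Prop) (f : α → ℝ≥0∞) :
    ∑' x, f x = ∑' x : {x // p x}, f x + ∑' x : {x // ¬ p x}, f x := by
  classical
  rw [← (Equiv.sumCompl p).tsum_eq, ENNReal.tsum_sumType]
  rfl

namespace MultiGraph

/-! ### Summing over all ways to insert a vertex -/

/-- The edges and special self-loops. -/
abbrev Link (G : MultiGraph) : Type := G.E ⊕ G.S

theorem tsum_insertVertex_congr {f : MultiGraph → ℝ≥0∞} (hf : ∀ G H, Iso G H → f G = f H)
    {G H : MultiGraph} (hGH : Iso G H) :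
    ∑' a : G.Link, f (G.insertVertex a) = ∑' a : H.Link, f (H.insertVertex a) := by
  obtain ⟨e, g, h, hE, hS⟩ := hGH
  rw [← (g.sumCongr h).tsum_eq]
  exact tsum_congr fun a => hf _ _ (Iso.insertVertex e g h hE hS a)

theorem card_link_congr {G H : MultiGraph} : Iso G H → Nat.card G.Link = Nat.card H.Link := by
  rintro ⟨e, g, h, hE, hS⟩
  exact Nat.card_congr (g.sumCongr h)

/-- A path of length `ℓ a` offers exactly `ℓ a` places for the new vertex, and all of them give the
same multigraph. For a special self-loop these are its `ℓ a - 1` ordinary edges and the special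
self-loop at the end. -/
theorem tsum_insertVertex_subdivide {f : MultiGraph → ℝ≥0∞} (hf : ∀ G H, Iso G H → f G = f H)
    (G : MultiGraph) {ℓ : G.Link → ℕ} (hℓ : ∀ a, 1 ≤ ℓ a) (ℓ' : G.Link → G.Link → ℕ)
    (h : ∀ a, Lengthens a ℓ (ℓ' a)) :
    ∑' a : (G.subdivide ℓ).Link, f ((G.subdivide ℓ).insertVertex a) =
      ∑' a : G.Link, ℓ a * f (G.subdivide (ℓ' a)) := by
  have h1 (e : G.E) (i : Fin (ℓ (.inl e))) :
      f ((G.subdivide ℓ).insertVertex (.inl (.inl ⟨e, i⟩))) = f (G.subdivide (ℓ' (.inl e))) :=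
    (hf _ _ (insertEdge_iso_insertVertex (ends_subdivide_inl e i))).symm.trans
      (hf _ _ (insertEdge_subdivide_inl (h _) i))
  have h2 (s : G.S) (i : Fin (ℓ (.inr s) - 1)) :
      f ((G.subdivide ℓ).insertVertex (.inl (.inr ⟨s, i⟩))) = f (G.subdivide (ℓ' (.inr s))) :=
    (hf _ _ (insertEdge_iso_insertVertex (ends_subdivide_inr s i))).symm.trans
      (hf _ _ (insertEdge_subdivide_inr (h _) i))
  have h3 (s : G.S) :
      f ((G.subdivide ℓ).insertVertex (.inr s)) = f (G.subdivide (ℓ' (.inr s))) :=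
    hf _ _ (insertSpecial_subdivide (h _))
  have h4 (s : G.S) : ((ℓ (.inr s) - 1 : ℕ) : ℝ≥0∞) + 1 = ℓ (.inr s) := by
    rw [← Nat.cast_add_one, Nat.sub_add_cancel (hℓ _)]
  refine (ENNReal.tsum_sumType _).trans ?_
  refine (congrArg (· + _) (ENNReal.tsum_sumType
    (α := Σ e : G.E, Fin (ℓ (.inl e))) (β := Σ s : G.S, Fin (ℓ (.inr s) - 1)) _)).trans ?_
  rw [ENNReal.tsum_sigma' (β := fun e : G.E => Fin (ℓ (.inl e))),
    ENNReal.tsum_sigma' (β := fun s : G.S => Fin (ℓ (.inr s) - 1)), ENNReal.tsum_sumType]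
  simp only [h1, h2, ENNReal.tsum_const_of_finite, Nat.card_fin]
  refine (add_assoc _ _ _).trans (congrArg _ ?_)
  refine (congrArg _ (tsum_congr (β := G.S) h3)).trans ?_
  refine ENNReal.tsum_add.symm.trans ?_
  exact tsum_congr fun s => by rw [← h4, add_mul, one_mul]

/-- `v` is no endpoint of a link on a disjoint cycle. -/
def OffCycles (G : MultiGraph) (e : G.E) : Prop := ∀ v ∈ G.ends e, ¬ G.OnDisjointCycle v

theorem offCycles_iff {G : MultiGraph} {e : G.E} {x y : G.V} (h : G.ends e = s(x, y)) :
    G.OffCycles e ↔ ¬ G.OnDisjointCycle x := by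
  simp only [OffCycles, h, Sym2.mem_iff, forall_eq_or_imp, forall_eq,
    ← onDisjointCycle_iff_of_ends h, and_self]

/-- On a surviving link, insertion commutes with deletion; on a link of a disjoint cycle it has no
effect after deletion. Special self-loops always survive. -/
theorem tsum_deleteCycles_insertVertex {f : MultiGraph → ℝ≥0∞}
    (hf : ∀ G H, Iso G H → f G = f H) (G : MultiGraph) :
    ∑' a : G.Link, f (G.insertVertex a).deleteCycles =
      ∑' a : G.deleteCycles.Link, f (G.deleteCycles.insertVertex a) +
        (Nat.card G.Link - Nat.card G.deleteCycles.Link : ℕ) * f G.deleteCycles := by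
  have h1 (e : {e // G.OffCycles e}) : f (G.insertVertex (.inl e.1)).deleteCycles =
      f (G.deleteCycles.insertVertex (.inl e)) := by
    have he := G.ends_eq_out e.1
    have hx := (offCycles_iff he).1 e.2
    have hy := (offCycles_iff (he.trans Sym2.eq_swap)).1 e.2
    refine (hf _ _ (deleteCycles_insertEdge he hx hy e.2)).symm.trans
      (hf _ _ (insertEdge_iso_insertVertex (G := G.deleteCycles) ?_))
    refine Sym2.map.injective Subtype.val_injective ?_
    exact (map_val_ends_deleteCycles G e).trans he
  have h2 (e : {e // ¬ G.OffCycles e}) : f (G.insertVertex (.inl e.1)).deleteCycles =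
      f G.deleteCycles := by
    have he := G.ends_eq_out e.1
    have hx := not_not.1 ((offCycles_iff he).not.1 e.2)
    exact (hf _ _ (deleteCycles_insertEdge_of_onDisjointCycle he hx)).symm
  have h3 (s : G.S) : f (G.insertVertex (.inr s)).deleteCycles =
      f (G.deleteCycles.insertVertex (.inr ⟨s, not_onDisjointCycle_at s⟩)) :=
    (hf _ _ (deleteCycles_insertSpecial s)).symm
  let eS : G.S ≃ {s // ¬ G.OnDisjointCycle (G.at_ s)} :=
    (Equiv.subtypeUnivEquiv (p := fun s => ¬ G.OnDisjointCycle (G.at_ s))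
      fun s => not_onDisjointCycle_at s).symm
  have hcard : Nat.card G.Link = Nat.card G.deleteCycles.Link + Nat.card {e // ¬ G.OffCycles e} := by
    have hE : Nat.card G.E = Nat.card {e // G.OffCycles e} + Nat.card {e // ¬ G.OffCycles e} := by
      classical
      rw [← Nat.card_sum]
      exact Nat.card_congr (Equiv.sumCompl _).symm
    change Nat.card (G.E ⊕ G.S) = Nat.card ({e // G.OffCycles e} ⊕
      {s // ¬ G.OnDisjointCycle (G.at_ s)}) + _
    rw [Nat.card_sum, Nat.card_sum, hE, Nat.card_congr eS]
    ring
  rw [hcard, Nat.add_sub_cancel_left, ENNReal.tsum_sumType,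
    ENNReal.tsum_subtype_add_tsum_subtype_not G.OffCycles]
  simp only [h1, h2, h3, ENNReal.tsum_const_of_finite]
  have hr : ∑' a : G.deleteCycles.Link, f (G.deleteCycles.insertVertex a) =
      ∑' e : {e // G.OffCycles e}, f (G.deleteCycles.insertVertex (.inl e)) +
        ∑' s : G.S, f (G.deleteCycles.insertVertex (.inr ⟨s, not_onDisjointCycle_at s⟩)) := by
    refine (ENNReal.tsum_sumType _).trans (congrArg _ ?_)
    exact (eS.tsum_eq fun s => f (G.deleteCycles.insertVertex (.inr s))).symm
  rw [hr]
  ring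

end MultiGraph

/-! ### Pairings -/

/-- The number of fixed points of an involution has the parity of the whole set, so prescribing 0 or
1 by parity is the same as allowing at most one. -/
theorem card_fixed_eq_mod_two_iff {D : Type} [Finite D] {σ : Equiv.Perm D}
    (hσ : Function.Involutive σ) :
    Nat.card {a // σ a = a} = Nat.card D % 2 ↔ ∀ a b, σ a = a → σ b = b → a = b := by
  classical
  have := Fintype.ofFinite D
  have hp : Fact (Nat.Prime 2) := ⟨Nat.prime_two⟩
  have key : Nat.card D % 2 = Nat.card {a // σ a = a} % 2 := by
    have h := Equiv.Perm.card_fixedPoints_modEq (f := (σ : D → D)) (p := 2) (n := 1)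
      (funext hσ)
    rw [Nat.card_eq_fintype_card, Nat.card_eq_fintype_card]
    refine Eq.trans h (congrArg (· % 2) ?_)
    exact Fintype.card_congr (Equiv.refl _)
  rw [key]
  constructor
  · intro h a b ha hb
    have h1 : Nat.card {a // σ a = a} ≤ 1 := by omega
    have := Finite.card_le_one_iff_subsingleton.1 h1
    exact congrArg Subtype.val (Subsingleton.elim (⟨a, ha⟩ : {a // σ a = a}) ⟨b, hb⟩)
  · intro h
    have : Subsingleton {a // σ a = a} := ⟨fun a b => Subtype.ext (h _ _ a.2 b.2)⟩
    have h1 := Finite.card_le_one_iff_subsingleton.2 this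
    omega

namespace Pairing

variable {D D' : Type}

theorem ext {σ τ : Pairing D} (h : ∀ a, σ.1 a = τ.1 a) : σ = τ :=
  Subtype.ext (Equiv.ext h)

theorem apply_apply (σ : Pairing D) (a : D) : σ.1 (σ.1 a) = a := σ.2.1 a

theorem eq_of_fixed [Finite D] (σ : Pairing D) {a b : D} (ha : σ.1 a = a) (hb : σ.1 b = b) : a = b :=
  (card_fixed_eq_mod_two_iff σ.2.1).1 σ.2.2 a b ha hb

instance [Finite D] : Finite (Pairing D) := inferInstanceAs (Finite (Subtype _))

/-- An involution with at most one fixed point is a pairing. -/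
def mk [Finite D] (f : D → D) (hf : Function.Involutive f)
    (hfix : ∀ a b, f a = a → f b = b → a = b) : Pairing D :=
  ⟨hf.toPerm, hf, (card_fixed_eq_mod_two_iff hf).2 hfix⟩

/-- Transport of a pairing along a bijection. -/
def relabel (e : D ≃ D') : Pairing D ≃ Pairing D' where
  toFun σ := ⟨e.permCongr σ.1, fun a => by simp [σ.apply_apply], by
    rw [← Nat.card_congr e]
    refine Eq.trans (Nat.card_congr (e.subtypeEquiv fun a => ?_).symm) σ.2.2
    simp⟩
  invFun σ := ⟨e.symm.permCongr σ.1, fun a => by simp [σ.apply_apply], by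
    rw [Nat.card_congr e]
    refine Eq.trans (Nat.card_congr (e.symm.subtypeEquiv fun a => ?_).symm) σ.2.2
    simp⟩
  left_inv σ := ext fun a => by simp
  right_inv σ := ext fun a => by simp

theorem relabel_apply (e : D ≃ D') (σ : Pairing D) (a : D) :
    (relabel e σ).1 (e a) = e (σ.1 a) := by
  change e (σ.1 (e.symm (e a))) = _
  rw [e.symm_apply_apply]

set_option linter.unusedSectionVars false

variable [Finite D]

/-- Pair two new points with each other. -/
def addPair (σ : Pairing D) : Pairing (D ⊕ Bool) :=
  mk (fun | .inl y => .inl (σ.1 y) | .inr b => .inr !b)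
    (by rintro (y | b) <;> simp [σ.apply_apply])
    (by
      rintro (y | b) (z | c) hy hz <;> simp at hy hz
      rw [σ.eq_of_fixed hy hz])

open Classical in
/-- Cut the pair of `x` and insert two new points, the first of which is paired with `x`. -/
noncomputable def cut (σ : Pairing D) (x : D) : Pairing (D ⊕ Bool) :=
  mk (fun
      | .inl y => if y = x then .inr false else if y = σ.1 x then .inr true else .inl (σ.1 y)
      | .inr false => .inl x
      | .inr true => if σ.1 x = x then .inr true else .inl (σ.1 x))
    (by
      have := σ.apply_apply
      rintro (y | _ | _)
      · by_cases h1 : y = x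
        · simp [h1]
        · by_cases h2 : y = σ.1 x
          · by_cases h3 : σ.1 x = x <;> simp_all
          · have h3 : σ.1 y ≠ x := fun h => h2 (by rw [← h, this])
            have h4 : σ.1 y ≠ σ.1 x := fun h => h1 (σ.1.injective h)
            simp [h1, h2, h3, h4, this]
      · simp
      · by_cases h3 : σ.1 x = x <;> simp [h3])
    (by
      have := σ.apply_apply
      have key : ∀ y : D, (if y = x then Sum.inr false else if y = σ.1 x then .inr true
          else .inl (σ.1 y) : D ⊕ Bool) = .inl y → σ.1 y = y ∧ y ≠ x := by
        intro y hy
        split_ifs at hy with h1 h2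
        exact ⟨Sum.inl_injective hy, h1⟩
      have key2 : (if σ.1 x = x then Sum.inr true else .inl (σ.1 x) : D ⊕ Bool) = .inr true →
          σ.1 x = x := by
        intro h
        split_ifs at h with h1
        exact h1
      rintro (y | _ | _) (z | _ | _) hy hz
      · rw [σ.eq_of_fixed (key y hy).1 (key z hz).1]
      · simp at hz
      · exact absurd (σ.eq_of_fixed (key y hy).1 (key2 hz)) (key y hy).2
      · simp at hy
      · rfl
      · simp at hy
      · exact absurd (σ.eq_of_fixed (key z hz).1 (key2 hy)) (key z hz).2
      · simp at hz
      · rfl)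

theorem addPair_inl (σ : Pairing D) (y : D) : σ.addPair.1 (.inl y) = .inl (σ.1 y) := rfl

theorem addPair_inr (σ : Pairing D) (b : Bool) : σ.addPair.1 (.inr b) = .inr !b := rfl

theorem cut_inl_self (σ : Pairing D) (x : D) : (σ.cut x).1 (.inl x) = .inr false := if_pos rfl

theorem cut_inl_apply (σ : Pairing D) {x : D} (h : σ.1 x ≠ x) :
    (σ.cut x).1 (.inl (σ.1 x)) = .inr true :=
  (if_neg h).trans (if_pos rfl)

theorem cut_inl_of_ne (σ : Pairing D) {x y : D} (h1 : y ≠ x) (h2 : y ≠ σ.1 x) :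
    (σ.cut x).1 (.inl y) = .inl (σ.1 y) :=
  (if_neg h1).trans (if_neg h2)

theorem cut_inr_false (σ : Pairing D) (x : D) : (σ.cut x).1 (.inr false) = .inl x := rfl

theorem cut_inr_true (σ : Pairing D) {x : D} (h : σ.1 x ≠ x) :
    (σ.cut x).1 (.inr true) = .inl (σ.1 x) := if_neg h

theorem cut_inr_true_of_fixed (σ : Pairing D) {x : D} (h : σ.1 x = x) :
    (σ.cut x).1 (.inr true) = .inr true := if_pos h

/-- Exchange the two new points. -/
def flip : Pairing (D ⊕ Bool) ≃ Pairing (D ⊕ Bool) :=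
  relabel ((Equiv.refl D).sumCongr Equiv.boolNot)

theorem flip_inl (σ : Pairing (D ⊕ Bool)) (y : D) :
    (flip σ).1 (.inl y) = (σ.1 (.inl y)).map id not :=
  relabel_apply ((Equiv.refl D).sumCongr Equiv.boolNot) σ (.inl y)

theorem flip_inr (σ : Pairing (D ⊕ Bool)) (b : Bool) :
    (flip σ).1 (.inr b) = (σ.1 (.inr !b)).map id not := by
  have := relabel_apply ((Equiv.refl D).sumCongr Equiv.boolNot) σ (.inr !b)
  simp only [Equiv.sumCongr_apply, Sum.map_inr, Equiv.boolNot_apply, Bool.not_not] at this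
  exact this

/-- Remove the two new points. -/
def removeFun (f : D ⊕ Bool → D ⊕ Bool) (y : D) : D :=
  (f (.inl y)).elim id fun b => (f (.inr !b)).elim id fun _ => y

theorem removeFun_of_inl {f : D ⊕ Bool → D ⊕ Bool} {y z : D} (h : f (.inl y) = .inl z) :
    removeFun f y = z := by
  simp [removeFun, h]

theorem removeFun_of_inr_inl {f : D ⊕ Bool → D ⊕ Bool} {y z : D} {b : Bool}
    (h : f (.inl y) = .inr b) (h' : f (.inr !b) = .inl z) : removeFun f y = z := by
  simp [removeFun, h, h']

theorem removeFun_of_inr_inr {f : D ⊕ Bool → D ⊕ Bool} {y : D} {b c : Bool}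
    (h : f (.inl y) = .inr b) (h' : f (.inr !b) = .inr c) : removeFun f y = y := by
  simp [removeFun, h, h']

theorem removeFun_involutive {f : D ⊕ Bool → D ⊕ Bool} (hf : Function.Involutive f) :
    Function.Involutive (removeFun f) := by
  intro y
  rcases h : f (.inl y) with z | b
  · rw [removeFun_of_inl h]
    exact removeFun_of_inl (by rw [← h, hf])
  · have hb : f (.inr b) = .inl y := by rw [← h, hf]
    rcases h' : f (.inr !b) with z | c
    · rw [removeFun_of_inr_inl h h']
      exact removeFun_of_inr_inl (b := !b) (by rw [← h', hf]) (by rwa [Bool.not_not])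
    · rw [removeFun_of_inr_inr h h', removeFun_of_inr_inr h h']

theorem removeFun_fixed {f : D ⊕ Bool → D ⊕ Bool} (hf : Function.Involutive f) {y : D}
    (hy : removeFun f y = y) :
    f (.inl y) = .inl y ∨ ∃ b, f (.inl y) = .inr b ∧ f (.inr !b) = .inr !b := by
  rcases h : f (.inl y) with z | b
  · rw [removeFun_of_inl h] at hy
    exact .inl (by rw [hy])
  · have hb : f (.inr b) = .inl y := by rw [← h, hf]
    refine .inr ⟨b, rfl, ?_⟩
    rcases h' : f (.inr !b) with z | c
    · rw [removeFun_of_inr_inl h h'] at hy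
      have := hf (.inr !b)
      rw [h', hy, h] at this
      cases b <;> simp at this
    · by_cases hc : c = b
      · have := hf (.inr !b)
        rw [h', hc, hb] at this
        simp at this
      · rw [Bool.eq_not_of_ne hc]

/-- Remove the two new points and join their partners. -/
def remove (τ : Pairing (D ⊕ Bool)) : Pairing D :=
  mk (removeFun τ.1) (removeFun_involutive τ.2.1) (by
    intro y z hy hz
    rcases removeFun_fixed τ.2.1 hy with h | ⟨b, h, hb⟩ <;>
      rcases removeFun_fixed τ.2.1 hz with h' | ⟨c, h', hc⟩
    · exact Sum.inl_injective (τ.eq_of_fixed h h')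
    · exact absurd (τ.eq_of_fixed h hc) (by simp)
    · exact absurd (τ.eq_of_fixed h' hb) (by simp)
    · have hbc := τ.eq_of_fixed hb hc
      have : b = c := by simpa using hbc
      subst this
      exact Sum.inl_injective (τ.1.injective (h.trans h'.symm)))

theorem remove_addPair (σ : Pairing D) : σ.addPair.remove = σ :=
  ext fun y => removeFun_of_inl (σ.addPair_inl y)

theorem remove_cut (σ : Pairing D) (x : D) : (σ.cut x).remove = σ := by
  refine ext fun y => ?_
  by_cases h1 : y = x
  · subst h1
    by_cases h2 : σ.1 y = y
    · rw [h2]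
      exact removeFun_of_inr_inr (σ.cut_inl_self y) (σ.cut_inr_true_of_fixed h2)
    · exact removeFun_of_inr_inl (σ.cut_inl_self y) (σ.cut_inr_true h2)
  · by_cases h2 : y = σ.1 x
    · subst h2
      rw [σ.apply_apply]
      exact removeFun_of_inr_inl (σ.cut_inl_apply h1) (σ.cut_inr_false x)
    · exact removeFun_of_inl (σ.cut_inl_of_ne h1 h2)

theorem remove_flip (τ : Pairing (D ⊕ Bool)) : (flip τ).remove = τ.remove := by
  refine ext fun y => ?_
  have h1 := flip_inl τ y
  rcases h : τ.1 (.inl y) with z | b <;> rw [h] at h1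
  · exact (removeFun_of_inl h1).trans (removeFun_of_inl h).symm
  · have h2 := flip_inr τ b
    rcases h' : τ.1 (.inr !b) with z | c <;> rw [h'] at h2
    · exact (removeFun_of_inr_inl h1 (by simpa using h2)).trans (removeFun_of_inr_inl h h').symm
    · exact (removeFun_of_inr_inr h1 (by simpa using h2)).trans (removeFun_of_inr_inr h h').symm

/-- The ways to extend a pairing to two new points. -/
noncomputable def extend : (Σ σ : Pairing D, Unit ⊕ D ⊕ {x // σ.1 x = x}) → Pairing (D ⊕ Bool)
  | ⟨σ, .inl _⟩ => σ.addPair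
  | ⟨σ, .inr (.inl x)⟩ => σ.cut x
  | ⟨σ, .inr (.inr x)⟩ => flip (σ.cut x)

theorem flip_cut_inr_false (σ : Pairing D) {x : D} (hx : σ.1 x = x) :
    (flip (σ.cut x)).1 (.inr false) = .inr false := by
  rw [flip_inr, Bool.not_false, cut_inr_true_of_fixed σ hx]
  rfl

/-- Removing the two points recovers `σ`, and the partner of the first new point tells which
extension was used: the other new point, an old point `x`, or itself. A pairing has at most one
fixed point, so in the last case the choice is also determined. -/
theorem extend_injective : (extend (D := D)).Injective := by
  have hrem : ∀ p, (extend (D := D) p).remove = p.1 := by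
    rintro ⟨σ, _ | x | x⟩
    · exact remove_addPair σ
    · exact remove_cut σ x
    · exact (remove_flip _).trans (remove_cut σ x)
  have hval : ∀ p, (extend (D := D) p).1 (.inr false) =
      p.2.elim (fun _ => .inr true) (fun c => c.elim .inl fun _ => .inr false) := by
    rintro ⟨σ, _ | x | x⟩
    · exact addPair_inr σ false
    · exact cut_inr_false σ x
    · exact flip_cut_inr_false σ x.2
  rintro ⟨σ, c⟩ ⟨σ', c'⟩ h
  obtain rfl : σ = σ' := (hrem ⟨σ, c⟩).symm.trans ((congrArg remove h).trans (hrem ⟨σ', c'⟩))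
  have h' := (hval ⟨σ, c⟩).symm.trans
    ((congrArg (fun τ : Pairing (D ⊕ Bool) => τ.1 (.inr false)) h).trans (hval ⟨σ, c'⟩))
  rcases c with _ | x | x <;> rcases c' with _ | y | y <;>
    simp only [Sum.elim_inl, Sum.elim_inr, reduceCtorEq, Sum.inl.injEq, Sum.inr.injEq,
      Bool.true_eq_false, Bool.false_eq_true] at h'
  · rfl
  · rw [h']
  · rw [Subtype.ext (σ.eq_of_fixed x.2 y.2)]

theorem extend_surjective : (extend (D := D)).Surjective := by
  intro τ
  have hτ := τ.apply_apply
  have hinl : ∀ {y z : D}, τ.1 (.inl y) = .inl z → τ.remove.1 y = z := fun h => removeFun_of_inl h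
  rcases h : τ.1 (.inr false) with x | b
  · have hx : τ.1 (.inl x) = .inr false := by rw [← h, hτ]
    refine ⟨⟨τ.remove, .inr (.inl x)⟩, ext ?_⟩
    change ∀ a, (τ.remove.cut x).1 a = τ.1 a
    rcases h' : τ.1 (.inr true) with z | c
    · have hz : τ.1 (.inl z) = .inr true := by rw [← h', hτ]
      have hxz : τ.remove.1 x = z := removeFun_of_inr_inl hx h'
      have hne : τ.remove.1 x ≠ x := by
        rw [hxz]
        rintro rfl
        rw [hz] at hx
        simp at hx
      rintro (y | _ | _)
      · by_cases h1 : y = x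
        · rw [h1, cut_inl_self, hx]
        · by_cases h2 : y = z
          · rw [h2, hz]
            conv_lhs => rw [← hxz]
            exact cut_inl_apply _ hne
          · rw [cut_inl_of_ne _ h1 (by rwa [hxz])]
            rcases hy : τ.1 (.inl y) with w | _ | _
            · rw [hinl hy]
            · exact absurd (Sum.inl_injective (τ.1.injective (hy.trans hx.symm))) h1
            · exact absurd (Sum.inl_injective (τ.1.injective (hy.trans hz.symm))) h2
      · rw [cut_inr_false, h]
      · rw [cut_inr_true _ hne, h', hxz]
    · have hfix : τ.remove.1 x = x := removeFun_of_inr_inr hx h'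
      have hc : c = true := by
        rcases c
        · have := τ.1.injective (h'.trans hx.symm)
          simp at this
        · rfl
      subst hc
      rintro (y | _ | _)
      · by_cases h1 : y = x
        · rw [h1, cut_inl_self, hx]
        · rw [cut_inl_of_ne _ h1 (by rwa [hfix])]
          rcases hy : τ.1 (.inl y) with w | _ | _
          · rw [hinl hy]
          · exact absurd (Sum.inl_injective (τ.1.injective (hy.trans hx.symm))) h1
          · exact absurd (τ.1.injective (hy.trans h'.symm)) (by simp)
      · rw [cut_inr_false, h]
      · rw [cut_inr_true_of_fixed _ hfix, h']
  · cases b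
    · have h' : ∃ x, τ.1 (.inr true) = .inl x := by
        rcases h' : τ.1 (.inr true) with x | _ | _
        · exact ⟨x, rfl⟩
        · exact absurd (τ.1.injective (h'.trans h.symm)) (by simp)
        · exact absurd (τ.eq_of_fixed h' h) (by simp)
      obtain ⟨x, h'⟩ := h'
      have hx : τ.1 (.inl x) = .inr true := by rw [← h', hτ]
      have hfix : τ.remove.1 x = x := removeFun_of_inr_inr hx h
      refine ⟨⟨τ.remove, .inr (.inr ⟨x, hfix⟩)⟩, ext ?_⟩
      change ∀ a, (flip (τ.remove.cut x)).1 a = τ.1 a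
      rintro (y | _ | _)
      · rw [flip_inl]
        by_cases h1 : y = x
        · rw [h1, cut_inl_self, hx]
          rfl
        · rw [cut_inl_of_ne _ h1 (by rwa [hfix])]
          rcases hy : τ.1 (.inl y) with w | _ | _
          · rw [hinl hy]
            rfl
          · exact absurd (τ.1.injective (hy.trans h.symm)) (by simp)
          · exact absurd (Sum.inl_injective (τ.1.injective (hy.trans hx.symm))) h1
      · rw [flip_cut_inr_false _ hfix, h]
      · rw [flip_inr, Bool.not_true, cut_inr_false, h']
        rfl
    · refine ⟨⟨τ.remove, .inl ()⟩, ext ?_⟩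
      have ht : τ.1 (.inr true) = .inr false := by rw [← h, hτ]
      change ∀ a, (τ.remove.addPair).1 a = τ.1 a
      rintro (y | _ | _)
      · rw [addPair_inl]
        rcases hy : τ.1 (.inl y) with w | _ | _
        · rw [hinl hy]
        · exact absurd (τ.1.injective (hy.trans ht.symm)) (by simp)
        · exact absurd (τ.1.injective (hy.trans h.symm)) (by simp)
      · rw [addPair_inr, h]
        rfl
      · rw [addPair_inr, ht]
        rfl

/-- The flipped cut is needed only at a fixed point: there either new point can be the one left
over. At any other point the flip of a cut at `x` is the cut at the partner of `x`. -/
theorem tsum_extend (F : Pairing (D ⊕ Bool) → ℝ≥0∞) :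
    ∑' τ, F τ = ∑' σ : Pairing D, (F σ.addPair +
      (∑' x, F (σ.cut x) + ∑' x : {x // σ.1 x = x}, F (flip (σ.cut x)))) := by
  rw [← (Equiv.ofBijective _ ⟨extend_injective (D := D), extend_surjective⟩).tsum_eq,
    ENNReal.tsum_sigma']
  refine tsum_congr fun σ => ?_
  rw [ENNReal.tsum_sumType, ENNReal.tsum_sumType, tsum_fintype]
  simp only [Finset.univ_unique, Finset.sum_singleton]
  rfl

end Pairing

/-! ### The multigraph of a pairing of half-edges -/

/-- The multigraph of the pairing `σ` of half-edges, where `π` sends a half-edge to its vertex. -/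
abbrev halfEdgeGraph {D V : Type} [Finite D] [Finite V] (π : D → V) (σ : Pairing D) :
    MultiGraph where
  V := V
  E := {e : Sym2 D // ∃ a, σ.1 a ≠ a ∧ e = s(a, σ.1 a)}
  S := {a : D // σ.1 a = a}
  finV := inferInstance
  finE := inferInstance
  finS := inferInstance
  ends := fun e => e.1.map π
  at_ := fun a => π a.1

/-- The vertex of a half-edge, when two half-edges at a new vertex have been added. -/
def extendVertex {D V : Type} (π : D → V) : D ⊕ Bool → Option V :=
  Sum.elim (fun x => some (π x)) fun _ => none

namespace Pairing

set_option linter.unusedSectionVars false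

open MultiGraph

variable {D V : Type}

theorem halfEdgeGraph_relabel {D' V' : Type} [Finite D] [Finite D'] [Finite V] [Finite V']
    (π : D → V) (π' : D' → V')
    (e : D ≃ D') (f : V ≃ V') (h : ∀ x, π' (e x) = f (π x)) (σ : Pairing D) :
    Iso (halfEdgeGraph π σ) (halfEdgeGraph π' (relabel e σ)) := by
  refine Iso.of_bijective (H := halfEdgeGraph π' (relabel e σ)) f
    (fun z => ⟨z.1.map e, ?_⟩) (fun x => ⟨e x.1, by rw [relabel_apply, x.2]⟩) f.bijective
    ⟨?_, ?_⟩ ⟨?_, ?_⟩ (fun z => ?_) (fun x => h x.1)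
  · obtain ⟨z, a, ha, hz⟩ := z
    refine ⟨e a, ?_, ?_⟩
    · rw [relabel_apply]
      exact fun h => ha (e.injective h)
    · rw [relabel_apply]
      exact congrArg (Sym2.map e) hz
  · exact fun z z' h => Subtype.ext (Sym2.map.injective e.injective (congrArg Subtype.val h))
  · rintro ⟨z, a, ha, hz⟩
    obtain ⟨a, rfl⟩ := e.surjective a
    rw [relabel_apply] at ha hz
    exact ⟨⟨s(a, σ.1 a), a, fun h => ha (congrArg e h), rfl⟩, Subtype.ext hz.symm⟩
  · exact fun x y h => Subtype.ext (e.injective (congrArg Subtype.val h))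
  · rintro ⟨x, hx⟩
    obtain ⟨x, rfl⟩ := e.surjective x
    rw [relabel_apply] at hx
    exact ⟨⟨x, e.injective hx⟩, rfl⟩
  · change (Sym2.map e z.1).map π' = (z.1.map π).map f
    rw [Sym2.map_map, Sym2.map_map]
    exact congrArg (fun g => Sym2.map g z.1) (funext h)

variable [Finite D] [Finite V]

theorem halfEdgeGraph_flip (π : D → V) (τ : Pairing (D ⊕ Bool)) :
    Iso (halfEdgeGraph (extendVertex π) τ) (halfEdgeGraph (extendVertex π) (flip τ)) :=
  halfEdgeGraph_relabel _ _ _ (Equiv.refl _) (by rintro (x | b) <;> rfl) τ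

variable (π : D → V) (σ : Pairing D)

theorem inr_notMem_map_inl {z : Sym2 D} {b : Bool} : Sum.inr b ∉ z.map (Sum.inl : D → D ⊕ Bool) := by
  simp [Sym2.mem_map]

theorem map_extendVertex (z : Sym2 D) :
    (z.map Sum.inl).map (extendVertex π) = (z.map π).map some := by
  rw [Sym2.map_map, Sym2.map_map]
  rfl

theorem addLoop_iso_addPair :
    Iso (halfEdgeGraph π σ).addLoop (halfEdgeGraph (extendVertex π) σ.addPair) := by
  refine Iso.of_bijective (H := halfEdgeGraph (extendVertex π) σ.addPair) id
    (fun o => o.elim ⟨s(.inr false, .inr true), .inr false, by simp [addPair_inr]⟩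
      fun z => ⟨z.1.map Sum.inl, ?_⟩)
    (fun x => ⟨.inl x.1, by rw [addPair_inl, x.2]⟩) Function.bijective_id ⟨?_, ?_⟩ ⟨?_, ?_⟩
    (fun o => ?_) (fun x => rfl)
  · obtain ⟨z, a, ha, rfl⟩ := z
    refine ⟨.inl a, ?_, ?_⟩
    · rw [addPair_inl]
      exact fun h => ha (Sum.inl_injective h)
    · rw [addPair_inl, Sym2.map_mk]
  · rintro (_ | z) (_ | z') h
    · rfl
    · have h' : s(.inr false, .inr true) = z'.1.map Sum.inl := congrArg Subtype.val h
      exact absurd (h' ▸ Sym2.mem_mk_left _ _) inr_notMem_map_inl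
    · have h' : z.1.map Sum.inl = s(.inr false, .inr true) := congrArg Subtype.val h
      exact absurd (h' ▸ Sym2.mem_mk_left _ _) inr_notMem_map_inl
    · have h' : z.1.map Sum.inl = z'.1.map Sum.inl := congrArg Subtype.val h
      exact congrArg some (Subtype.ext (Sym2.map.injective Sum.inl_injective h'))
  · rintro ⟨z, a, ha, hza⟩
    rcases a with a | b
    · rw [addPair_inl] at ha hza
      exact ⟨some ⟨s(a, σ.1 a), a, fun h => ha (congrArg _ h), rfl⟩, Subtype.ext hza.symm⟩
    · refine ⟨none, Subtype.ext (Eq.trans ?_ hza.symm)⟩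
      change s(Sum.inr false, Sum.inr true) = _
      rw [addPair_inr]
      cases b
      · rfl
      · exact Sym2.eq_swap
  · exact fun x y h => Subtype.ext (Sum.inl_injective (congrArg Subtype.val h))
  · rintro ⟨x | b, hx⟩
    · exact ⟨⟨x, Sum.inl_injective (by rwa [addPair_inl] at hx)⟩, rfl⟩
    · simp [addPair_inr] at hx
  · rcases o with _ | z
    · rfl
    · exact (map_extendVertex π z.1).trans (by simp)

/-- The edge formed by `x` and its partner. -/
def edgeOf {x : D} (hx : σ.1 x ≠ x) : (halfEdgeGraph π σ).E :=
  ⟨s(x, σ.1 x), x, hx, rfl⟩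

theorem edgeOf_apply {x : D} (hx : σ.1 x ≠ x) (hx' : σ.1 (σ.1 x) ≠ σ.1 x) :
    σ.edgeOf π hx' = σ.edgeOf π hx :=
  Subtype.ext (by
    change s(σ.1 x, σ.1 (σ.1 x)) = s(x, σ.1 x)
    rw [apply_apply, Sym2.eq_swap])

theorem exists_inl_of_ne_edgeOf {x : D} {hx : σ.1 x ≠ x} {z : (halfEdgeGraph π σ).E}
    (hz : z ≠ σ.edgeOf π hx) :
    ∃ a, σ.1 a ≠ a ∧ z.1 = s(a, σ.1 a) ∧ a ≠ x ∧ a ≠ σ.1 x := by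
  obtain ⟨z, a, ha, rfl⟩ := z
  refine ⟨a, ha, rfl, ?_, ?_⟩
  · intro h
    subst h
    exact hz rfl
  · intro h
    subst h
    exact hz (edgeOf_apply π σ hx ha)

/-- The pair of `x` and its partner becomes two pairs, one with each new half-edge. The half at `x`
inherits the name of the old edge, the other half is the new one. -/
theorem insertEdge_iso_cut {x : D} (hx : σ.1 x ≠ x) :
    Iso ((halfEdgeGraph π σ).insertEdge (σ.edgeOf π hx) (π x) (π (σ.1 x)))
      (halfEdgeGraph (extendVertex π) (σ.cut x)) := by
  classical
  have hbase (z : (halfEdgeGraph π σ).E) (hz : z ≠ σ.edgeOf π hx) :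
      ∃ a, (σ.cut x).1 a ≠ a ∧ z.1.map Sum.inl = s(a, (σ.cut x).1 a) := by
    obtain ⟨a, ha, hza, h1, h2⟩ := exists_inl_of_ne_edgeOf π σ hz
    refine ⟨.inl a, ?_, ?_⟩
    · rw [cut_inl_of_ne σ h1 h2]
      exact fun h => ha (Sum.inl_injective h)
    · rw [cut_inl_of_ne σ h1 h2, hza, Sym2.map_mk]
  let z₀ : (halfEdgeGraph (extendVertex π) (σ.cut x)).E :=
    (σ.cut x).edgeOf (extendVertex π) (x := .inr false) (by rw [cut_inr_false]; simp)
  let z₁ : (halfEdgeGraph (extendVertex π) (σ.cut x)).E :=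
    (σ.cut x).edgeOf (extendVertex π) (x := .inr true) (by rw [cut_inr_true σ hx]; simp)
  have hz₀ : z₀.1 = s(.inr false, .inl x) := rfl
  have hz₁ : z₁.1 = s(.inr true, .inl (σ.1 x)) := by rw [← cut_inr_true σ hx]; rfl
  let F : Option (halfEdgeGraph π σ).E → (halfEdgeGraph (extendVertex π) (σ.cut x)).E
    | none => z₁
    | some z => if hz : z = σ.edgeOf π hx then z₀ else ⟨z.1.map Sum.inl, hbase z hz⟩
  have hF₀ : F (some (σ.edgeOf π hx)) = z₀ := dif_pos rfl
  have hF (z) (hz : z ≠ σ.edgeOf π hx) : (F (some z)).1 = z.1.map Sum.inl := by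
    simp only [F, dif_neg hz]
  have hinl (z : (halfEdgeGraph π σ).E) (hz : z ≠ σ.edgeOf π hx) (b : Bool) :
      Sum.inr b ∉ (F (some z)).1 := by
    rw [hF z hz]
    exact inr_notMem_map_inl
  have hm₀ : Sum.inr false ∈ z₀.1 := by rw [hz₀]; exact Sym2.mem_mk_left _ _
  have hm₁ : Sum.inr true ∈ z₁.1 := by rw [hz₁]; exact Sym2.mem_mk_left _ _
  have h01 : z₀ ≠ z₁ := by
    intro h
    rw [h, hz₁] at hm₀
    simp at hm₀
  refine Iso.of_bijective (H := halfEdgeGraph (extendVertex π) (σ.cut x)) id F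
    (fun y => ⟨.inl y.1, ?_⟩) Function.bijective_id ⟨?_, ?_⟩ ⟨?_, ?_⟩
    (fun o => ?_) (fun y => rfl)
  · have h1 : y.1 ≠ x := fun h => hx (by rw [← h, y.2])
    have h2 : y.1 ≠ σ.1 x := fun h => h1 (σ.1.injective (by rw [y.2, h]))
    rw [cut_inl_of_ne σ h1 h2, y.2]
  · rintro (_ | z) (_ | z') h
    · rfl
    · by_cases hz : z' = σ.edgeOf π hx
      · rw [hz, hF₀] at h
        exact absurd h.symm h01
      · exact absurd ((congrArg Subtype.val h : z₁.1 = _) ▸ hm₁) (hinl _ hz _)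
    · by_cases hz : z = σ.edgeOf π hx
      · rw [hz, hF₀] at h
        exact absurd h h01
      · exact absurd ((congrArg Subtype.val h : _ = z₁.1) ▸ hm₁) (hinl _ hz _)
    · by_cases hz : z = σ.edgeOf π hx <;> by_cases hz' : z' = σ.edgeOf π hx
      · rw [hz, hz']
      · rw [hz, hF₀] at h
        exact absurd (h ▸ hm₀) (hinl _ hz' _)
      · rw [hz', hF₀] at h
        exact absurd (h ▸ hm₀) (hinl _ hz _)
      · have h' := congrArg Subtype.val h
        rw [hF _ hz, hF _ hz'] at h'
        exact congrArg some (Subtype.ext (Sym2.map.injective Sum.inl_injective h'))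
  · rintro ⟨z, a, ha, hza⟩
    rcases a with a | _ | _
    · by_cases h1 : a = x
      · subst h1
        refine ⟨some (σ.edgeOf π hx), hF₀.trans (Subtype.ext (Eq.trans ?_ hza.symm))⟩
        rw [hz₀, cut_inl_self, Sym2.eq_swap]
      · by_cases h2 : a = σ.1 x
        · subst h2
          refine ⟨none, Subtype.ext (hz₁.trans (Eq.trans ?_ hza.symm))⟩
          rw [cut_inl_apply σ hx, Sym2.eq_swap]
        · rw [cut_inl_of_ne σ h1 h2] at ha
          have hne : σ.edgeOf π (x := a) (fun h => ha (congrArg _ h)) ≠ σ.edgeOf π hx := by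
            intro h
            rcases Sym2.eq_iff.1 (congrArg Subtype.val h) with h | h
            exacts [h1 h.1, h2 h.1]
          refine ⟨some _, Subtype.ext ((hF _ hne).trans (Eq.trans ?_ hza.symm))⟩
          rw [cut_inl_of_ne σ h1 h2]
          rfl
    · exact ⟨some (σ.edgeOf π hx), hF₀.trans (Subtype.ext hza.symm)⟩
    · exact ⟨none, Subtype.ext hza.symm⟩
  · exact fun y y' h => Subtype.ext (Sum.inl_injective (congrArg Subtype.val h))
  · rintro ⟨y | _ | _, hy⟩
    · by_cases h1 : y = x
      · rw [h1, cut_inl_self] at hy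
        simp at hy
      · by_cases h2 : y = σ.1 x
        · rw [h2, cut_inl_apply σ hx] at hy
          simp at hy
        · rw [cut_inl_of_ne σ h1 h2] at hy
          exact ⟨⟨y, Sum.inl_injective hy⟩, rfl⟩
    · rw [cut_inr_false] at hy
      simp at hy
    · rw [cut_inr_true σ hx] at hy
      simp at hy
  · rw [Sym2.map_id]
    rcases o with _ | z
    · change (z₁.1).map _ = _
      rw [hz₁]
      rfl
    · by_cases hz : z = σ.edgeOf π hx
      · subst hz
        rw [hF₀]
        refine Eq.trans ?_ (ends_insertEdge_self (G := halfEdgeGraph π σ) _ _ _).symm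
        change (z₀.1).map _ = _
        rw [hz₀, Sym2.eq_swap]
        rfl
      · refine Eq.trans ?_ (ends_insertEdge_of_ne (G := halfEdgeGraph π σ) _ _ hz).symm
        change ((F (some z)).1).map _ = _
        rw [hF _ hz]
        exact map_extendVertex π z.1

/-- Here `x` is unmatched. After the cut it is matched with the first new half-edge and the second
one is left over, so the special self-loop moves to the new vertex. -/
theorem insertSpecial_iso_cut {x : D} (hx : σ.1 x = x) :
    Iso ((halfEdgeGraph π σ).insertSpecial ⟨x, hx⟩)
      (halfEdgeGraph (extendVertex π) (σ.cut x)) := by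
  have hbase (z : (halfEdgeGraph π σ).E) :
      ∃ a, (σ.cut x).1 a ≠ a ∧ z.1.map Sum.inl = s(a, (σ.cut x).1 a) := by
    obtain ⟨z, a, ha, rfl⟩ := z
    have h1 : a ≠ x := fun h => ha (by rw [h, hx])
    rw [← hx] at h1
    refine ⟨.inl a, ?_, ?_⟩
    · rw [cut_inl_of_ne σ (by rwa [hx] at h1) h1]
      exact fun h => ha (Sum.inl_injective h)
    · rw [cut_inl_of_ne σ (by rwa [hx] at h1) h1, Sym2.map_mk]
  let z₀ : (halfEdgeGraph (extendVertex π) (σ.cut x)).E :=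
    (σ.cut x).edgeOf (extendVertex π) (x := .inr false) (by rw [cut_inr_false]; simp)
  have hz₀ : z₀.1 = s(.inr false, .inl x) := rfl
  have hm₀ : Sum.inr false ∈ z₀.1 := by rw [hz₀]; exact Sym2.mem_mk_left _ _
  have hs : ∀ y : D ⊕ Bool, (σ.cut x).1 y = y → y = .inr true := fun y hy =>
    (σ.cut x).eq_of_fixed hy (cut_inr_true_of_fixed σ hx)
  refine Iso.of_bijective (H := halfEdgeGraph (extendVertex π) (σ.cut x)) id
    (fun o => o.elim z₀ fun z => ⟨z.1.map Sum.inl, hbase z⟩)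
    (fun y => ⟨.inr true, cut_inr_true_of_fixed σ hx⟩) Function.bijective_id ⟨?_, ?_⟩ ⟨?_, ?_⟩
    (fun o => ?_) (fun y => ?_)
  · rintro (_ | z) (_ | z') h
    · rfl
    · have h' : z₀.1 = z'.1.map Sum.inl := congrArg Subtype.val h
      exact absurd (h' ▸ hm₀) inr_notMem_map_inl
    · have h' : z.1.map Sum.inl = z₀.1 := congrArg Subtype.val h
      exact absurd (h' ▸ hm₀) inr_notMem_map_inl
    · have h' : z.1.map Sum.inl = z'.1.map Sum.inl := congrArg Subtype.val h
      exact congrArg some (Subtype.ext (Sym2.map.injective Sum.inl_injective h'))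
  · rintro ⟨z, a, ha, hza⟩
    rcases a with a | _ | _
    · by_cases h1 : a = x
      · subst h1
        refine ⟨none, Subtype.ext (hz₀.trans (Eq.trans ?_ hza.symm))⟩
        rw [cut_inl_self, Sym2.eq_swap]
      · rw [cut_inl_of_ne σ h1 (by rwa [hx])] at ha
        refine ⟨some ⟨s(a, σ.1 a), a, fun h => ha (congrArg _ h), rfl⟩,
          Subtype.ext (Eq.trans ?_ hza.symm)⟩
        rw [cut_inl_of_ne σ h1 (by rwa [hx])]
        rfl
    · exact ⟨none, Subtype.ext hza.symm⟩
    · exact absurd (cut_inr_true_of_fixed σ hx) ha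
  · exact fun y y' _ => Subtype.ext (σ.eq_of_fixed y.2 y'.2)
  · exact fun y => ⟨⟨x, hx⟩, Subtype.ext (hs _ y.2).symm⟩
  · rw [Sym2.map_id]
    rcases o with _ | z
    · change (z₀.1).map _ = _
      rw [hz₀, Sym2.eq_swap]
      rfl
    · exact map_extendVertex π z.1
  · obtain rfl : y = ⟨x, hx⟩ := Subtype.ext (σ.eq_of_fixed y.2 hx)
    exact (at_insertSpecial_self (G := halfEdgeGraph π σ) ⟨x, hx⟩).symm

end Pairing

/-! ### Counting half-edges, and the insertion of one random vertex -/

namespace MultiGraph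

/-- The effect on `f` of inserting a random vertex of degree two into a multigraph with `N` links,
of which those outside of `G` are on disjoint cycles. -/
noncomputable def insertionSum (N : ℕ) (f : MultiGraph → ℝ≥0∞) (G : MultiGraph) : ℝ≥0∞ :=
  2 * ∑' a : G.Link, f (G.insertVertex a) + (2 * (N - Nat.card G.Link : ℕ) + 1 : ℕ) * f G

theorem insertionSum_congr {N : ℕ} {f : MultiGraph → ℝ≥0∞} (hf : ∀ G H, Iso G H → f G = f H)
    {G H : MultiGraph} (h : Iso G H) : insertionSum N f G = insertionSum N f H := by
  rw [insertionSum, insertionSum, tsum_insertVertex_congr hf h, card_link_congr h, hf G H h]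

end MultiGraph

namespace Pairing

open MultiGraph

section Counting

variable {D V : Type} [Finite D] [Finite V] (π : D → V) (σ : Pairing D)

/-- A half-edge of an edge. -/
noncomputable def rep (z : (halfEdgeGraph π σ).E) : D := z.2.choose

theorem rep_ne (z : (halfEdgeGraph π σ).E) : σ.1 (σ.rep π z) ≠ σ.rep π z :=
  z.2.choose_spec.1

theorem eq_rep (z : (halfEdgeGraph π σ).E) : z.1 = s(σ.rep π z, σ.1 (σ.rep π z)) :=
  z.2.choose_spec.2

theorem edgeOf_rep (z : (halfEdgeGraph π σ).E) : σ.edgeOf π (σ.rep_ne π z) = z :=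
  Subtype.ext (σ.eq_rep π z).symm

/-- An edge consists of two half-edges. -/
noncomputable def edgeProdBool : (halfEdgeGraph π σ).E × Bool ≃ {x // σ.1 x ≠ x} :=
  Equiv.ofBijective
    (fun p => if p.2 then ⟨σ.rep π p.1, σ.rep_ne π p.1⟩
      else ⟨σ.1 (σ.rep π p.1), fun h => σ.rep_ne π p.1 (σ.1.injective h)⟩) (by
    constructor
    · have key : ∀ z z', σ.rep π z = σ.rep π z' ∨ σ.rep π z = σ.1 (σ.rep π z') → z = z' := by
        intro z z' h
        refine Subtype.ext ?_
        rw [eq_rep, eq_rep]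
        rcases h with h | h
        · rw [h]
        · rw [h, apply_apply, Sym2.eq_swap]
      rintro ⟨z, b⟩ ⟨z', b'⟩ h
      cases b <;> cases b'
      · have h' : σ.1 (σ.rep π z) = σ.1 (σ.rep π z') := congrArg Subtype.val h
        rw [key z z' (.inl (σ.1.injective h'))]
      · have h' : σ.1 (σ.rep π z) = σ.rep π z' := congrArg Subtype.val h
        obtain rfl := key z z' (.inr (by rw [← h', apply_apply]))
        exact absurd h' (σ.rep_ne π z)
      · have h' : σ.rep π z = σ.1 (σ.rep π z') := congrArg Subtype.val h
        obtain rfl := key z z' (.inr h')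
        exact absurd h'.symm (σ.rep_ne π z)
      · have h' : σ.rep π z = σ.rep π z' := congrArg Subtype.val h
        rw [key z z' (.inl h')]
    · rintro ⟨x, hx⟩
      rcases Sym2.eq_iff.1 (σ.eq_rep π (σ.edgeOf π hx)) with h | h
      · exact ⟨(σ.edgeOf π hx, true), Subtype.ext h.1.symm⟩
      · exact ⟨(σ.edgeOf π hx, false), Subtype.ext h.1.symm⟩)

/-- The half-edges, sorted by their edges and special self-loops. -/
noncomputable def halfEdgeEquiv :
    ((halfEdgeGraph π σ).E × Bool) ⊕ (halfEdgeGraph π σ).S ≃ D :=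
  open Classical in
  ((Equiv.sumComm _ _).trans ((Equiv.refl _).sumCongr (σ.edgeProdBool π))).trans
    (Equiv.sumCompl fun x => σ.1 x = x)

/-- An unmatched half-edge is a link of its own, whence the rounding up. In particular the number of
links does not depend on the pairing. -/
theorem card_link : Nat.card (halfEdgeGraph π σ).Link = (Nat.card D + 1) / 2 := by
  have h1 := Nat.card_congr (σ.halfEdgeEquiv π)
  have h2 : Nat.card (halfEdgeGraph π σ).S = Nat.card D % 2 := σ.2.2
  rw [Nat.card_sum, Nat.card_prod, Nat.card_eq_fintype_card (α := Bool), Fintype.card_bool, h2] at h1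
  rw [Link, Nat.card_sum, h2]
  omega

theorem degree_halfEdgeGraph (v : V) :
    (halfEdgeGraph π σ).degree v = Nat.card {x // π x = v} := by
  classical
  let _ := Fintype.ofFinite D
  let _ := Fintype.ofFinite (halfEdgeGraph π σ).E
  let _ := Fintype.ofFinite (halfEdgeGraph π σ).S
  rw [degree_eq_sum, Nat.card_eq_fintype_card, Fintype.card_subtype, ← Nat.cast_id (Finset.card _),
    ← Finset.sum_boole, ← (σ.halfEdgeEquiv π).sum_comp, Fintype.sum_sum_type, Fintype.sum_prod_type]
  congr 1
  · refine Finset.sum_congr rfl fun z _ => ?_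
    have h : (halfEdgeGraph π σ).ends z = s(π (σ.rep π z), π (σ.1 (σ.rep π z))) :=
      congrArg (Sym2.map π) (σ.eq_rep π z)
    rw [h, mult_mk, Fintype.sum_bool]
    rfl

theorem tsum_halfEdge (g : D → ℝ≥0∞) :
    ∑' x, g x = ∑' z, (g (σ.rep π z) + g (σ.1 (σ.rep π z))) + ∑' x : (halfEdgeGraph π σ).S, g x.1 := by
  rw [← (σ.halfEdgeEquiv π).tsum_eq, ENNReal.tsum_sumType, ENNReal.tsum_prod']
  congr 1
  refine tsum_congr fun z => ?_
  rw [tsum_fintype, Fintype.sum_bool]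
  rfl

end Counting

section Insertion

variable {D V : Type} [Finite D] [Finite V]

/-- Every link is counted twice: an edge is cut from either of its half-edges, a special self-loop
by the cut and by its flip. The additional 1 in `insertionSum` is the isolated loop, which is
deleted at once. -/
theorem tsum_deleteCycles_extendVertex {f : MultiGraph → ℝ≥0∞} (hf : ∀ G H, Iso G H → f G = f H)
    (π : D → V) :
    ∑' τ : Pairing (D ⊕ Bool), f (halfEdgeGraph (extendVertex π) τ).deleteCycles =
      ∑' σ : Pairing D, insertionSum ((Nat.card D + 1) / 2) f (halfEdgeGraph π σ).deleteCycles := by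
  rw [tsum_extend]
  refine tsum_congr fun σ => ?_
  have h0 : f (halfEdgeGraph (extendVertex π) σ.addPair).deleteCycles =
      f (halfEdgeGraph π σ).deleteCycles :=
    (hf _ _ ((deleteCycles_addLoop _).trans (addLoop_iso_addPair π σ).deleteCycles)).symm
  have h1 (z : (halfEdgeGraph π σ).E) :
      f (halfEdgeGraph (extendVertex π) (σ.cut (σ.rep π z))).deleteCycles =
        f ((halfEdgeGraph π σ).insertVertex (.inl z)).deleteCycles := by
    have h := insertEdge_iso_cut π σ (σ.rep_ne π z)
    rw [edgeOf_rep] at h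
    exact hf _ _ (h.symm.trans (insertEdge_iso_insertVertex (G := halfEdgeGraph π σ)
      (congrArg (Sym2.map π) (σ.eq_rep π z)))).deleteCycles
  have h2 (z : (halfEdgeGraph π σ).E) :
      f (halfEdgeGraph (extendVertex π) (σ.cut (σ.1 (σ.rep π z)))).deleteCycles =
        f ((halfEdgeGraph π σ).insertVertex (.inl z)).deleteCycles := by
    have hne : σ.1 (σ.1 (σ.rep π z)) ≠ σ.1 (σ.rep π z) :=
      fun h => σ.rep_ne π z (σ.1.injective h)
    have h := insertEdge_iso_cut π σ hne
    rw [edgeOf_apply π σ (σ.rep_ne π z), edgeOf_rep, apply_apply] at h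
    refine hf _ _ (h.symm.trans (insertEdge_iso_insertVertex (G := halfEdgeGraph π σ) ?_)).deleteCycles
    exact (congrArg (Sym2.map π) (σ.eq_rep π z)).trans Sym2.eq_swap
  have h3 (x : (halfEdgeGraph π σ).S) :
      f (halfEdgeGraph (extendVertex π) (σ.cut x.1)).deleteCycles =
        f ((halfEdgeGraph π σ).insertVertex (.inr x)).deleteCycles :=
    hf _ _ (insertSpecial_iso_cut π σ x.2).symm.deleteCycles
  have h4 (x : (halfEdgeGraph π σ).S) :
      f (halfEdgeGraph (extendVertex π) (flip (σ.cut x.1))).deleteCycles =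
        f ((halfEdgeGraph π σ).insertVertex (.inr x)).deleteCycles :=
    (hf _ _ (halfEdgeGraph_flip π (σ.cut x.1)).deleteCycles).symm.trans (h3 x)
  have h5 := tsum_deleteCycles_insertVertex hf (halfEdgeGraph π σ)
  rw [ENNReal.tsum_sumType, card_link] at h5
  rw [h0, insertionSum, tsum_halfEdge π σ]
  simp only [h1, h2]
  rw [tsum_congr h3, tsum_congr h4, ENNReal.tsum_add]
  have h6 (a b c : ℝ≥0∞) : c + (a + a + b + b) = c + 2 * (a + b) := by ring
  rw [h6, h5]
  push_cast
  ring

end Insertion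

end Pairing

/-! ### Inserting all vertices of degree two -/

/-- A reindexed sum over functions, according to which value is increased by one. -/
theorem tsum_add_single {Λ : Type} [Fintype Λ] [DecidableEq Λ] (c : ℕ → ℝ≥0∞)
    (F : (Λ → ℕ) → ℝ≥0∞) :
    ∑' ℓ : Λ → ℕ, c (∑ a, ℓ a) * ∑' a, (ℓ a + 1 : ℕ) * F (ℓ + Pi.single a 1) =
      ∑' ℓ : Λ → ℕ, ((∑ a, ℓ a : ℕ) : ℝ≥0∞) * c (∑ a, ℓ a - 1) * F ℓ := by
  simp_rw [← ENNReal.tsum_mul_left]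
  rw [ENNReal.tsum_comm]
  have h (a : Λ) : ∑' ℓ : Λ → ℕ, c (∑ a, ℓ a) * ((ℓ a + 1 : ℕ) * F (ℓ + Pi.single a 1)) =
      ∑' ℓ : Λ → ℕ, (ℓ a : ℝ≥0∞) * (c (∑ a, ℓ a - 1) * F ℓ) := by
    rw [← (add_left_injective (Pi.single a 1 : Λ → ℕ)).tsum_eq
      (f := fun ℓ : Λ → ℕ => (ℓ a : ℝ≥0∞) * (c (∑ a, ℓ a - 1) * F ℓ))]
    · refine tsum_congr fun ℓ => ?_
      simp only [Pi.add_apply, Pi.single_eq_same, Finset.sum_add_distrib]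
      rw [Finset.sum_pi_single', if_pos (Finset.mem_univ a), Nat.add_sub_cancel]
      push_cast
      ring
    · intro ℓ hℓ
      have h0 : ℓ a ≠ 0 := fun h0 => hℓ (by simp [h0])
      refine ⟨ℓ - Pi.single a 1, funext fun b => ?_⟩
      by_cases hb : b = a
      · subst hb
        simp only [Pi.add_apply, Pi.sub_apply, Pi.single_eq_same]
        omega
      · simp [hb]
  rw [tsum_congr h, ENNReal.tsum_comm]
  refine tsum_congr fun ℓ => ?_
  rw [ENNReal.tsum_mul_right, tsum_fintype, Nat.cast_sum]
  ring

/-- The number of ways to insert `j` vertices, in a given order, so that a prescribed arrangement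
of `k` of them on the links arises, while the others end up on disjoint cycles. -/
def insertionCount : ℕ → ℕ → ℕ
  | 0, k => if k = 0 then 1 else 0
  | j + 1, k => 2 * k * insertionCount j (k - 1) + (2 * (j - k) + 1) * insertionCount j k

namespace MultiGraph

noncomputable instance linkFintype (G : MultiGraph) : Fintype G.Link := Fintype.ofFinite _

theorem card_link_subdivide (G : MultiGraph) (ℓ : G.Link → ℕ) :
    Nat.card (G.subdivide (ℓ + 1)).Link = Nat.card G.Link + ∑ a, ℓ a := by
  classical
  have h : Nat.card (G.subdivide (ℓ + 1)).Link =
      Nat.card (((Σ e : G.E, Fin (ℓ (.inl e) + 1)) ⊕ (Σ s : G.S, Fin (ℓ (.inr s)))) ⊕ G.S) := rfl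
  let _ := Fintype.ofFinite G.E
  let _ := Fintype.ofFinite G.S
  have h' : ∑ a, ℓ a = ∑ e, ℓ (.inl e) + ∑ s, ℓ (.inr s) := by
    rw [← Fintype.sum_sum_type]
    congr!
  rw [h, h', Nat.card_sum, Nat.card_sum, Nat.card_sum, Nat.card_sigma, Nat.card_sigma]
  simp only [Nat.card_eq_fintype_card, Fintype.card_fin, Finset.sum_add_distrib]
  simp
  ring

theorem not_onDisjointCycle_of_three_le {G : MultiGraph} (h : ∀ v, 3 ≤ G.degree v) (v : G.V) :
    ¬ G.OnDisjointCycle v := fun hv => by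
  have := (hv v .refl).1
  have := h v
  omega

/-- The weighted sum of `f` over the multigraphs which arise when vertices of degree two are
inserted into the links of `G`, for `j` such vertices inside and outside of `G`. -/
noncomputable def expansionSum (f : MultiGraph → ℝ≥0∞) (G : MultiGraph) (j : ℕ) : ℝ≥0∞ :=
  ∑' ℓ : G.Link → ℕ, (insertionCount j (∑ a, ℓ a) : ℝ≥0∞) * f (G.subdivide (ℓ + 1))

theorem expansionSum_zero {f : MultiGraph → ℝ≥0∞} (hf : ∀ G H, Iso G H → f G = f H)
    (G : MultiGraph) : expansionSum f G 0 = f G := by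
  rw [expansionSum, tsum_eq_single 0]
  · simp only [insertionCount, Pi.zero_apply,
        Finset.sum_const_zero, if_true, Nat.cast_one, one_mul]
    exact (hf _ _ (subdivide_one fun _ => rfl)).symm
  · intro ℓ hℓ
    have : ∑ a, ℓ a ≠ 0 := fun h => hℓ (funext fun a => Finset.sum_eq_zero_iff.1 h a (by simp))
    rw [insertionCount, if_neg this, Nat.cast_zero, zero_mul]

/-- A link carrying `ℓ a` vertices has `ℓ a + 1` places. After reindexing, an arrangement is reached
from its predecessors with total weight 2 ∑ `ℓ a`, which depends only on the total. This is why all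
arrangements with the same total keep the same weight. The links of cycles number `j - ∑ a, ℓ a`,
because insertion of `j` vertices raises the number of links by `j`. -/
theorem expansionSum_insertionSum {f : MultiGraph → ℝ≥0∞} (hf : ∀ G H, Iso G H → f G = f H)
    (G : MultiGraph) (j : ℕ) :
    expansionSum (insertionSum (Nat.card G.Link + j) f) G j = expansionSum f G (j + 1) := by
  classical
  have h1 (ℓ : G.Link → ℕ) : insertionSum (Nat.card G.Link + j) f (G.subdivide (ℓ + 1)) =
      2 * (∑' a, (ℓ a + 1 : ℕ) * f (G.subdivide (ℓ + Pi.single a 1 + 1))) +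
        (2 * (j - ∑ a, ℓ a) + 1 : ℕ) * f (G.subdivide (ℓ + 1)) := by
    rw [insertionSum, card_link_subdivide, Nat.add_sub_add_left,
      tsum_insertVertex_subdivide hf G (ℓ := ℓ + 1) (fun a => Nat.le_add_left 1 (ℓ a))
        (fun a => ℓ + Pi.single a 1 + 1)]
    · rfl
    · refine fun a => ⟨fun a => Nat.le_add_left 1 (ℓ a), ?_, fun b hb => ?_⟩
      · simp
      · simp [hb]
  rw [expansionSum, expansionSum]
  simp_rw [h1]
  have h2 := tsum_add_single (Λ := G.Link) (fun k => (insertionCount j k : ℝ≥0∞))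
    fun ℓ => f (G.subdivide (ℓ + 1))
  simp_rw [mul_add]
  rw [ENNReal.tsum_add]
  simp_rw [mul_left_comm _ (2 : ℝ≥0∞)]
  rw [ENNReal.tsum_mul_left, h2, ← ENNReal.tsum_mul_left, ← ENNReal.tsum_add]
  refine tsum_congr fun ℓ => ?_
  rw [insertionCount]
  push_cast
  ring

end MultiGraph

namespace Pairing

open MultiGraph

theorem tsum_deleteCycles_relabel {f : MultiGraph → ℝ≥0∞} (hf : ∀ G H, Iso G H → f G = f H)
    {D V D' V' : Type} [Finite D] [Finite D'] [Finite V] [Finite V']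
    (π : D → V) (π' : D' → V')
    (e : D ≃ D') (φ : V ≃ V') (h : ∀ x, π' (e x) = φ (π x)) :
    ∑' σ, f (halfEdgeGraph π σ).deleteCycles = ∑' σ, f (halfEdgeGraph π' σ).deleteCycles := by
  rw [← (relabel e).tsum_eq]
  exact tsum_congr fun σ => hf _ _ (halfEdgeGraph_relabel π π' e φ h σ).deleteCycles

theorem tsum_deleteCycles_option {f : MultiGraph → ℝ≥0∞} (hf : ∀ G H, Iso G H → f G = f H)
    {D₀ V₀ : Type} [Finite D₀] [Finite V₀] (π₀ : D₀ → V₀) (J : Type) [Finite J] :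
    ∑' σ : Pairing (D₀ ⊕ Option J × Bool), f (halfEdgeGraph (Sum.map π₀ Prod.fst) σ).deleteCycles =
      ∑' σ : Pairing (D₀ ⊕ J × Bool), insertionSum ((Nat.card (D₀ ⊕ J × Bool) + 1) / 2) f
        (halfEdgeGraph (Sum.map π₀ Prod.fst) σ).deleteCycles := by
  let e : D₀ ⊕ Option J × Bool ≃ (D₀ ⊕ J × Bool) ⊕ Bool :=
    { toFun := fun x => match x with
        | .inl x => .inl (.inl x)
        | .inr (some j, b) => .inl (.inr (j, b))
        | .inr (none, b) => .inr b
      invFun := fun x => match x with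
        | .inl (.inl x) => .inl x
        | .inl (.inr (j, b)) => .inr (some j, b)
        | .inr b => .inr (none, b)
      left_inv := by rintro (x | ⟨_ | j, b⟩) <;> rfl
      right_inv := by rintro ((x | ⟨j, b⟩) | b) <;> rfl }
  let φ : V₀ ⊕ Option J ≃ Option (V₀ ⊕ J) :=
    { toFun := fun x => match x with
        | .inl x => some (.inl x)
        | .inr (some j) => some (.inr j)
        | .inr none => none
      invFun := fun x => match x with
        | some (.inl x) => .inl x
        | some (.inr j) => .inr (some j)
        | none => .inr none
      left_inv := by rintro (x | _ | j) <;> rfl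
      right_inv := by rintro (_ | x | j) <;> rfl }
  exact (tsum_deleteCycles_relabel hf _ (extendVertex (Sum.map π₀ Prod.fst)) e φ
    (by rintro (x | ⟨_ | j, b⟩) <;> rfl)).trans (tsum_deleteCycles_extendVertex hf _)

theorem tsum_deleteCycles_eq {D₀ V₀ : Type} [Finite D₀] [Finite V₀] (π₀ : D₀ → V₀)
    (hπ₀ : ∀ v, 3 ≤ Nat.card {x // π₀ x = v}) (J : Type) [Finite J]
    {f : MultiGraph → ℝ≥0∞} (hf : ∀ G H, Iso G H → f G = f H) :
    ∑' σ : Pairing (D₀ ⊕ J × Bool), f (halfEdgeGraph (Sum.map π₀ Prod.fst) σ).deleteCycles =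
      ∑' τ : Pairing D₀, expansionSum f (halfEdgeGraph π₀ τ) (Nat.card J) := by
  -- The induction must range over all `f`: removing one vertex of `J` replaces `f` by `insertionSum
  -- _ f`. In the base case all degrees are at least three and nothing is deleted.
  suffices h : ∀ [Finite J] (f : MultiGraph → ℝ≥0∞), (∀ G H, Iso G H → f G = f H) →
      ∑' σ : Pairing (D₀ ⊕ J × Bool), f (halfEdgeGraph (Sum.map π₀ Prod.fst) σ).deleteCycles =
        ∑' τ : Pairing D₀, expansionSum f (halfEdgeGraph π₀ τ) (Nat.card J) from h f hf
  refine Finite.induction_empty_option (P := fun J => ∀ [Finite J] (f : MultiGraph → ℝ≥0∞),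
    (∀ G H, Iso G H → f G = f H) →
      ∑' σ : Pairing (D₀ ⊕ J × Bool), f (halfEdgeGraph (Sum.map π₀ Prod.fst) σ).deleteCycles =
        ∑' τ : Pairing D₀, expansionSum f (halfEdgeGraph π₀ τ) (Nat.card J)) ?_ ?_ ?_ J
  · intro J J' e ih _ f hf
    have _ : Finite J := Finite.of_equiv J' e.symm
    rw [← Nat.card_congr e, ← ih f hf]
    exact (tsum_deleteCycles_relabel hf _ _ ((Equiv.refl _).sumCongr (e.prodCongr (Equiv.refl _)))
      ((Equiv.refl _).sumCongr e) (by rintro (x | ⟨x, b⟩) <;> rfl)).symm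
  · intro _ f hf
    have h0 := tsum_deleteCycles_relabel hf (Sum.map π₀ Prod.fst : D₀ ⊕ PEmpty × Bool → V₀ ⊕ PEmpty)
      π₀ (Equiv.sumEmpty _ _) (Equiv.sumEmpty _ _)
      (by rintro (x | ⟨x, b⟩); exacts [rfl, x.elim])
    refine h0.trans (tsum_congr fun τ => ?_)
    rw [Nat.card_eq_fintype_card, Fintype.card_pempty, expansionSum_zero hf]
    refine hf _ _ (iso_deleteCycles_self (not_onDisjointCycle_of_three_le fun v => ?_)).symm
    exact (hπ₀ v).trans_eq (degree_halfEdgeGraph π₀ τ v).symm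
  · intro J _ ih _ f hf
    rw [tsum_deleteCycles_option hf, ih _ fun G H h => insertionSum_congr hf h]
    refine tsum_congr fun τ => ?_
    have hc : (Nat.card (D₀ ⊕ J × Bool) + 1) / 2 =
        Nat.card (halfEdgeGraph π₀ τ).Link + Nat.card J := by
      rw [Nat.card_sum, Nat.card_prod, Nat.card_eq_fintype_card (α := Bool), Fintype.card_bool,
        card_link]
      omega
    rw [hc, expansionSum_insertionSum hf, Finite.card_option]

end Pairing

/-! ### The number of vertices of degree two on disjoint cycles -/

/-- This makes the truncated subtraction `j - k` in the recursion harmless. -/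
theorem insertionCount_eq_zero {j k : ℕ} (h : j < k) : insertionCount j k = 0 := by
  induction j generalizing k with
  | zero => simp [insertionCount, h.ne']
  | succ j ih => rw [insertionCount, ih (by omega), ih (by omega)]; simp

theorem succ_mul_multichoose_succ (m k : ℕ) :
    (k + 1) * m.multichoose (k + 1) = (m + k) * m.multichoose k := by
  induction m generalizing k with
  | zero => cases k <;> simp
  | succ m ih =>
    induction k with
    | zero => simp
    | succ k ih' =>
      rw [Nat.multichoose_succ_succ, Nat.multichoose_succ_succ] at *
      have := ih (k + 1)
      nlinarith

/-- The weighted sum of `g` over the numbers of vertices on the links, when `j` vertices of degree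
two are inserted into a multigraph with `m` links. -/
noncomputable def insertionTotal (m j : ℕ) (g : ℕ → ℝ) : ℝ :=
  ∑ k ∈ Finset.range (j + 1), (insertionCount j k * m.multichoose k : ℝ) * g k

/-- Summation by parts: the absorption identity for `multichoose` moves the recursion from the
counts to the test function, where it becomes the unnormalised transition operator of the urn. -/
theorem insertionTotal_succ (m j : ℕ) (g : ℕ → ℝ) :
    insertionTotal m (j + 1) g =
      insertionTotal m j fun k => 2 * (m + k) * g (k + 1) + (2 * (j - k) + 1) * g k := by
  have h1 (k : ℕ) : (k + 1 : ℝ) * m.multichoose (k + 1) = (m + k) * m.multichoose k := by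
    exact_mod_cast succ_mul_multichoose_succ m k
  have h2 (k : ℕ) : ((insertionCount (j + 1) k * m.multichoose k : ℝ)) * g k =
      2 * k * insertionCount j (k - 1) * m.multichoose k * g k +
        insertionCount j k * m.multichoose k * ((2 * (j - k) + 1) * g k) := by
    rcases lt_or_ge j k with h | h
    · rw [insertionCount, insertionCount_eq_zero h]
      push_cast
      ring
    · rw [insertionCount]
      push_cast [h]
      ring
  rw [insertionTotal, insertionTotal, Finset.sum_congr rfl fun k _ => h2 k,
    Finset.sum_add_distrib, Finset.sum_range_succ', Finset.sum_range_succ (n := j + 1),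
    insertionCount_eq_zero (Nat.lt_succ_self j)]
  simp only [Nat.add_sub_cancel, Nat.cast_zero, mul_zero, zero_mul, add_zero]
  rw [← Finset.sum_add_distrib]
  refine Finset.sum_congr rfl fun k _ => ?_
  push_cast
  linear_combination 2 * insertionCount j k * g (k + 1) * h1 k

theorem insertionTotal_zero (m : ℕ) (g : ℕ → ℝ) : insertionTotal m 0 g = g 0 := by
  simp [insertionTotal, insertionCount]

theorem insertionTotal_mul (m j : ℕ) (c : ℝ) (g : ℕ → ℝ) :
    (insertionTotal m j fun k => c * g k) = c * insertionTotal m j g := by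
  rw [insertionTotal, insertionTotal, Finset.mul_sum]
  exact Finset.sum_congr rfl fun k _ => by ring

theorem insertionTotal_congr (m j : ℕ) {g h : ℕ → ℝ} (H : ∀ k, k ≤ j → g k = h k) :
    insertionTotal m j g = insertionTotal m j h :=
  Finset.sum_congr rfl fun k hk => by rw [H k (by simpa [Nat.lt_succ_iff] using hk)]

theorem insertionTotal_sub (m j : ℕ) (g h : ℕ → ℝ) :
    insertionTotal m j g - insertionTotal m j h = insertionTotal m j fun k => g k - h k := by
  rw [insertionTotal, insertionTotal, ← Finset.sum_sub_distrib]
  exact Finset.sum_congr rfl fun k _ => by ring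

theorem insertionTotal_nonneg (m j : ℕ) {g : ℕ → ℝ} (H : ∀ k, k ≤ j → 0 ≤ g k) :
    0 ≤ insertionTotal m j g :=
  Finset.sum_nonneg fun k hk => mul_nonneg (by positivity) (H k (by simpa [Nat.lt_succ_iff] using hk))

/-- The number of ways to insert `j` vertices of degree two into a multigraph with `m` links. -/
noncomputable def insertionNorm (m j : ℕ) : ℝ := ∏ i ∈ Finset.range j, (2 * (m + i : ℝ) + 1)

theorem insertionNorm_pos (m j : ℕ) : 0 < insertionNorm m j :=
  Finset.prod_pos fun _ _ => by positivity

theorem insertionNorm_succ (m j : ℕ) :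
    insertionNorm m (j + 1) = insertionNorm m j * (2 * (m + j) + 1) :=
  Finset.prod_range_succ _ _

theorem insertionTotal_one (m j : ℕ) : (insertionTotal m j fun _ => 1) = insertionNorm m j := by
  induction j with
  | zero => simp [insertionTotal_zero, insertionNorm]
  | succ j ih =>
    rw [insertionTotal_succ, insertionNorm_succ, ← ih, mul_comm, ← insertionTotal_mul]
    exact insertionTotal_congr _ _ fun k _ => by ring

/-- The function 2(j - k) + 1 is an eigenfunction along the urn: one step multiplies it by 2(m + j)
+ 3, because 2(m + k) + 2(j + 1 - k) + 1 no longer involves k. This yields the mean number of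
vertices on disjoint cycles. -/
theorem insertionTotal_cycles (m j : ℕ) :
    (insertionTotal m j fun k => 2 * (j - k) + 1) =
      insertionNorm m j * ((2 * (m + j) + 1) / (2 * m + 1)) := by
  induction j with
  | zero =>
    have : (2 * m + 1 : ℝ) ≠ 0 := by positivity
    simp [insertionTotal_zero, insertionNorm, div_self this]
  | succ j ih =>
    have h1 : (2 * (m + j) + 1 : ℝ) ≠ 0 := by positivity
    have h2 : (2 * m + 1 : ℝ) ≠ 0 := by positivity
    rw [insertionTotal_succ, insertionNorm_succ]
    have h3 := insertionTotal_mul m j (2 * (m + j) + 3) fun k => 2 * (j - k : ℝ) + 1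
    rw [ih] at h3
    have h4 : insertionNorm m j * (2 * (m + j) + 1) * ((2 * (m + (j + 1 : ℕ)) + 1) / (2 * m + 1)) =
        (2 * (m + j) + 3) * (insertionNorm m j * ((2 * (m + j) + 1) / (2 * m + 1))) := by
      push_cast
      ring
    rw [h4, ← h3]
    exact insertionTotal_congr _ _ fun k _ => by push_cast; ring

/-- The probability that `k` of `j` vertices of degree two end up on the links. -/
noncomputable def insertionProb (m j k : ℕ) : ℝ :=
  insertionCount j k * m.multichoose k / insertionNorm m j

theorem insertionProb_nonneg (m j k : ℕ) : 0 ≤ insertionProb m j k :=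
  div_nonneg (by positivity) (insertionNorm_pos m j).le

/-- For given `k`, the number of `j` at which `k` of `j` vertices are on the links is at most `2` on
average. -/
theorem sum_insertionProb_le {m : ℕ} (hm : 2 ≤ m) (k J : ℕ) :
    ∑ j ∈ Finset.range J, insertionProb m j k ≤ 2 := by
  have hm' : (2 : ℝ) ≤ m := by exact_mod_cast hm
  -- A potential for the time spent at level k: Φ(j, x) is the indicator of x = k plus the mean of
  -- Φ(j + 1, ·) after one step of the urn from x. The sum then telescopes to Φ(0, 0) minus a
  -- nonnegative term, and `2 ≤ m` keeps the denominators positive and Φ(0, 0) at most 2.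
  let Φ (j x : ℕ) : ℝ := if x ≤ k then (2 * (m + j) - 1) / (2 * (m + x) - 2) else 0
  have hΦ (j x : ℕ) : 0 ≤ Φ j x := by
    simp only [Φ]
    split_ifs
    · refine div_nonneg ?_ ?_
      · have : (0 : ℝ) ≤ j := by positivity
        linarith
      · have : (0 : ℝ) ≤ x := by positivity
        linarith
    · rfl
  have h (J : ℕ) : ∑ j ∈ Finset.range J, insertionProb m j k =
      (2 * m - 1) / (2 * m - 2) - insertionTotal m J (Φ J) / insertionNorm m J := by
    induction J with
    | zero => simp [insertionTotal_zero, insertionNorm, Φ]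
    | succ j ih =>
      have h1 : (2 * (m + j) + 1 : ℝ) ≠ 0 := by positivity
      have h2 := (insertionNorm_pos m j).ne'
      have h3 : (insertionTotal m j fun x => if x = k then 1 else 0) =
          insertionCount j k * m.multichoose k := by
        simp only [insertionTotal, mul_ite, mul_one, mul_zero]
        rw [Finset.sum_ite_eq']
        split_ifs with hk
        · rfl
        · rw [insertionCount_eq_zero (by simpa using hk)]; simp
      have h4 : insertionTotal m (j + 1) (Φ (j + 1)) = (2 * (m + j) + 1) *
          (insertionTotal m j (Φ j) - insertionCount j k * m.multichoose k) := by
        rw [insertionTotal_succ, ← h3, insertionTotal_sub, ← insertionTotal_mul]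
        refine insertionTotal_congr _ _ fun x hx => ?_
        have hx0 : (0 : ℝ) ≤ x := by positivity
        have h5 : (2 * (m + x) - 2 : ℝ) ≠ 0 := by linarith
        have h6 : (m + x : ℝ) ≠ 0 := by linarith
        have h8 : (m + x - 1 : ℝ) ≠ 0 := by linarith
        rcases lt_trichotomy x k with hxk | hxk | hxk
        · simp only [Φ, if_pos hxk.le, if_pos (Nat.succ_le_of_lt hxk), if_neg hxk.ne]
          have h7 : (2 * (m + (x + 1 : ℕ)) - 2 : ℝ) = 2 * (m + x) := by push_cast; ring
          rw [h7]
          field_simp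
          push_cast
          ring
        · subst hxk
          simp only [Φ, if_pos le_rfl, if_neg (Nat.not_succ_le_self x), if_true]
          field_simp
          push_cast
          ring
        · simp only [Φ, if_neg hxk.not_ge, if_neg (not_le.2 (Nat.lt_succ_of_lt hxk)),
            if_neg hxk.ne']
          ring
      rw [Finset.sum_range_succ, ih, h4, insertionNorm_succ, insertionProb]
      field_simp
      ring
  have h1 : 0 ≤ insertionTotal m J (Φ J) / insertionNorm m J :=
    div_nonneg (insertionTotal_nonneg _ _ fun x _ => hΦ J x) (insertionNorm_pos m J).le
  have h2 : (2 * m - 1 : ℝ) / (2 * m - 2) ≤ 2 := by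
    rw [div_le_iff₀ (by linarith)]
    linarith
  rw [h J]
  linarith

theorem sum_insertionProb (m j : ℕ) :
    ∑ k ∈ Finset.range (j + 1), insertionProb m j k = 1 := by
  have h := insertionTotal_one m j
  simp only [insertionTotal, mul_one] at h
  simp only [insertionProb]
  rw [← Finset.sum_div, h, div_self (insertionNorm_pos m j).ne']

theorem sum_insertionProb_mul_sub (m j : ℕ) :
    ∑ k ∈ Finset.range (j + 1), insertionProb m j k * (j - k) = j / (2 * m + 1) := by
  have h := insertionTotal_cycles m j
  have h1 : (2 * m + 1 : ℝ) ≠ 0 := by positivity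
  have h0 := (insertionNorm_pos m j).ne'
  have h2 : ∑ k ∈ Finset.range (j + 1), insertionProb m j k * (2 * (j - k) + 1) =
      (2 * (m + j) + 1) / (2 * m + 1) := by
    simp only [insertionTotal] at h
    rw [← mul_right_inj' h0, ← h, Finset.mul_sum]
    refine Finset.sum_congr rfl fun k _ => ?_
    rw [insertionProb]
    field_simp
  have h3 : ∑ k ∈ Finset.range (j + 1), insertionProb m j k * (2 * (j - k) + 1) =
      2 * ∑ k ∈ Finset.range (j + 1), insertionProb m j k * (j - k) +
        ∑ k ∈ Finset.range (j + 1), insertionProb m j k := by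
    rw [Finset.mul_sum, ← Finset.sum_add_distrib]
    exact Finset.sum_congr rfl fun k _ => by ring
  have h4 : (2 * (m + j) + 1 : ℝ) / (2 * m + 1) = 2 * (j / (2 * m + 1)) + 1 := by
    field_simp
    ring
  rw [sum_insertionProb] at h3
  linarith

/-! ### The two models for given degrees -/

namespace MultiGraph

/-- The sum of `f` over the multigraphs in which `k` vertices of degree two have been inserted into
the links of `G`. -/
noncomputable def levelSum (f : MultiGraph → ℝ≥0∞) (G : MultiGraph) (k : ℕ) : ℝ≥0∞ :=
  ∑' ℓ : {ℓ : G.Link → ℕ // ∑ a, ℓ a = k}, f (G.subdivide (ℓ.1 + 1))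

theorem tsum_mul_levelSum (f : MultiGraph → ℝ≥0∞) (G : MultiGraph) (c : ℕ → ℝ≥0∞) :
    ∑' k, c k * levelSum f G k = ∑' ℓ : G.Link → ℕ, c (∑ a, ℓ a) * f (G.subdivide (ℓ + 1)) := by
  rw [← (Equiv.sigmaFiberEquiv fun ℓ : G.Link → ℕ => ∑ a, ℓ a).tsum_eq, ENNReal.tsum_sigma']
  refine tsum_congr fun k => ?_
  rw [levelSum, ← ENNReal.tsum_mul_left]
  refine tsum_congr fun ℓ => ?_
  rw [Equiv.sigmaFiberEquiv_apply, ℓ.2]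

theorem expansionSum_eq (f : MultiGraph → ℝ≥0∞) (G : MultiGraph) (j : ℕ) :
    expansionSum f G j = ∑' k, (insertionCount j k : ℝ≥0∞) * levelSum f G k :=
  (tsum_mul_levelSum f G fun k => (insertionCount j k : ℝ≥0∞)).symm

theorem card_level (G : MultiGraph) (k : ℕ) :
    Nat.card {ℓ : G.Link → ℕ // ∑ a, ℓ a = k} = (Nat.card G.Link).multichoose k := by
  classical
  rw [← Nat.card_congr (Sym.equivNatSumOfFintype G.Link k), Nat.card_eq_fintype_card,
    Sym.card_sym_eq_multichoose, Nat.card_eq_fintype_card]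

theorem finite_level (G : MultiGraph) (k : ℕ) : Finite {ℓ : G.Link → ℕ // ∑ a, ℓ a = k} := by
  classical
  exact .of_equiv _ (Sym.equivNatSumOfFintype G.Link k)

theorem levelSum_one (G : MultiGraph) (k : ℕ) :
    levelSum 1 G k = (Nat.card G.Link).multichoose k := by
  have := finite_level G k
  rw [levelSum, ← card_level]
  simp only [Pi.one_apply]
  rw [ENNReal.tsum_const_of_finite, mul_one]

theorem levelSum_le {f : MultiGraph → ℝ≥0∞} (hf : ∀ G, f G ≤ 1) (G : MultiGraph) (k : ℕ) :
    levelSum f G k ≤ (Nat.card G.Link).multichoose k := by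
  rw [← levelSum_one]
  exact ENNReal.tsum_le_tsum fun ℓ => hf _

theorem expansionSum_one (G : MultiGraph) (j : ℕ) :
    expansionSum 1 G j = ENNReal.ofReal (insertionNorm (Nat.card G.Link) j) := by
  rw [expansionSum_eq, tsum_eq_sum (s := Finset.range (j + 1)), ← insertionTotal_one, insertionTotal,
    ENNReal.ofReal_sum_of_nonneg fun _ _ => by positivity]
  · refine Finset.sum_congr rfl fun k _ => ?_
    rw [levelSum_one, mul_one, ENNReal.ofReal_mul (by positivity), ENNReal.ofReal_natCast,
      ENNReal.ofReal_natCast]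
  · intro k hk
    rw [insertionCount_eq_zero (by simpa using hk), Nat.cast_zero, zero_mul]

end MultiGraph

theorem geomLaw_zero (q : ℝ) : geomLaw q {0} = 0 := by
  rw [geomLaw, Measure.map_apply (measurable_of_countable _) (measurableSet_singleton 0)]
  have : (fun x : ℕ => x + 1) ⁻¹' {0} = ∅ := by ext; simp
  rw [this, measure_empty]

theorem geomLaw_succ {q : ℝ} (h0 : 0 < q) (h1 : q ≤ 1) (k : ℕ) :
    geomLaw q {k + 1} = ENNReal.ofReal ((1 - q) ^ k * q) := by
  rw [geomLaw, Measure.map_apply (measurable_of_countable _) (measurableSet_singleton _)]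
  have h : (fun x : ℕ => x + 1) ⁻¹' {k + 1} = {k} := by ext; simp
  have hp : Set.projIcc (0 : ℝ) 1 zero_le_one q = ⟨q, h0.le, h1⟩ := Set.projIcc_of_mem _ _
  rw [h, hp, geometricMeasure_singleton]
  intro h
  exact h0.ne' (congrArg Subtype.val h)

instance (q : ℝ) : IsProbabilityMeasure (geomLaw q) :=
  Measure.isProbabilityMeasure_map (measurable_of_countable _).aemeasurable

-- The product of the geometric weights depends only on the total number of inserted vertices, so
-- the sum can be sorted by levels.
open MultiGraph in
theorem geomExpansionProb_eq {q : ℝ} (h0 : 0 < q) (h1 : q ≤ 1) (G : MultiGraph)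
    (A : Set MultiGraph) :
    geomExpansionProb q G A =
      ∑' k, ENNReal.ofReal (q ^ Nat.card G.Link * (1 - q) ^ k) * levelSum (A.indicator 1) G k := by
  classical
  rw [tsum_mul_levelSum, geomExpansionProb]
  have hF : Fintype.ofFinite (G.E ⊕ G.S) = linkFintype G := rfl
  rw [hF, ← Measure.tsum_indicator_apply_singleton _ _ (Set.to_countable _).measurableSet,
    ← (add_left_injective (1 : G.Link → ℕ)).tsum_eq]
  · refine tsum_congr fun ℓ => ?_
    by_cases h : G.subdivide (ℓ + 1) ∈ A
    · rw [Set.indicator_of_mem (by exact h), Set.indicator_of_mem h, Measure.pi_singleton]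
      simp only [Pi.add_apply, Pi.one_apply, geomLaw_succ h0 h1, mul_one]
      rw [← ENNReal.ofReal_prod_of_nonneg fun a _ =>
        mul_nonneg (pow_nonneg (by linarith) _) h0.le, Finset.prod_mul_distrib,
        Finset.prod_pow_eq_pow_sum, Finset.prod_const, Finset.card_univ, Nat.card_eq_fintype_card,
        mul_comm]
    · rw [Set.indicator_of_notMem (by exact h), Set.indicator_of_notMem h, mul_zero]
  -- A length function with some value 0 has no mass, so only functions of the form `ℓ + 1`
  -- contribute.
  · intro ℓ hℓ
    have h (a : G.Link) : ℓ a ≠ 0 := by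
      intro ha
      refine hℓ ?_
      rw [Set.indicator_apply_eq_zero]
      intro _
      rw [Measure.pi_singleton]
      exact Finset.prod_eq_zero (Finset.mem_univ a) (by rw [ha, geomLaw_zero])
    exact ⟨ℓ - 1, funext fun a => Nat.sub_add_cancel (Nat.one_le_iff_ne_zero.2 (h a))⟩

theorem unifExp_tsum {X : Type} (c : ℕ → ℝ≥0∞) (g : ℕ → X → ℝ≥0∞) :
    unifExp (fun x => ∑' k, c k * g k x) = ∑' k, c k * unifExp (g k) := by
  simp only [unifExp, div_eq_mul_inv]
  rw [ENNReal.tsum_comm, ← ENNReal.tsum_mul_right]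
  refine tsum_congr fun k => ?_
  rw [ENNReal.tsum_mul_left, mul_assoc]

theorem unifExp_le {X : Type} [Finite X] {g : X → ℝ≥0∞} {c : ℝ≥0∞} (h : ∀ x, g x ≤ c) :
    unifExp g ≤ c := by
  refine ENNReal.div_le_of_le_mul ?_
  rw [mul_comm, ← ENNReal.tsum_const_of_finite]
  exact ENNReal.tsum_le_tsum h

section Degrees

variable {n : ℕ} (d : Fin n → ℕ)

/-- The number of links of the kernel. -/
noncomputable def kernelLinks : ℕ := (Nat.card (HalfEdge (degreesFrom 3 d)) + 1) / 2

/-- The number of vertices of degree two. -/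
noncomputable def degreeTwoCount : ℕ := Nat.card {u // d u = 2}

/-- The expected sum of `f` over the multigraphs in which `k` vertices have been inserted into the
links of the kernel. -/
noncomputable def kernelSum (f : MultiGraph → ℝ≥0∞) (k : ℕ) : ℝ≥0∞ :=
  unifExp fun τ : Pairing (HalfEdge (degreesFrom 3 d)) =>
    (configGraph (degreesFrom 3 d) τ).levelSum f k

theorem card_link_configGraph (τ : Pairing (HalfEdge (degreesFrom 3 d))) :
    Nat.card (configGraph (degreesFrom 3 d) τ).Link = kernelLinks d :=
  Pairing.card_link Sigma.fst τ

theorem kernelSum_le {f : MultiGraph → ℝ≥0∞} (hf : ∀ G, f G ≤ 1) (k : ℕ) :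
    kernelSum d f k ≤ (kernelLinks d).multichoose k := by
  refine unifExp_le fun τ => (MultiGraph.levelSum_le hf _ k).trans_eq ?_
  rw [card_link_configGraph]

theorem unifExp_geomExpansionProb {q : ℝ} (h0 : 0 < q) (h1 : q ≤ 1) (A : Set MultiGraph) :
    (unifExp fun σ : Pairing (HalfEdge (degreesFrom 3 d)) =>
      geomExpansionProb q (configGraph (degreesFrom 3 d) σ) A) =
      ∑' k, ENNReal.ofReal (q ^ kernelLinks d * (1 - q) ^ k) * kernelSum d (A.indicator 1) k := by
  simp only [kernelSum]
  rw [← unifExp_tsum]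
  refine congrArg unifExp (funext fun τ => ?_)
  rw [geomExpansionProb_eq h0 h1, card_link_configGraph]

/-- The vertices of degree at least two. -/
def vertexSplit : {u // 2 ≤ d u} ≃ {u // 3 ≤ d u} ⊕ {u // d u = 2} where
  toFun u := if h : 3 ≤ d u.1 then .inl ⟨u.1, h⟩ else .inr ⟨u.1, by have := u.2; omega⟩
  invFun := Sum.elim (fun u => ⟨u.1, by have := u.2; omega⟩) fun u => ⟨u.1, u.2.ge⟩
  left_inv u := by dsimp only; split_ifs <;> rfl
  right_inv := by
    rintro (u | u)
    · exact dif_pos u.2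
    · exact dif_neg (by have := u.2; simp only [Sum.elim_inr]; omega)

/-- The half-edges at the vertices of degree at least two. -/
def halfEdgeSplit : HalfEdge (degreesFrom 2 d) ≃
    HalfEdge (degreesFrom 3 d) ⊕ {u // d u = 2} × Bool where
  toFun x := if h : 3 ≤ d x.1.1 then .inl ⟨⟨x.1.1, h⟩, x.2⟩
    else .inr (⟨x.1.1, by have := x.1.2; omega⟩,
      finTwoEquiv (Fin.cast (by have := x.1.2; unfold degreesFrom; omega) x.2))
  invFun := Sum.elim (fun x => ⟨⟨x.1.1, by have := x.1.2; omega⟩, x.2⟩)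
    fun x => ⟨⟨x.1.1, x.1.2.ge⟩, Fin.cast x.1.2.symm
      (finTwoEquiv.symm x.2)⟩
  left_inv x := by
    dsimp only
    split_ifs
    · rfl
    · simp only [Sum.elim_inr, Equiv.symm_apply_apply]
      rfl
  right_inv := by
    rintro (x | x)
    · exact dif_pos x.1.2
    · refine (dif_neg (by have := x.1.2; simp only [Sum.elim_inr]; omega)).trans ?_
      refine congrArg Sum.inr (Prod.ext rfl ?_)
      exact finTwoEquiv.apply_symm_apply x.2

theorem map_fst_halfEdgeSplit (x : HalfEdge (degreesFrom 2 d)) :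
    Sum.map Sigma.fst Prod.fst (halfEdgeSplit d x) = vertexSplit d x.1 := by
  by_cases h : 3 ≤ d x.1.1
  · simp [halfEdgeSplit, vertexSplit, h]
  · simp [halfEdgeSplit, vertexSplit, h]

theorem tsum_deleteCycles_configGraph {f : MultiGraph → ℝ≥0∞}
    (hf : ∀ G H, MultiGraph.Iso G H → f G = f H) :
    ∑' σ : Pairing (HalfEdge (degreesFrom 2 d)), f (configGraph (degreesFrom 2 d) σ).deleteCycles =
      ∑' τ : Pairing (HalfEdge (degreesFrom 3 d)),
        (configGraph (degreesFrom 3 d) τ).expansionSum f (degreeTwoCount d) := by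
  refine (Pairing.tsum_deleteCycles_relabel hf _ _ (halfEdgeSplit d) (vertexSplit d)
    (map_fst_halfEdgeSplit d)).trans (Pairing.tsum_deleteCycles_eq _ (fun v => ?_) _ hf)
  refine v.2.trans_eq ?_
  rw [Nat.card_congr (Equiv.sigmaSubtype v)]
  simp [degreesFrom]

theorem unifExp_deleteCycles {f : MultiGraph → ℝ≥0∞}
    (hf : ∀ G H, MultiGraph.Iso G H → f G = f H) :
    (unifExp fun σ : Pairing (HalfEdge (degreesFrom 2 d)) =>
      f (configGraph (degreesFrom 2 d) σ).deleteCycles) =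
      ∑' k, ENNReal.ofReal (insertionCount (degreeTwoCount d) k /
        insertionNorm (kernelLinks d) (degreeTwoCount d)) * kernelSum d f k := by
  -- The constant function 1 counts pairings: their number is `insertionNorm` times the number of
  -- kernel pairings. This is the normalisation.
  have h1 := tsum_deleteCycles_configGraph d (f := 1) fun _ _ _ => rfl
  simp only [Pi.one_apply, MultiGraph.expansionSum_one, card_link_configGraph] at h1
  rw [ENNReal.tsum_const_of_finite, ENNReal.tsum_const_of_finite, mul_one] at h1
  have hZ := insertionNorm_pos (kernelLinks d) (degreeTwoCount d)
  set Z := insertionNorm (kernelLinks d) (degreeTwoCount d)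
  simp only [kernelSum]
  rw [← unifExp_tsum, unifExp, unifExp, tsum_deleteCycles_configGraph d hf, h1, div_eq_mul_inv,
    div_eq_mul_inv, ENNReal.mul_inv (.inr ENNReal.ofReal_ne_top)
      (.inr (ENNReal.ofReal_pos.2 hZ).ne'), ← ENNReal.ofReal_inv_of_pos hZ, ← ENNReal.tsum_mul_right,
    ← ENNReal.tsum_mul_right]
  refine tsum_congr fun τ => ?_
  rw [MultiGraph.expansionSum_eq, mul_comm _⁻¹, ← mul_assoc, ← ENNReal.tsum_mul_right]
  refine congrArg (· * _) (tsum_congr fun k => ?_)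
  rw [div_eq_inv_mul, ENNReal.ofReal_mul (inv_nonneg.2 hZ.le), ENNReal.ofReal_natCast]
  ring

end Degrees

/-! ### The law of the kernel degrees and of the number of vertices of degree two -/

section KernelPart

variable {n : ℕ}

/-- The degrees which are at least three, the others being replaced by zero. -/
def kernelPart (d : Fin n → ℕ) : Fin n → ℕ := fun u => if 3 ≤ d u then d u else 0

/-- The vertex type of `degreesFrom k d` depends on `d`, which blocks rewriting. Hence the statement
is made for an arbitrary function `Q` of the predicate and of the degrees on it. -/
theorem degreesFrom_congr {k : ℕ} {d d' : Fin n → ℕ} (h : ∀ u, k ≤ d u ↔ k ≤ d' u)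
    (h' : ∀ u, k ≤ d u → d u = d' u) {β : Type*}
    (Q : (p : Fin n → Prop) → ({u // p u} → ℕ) → β) :
    Q (fun u => k ≤ d u) (degreesFrom k d) = Q (fun u => k ≤ d' u) (degreesFrom k d') := by
  have key (p p' : Fin n → Prop) (hp : p = p') (h' : ∀ u, p u → d u = d' u) :
      Q p (fun u => d u) = Q p' fun u => d' u := by
    subst hp
    exact congrArg (Q p) (funext fun u => h' u u.2)
  exact key _ _ (funext fun u => propext (h u)) h'

theorem three_le_kernelPart_iff (d : Fin n → ℕ) (u : Fin n) : 3 ≤ kernelPart d u ↔ 3 ≤ d u := by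
  unfold kernelPart
  split_ifs <;> omega

theorem kernelPart_eq (d : Fin n → ℕ) (u : Fin n) (h : 3 ≤ kernelPart d u) :
    kernelPart d u = d u :=
  if_pos ((three_le_kernelPart_iff d u).1 h)

theorem kernelSum_kernelPart (d : Fin n → ℕ) (f : MultiGraph → ℝ≥0∞) (k : ℕ) :
    kernelSum (kernelPart d) f k = kernelSum d f k :=
  degreesFrom_congr (three_le_kernelPart_iff d) (kernelPart_eq d)
    fun _ e => unifExp fun τ : Pairing (HalfEdge e) => (configGraph e τ).levelSum f k

theorem card_halfEdge_kernel (d : Fin n → ℕ) :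
    Nat.card (HalfEdge (degreesFrom 3 d)) = ∑ u, kernelPart d u := by
  rw [Nat.card_sigma]
  simp only [Nat.card_eq_fintype_card, Fintype.card_fin, degreesFrom, kernelPart]
  rw [← Finset.sum_filter, ← Finset.sum_subtype_eq_sum_filter, Finset.subtype_univ]

theorem kernelLinks_eq (d : Fin n → ℕ) : kernelLinks d = (∑ u, kernelPart d u + 1) / 2 := by
  rw [kernelLinks, card_halfEdge_kernel]

theorem degreeTwoCount_eq (d : Fin n → ℕ) :
    degreeTwoCount d = (Finset.univ.filter fun u => d u = 2).card := by
  rw [degreeTwoCount, Nat.card_eq_fintype_card, Fintype.card_subtype]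

/-- The vertices outside of the kernel. -/
def lowVertices (κ : Fin n → ℕ) : Finset (Fin n) := Finset.univ.filter fun u => κ u = 0

/-- The weight of the kernel degrees `κ` when the mean degree is `x`. -/
noncomputable def kernelWeight (κ : Fin n → ℕ) (x : ℝ) : ℝ :=
  Real.exp (-(n * x)) * ∏ u, (x ^ κ u / (κ u).factorial)

/-- The weight of `j` vertices of degree two among `N` vertices of degree at most two when the mean
degree is `x`. -/
noncomputable def lowWeight (N j : ℕ) (x : ℝ) : ℝ :=
  N.choose j * ((x ^ 2 / 2) ^ j * (1 + x) ^ (N - j))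

theorem kernelWeight_nonneg (κ : Fin n → ℕ) {x : ℝ} (hx : 0 ≤ x) : 0 ≤ kernelWeight κ x :=
  mul_nonneg (Real.exp_pos _).le (Finset.prod_nonneg fun _ _ => by positivity)

theorem lowWeight_nonneg (N j : ℕ) {x : ℝ} (hx : 0 ≤ x) : 0 ≤ lowWeight N j x := by
  unfold lowWeight
  positivity

theorem continuous_kernelWeight (κ : Fin n → ℕ) : Continuous (kernelWeight κ) := by
  unfold kernelWeight
  fun_prop

theorem continuous_lowWeight (N j : ℕ) : Continuous (lowWeight N j) := by
  unfold lowWeight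
  fun_prop

theorem sum_lowWeight (N : ℕ) (x : ℝ) :
    ∑ j ∈ Finset.range (N + 1), lowWeight N j x = (1 + x + x ^ 2 / 2) ^ N := by
  rw [add_comm (1 + x), add_pow]
  exact Finset.sum_congr rfl fun j _ => by rw [lowWeight]; ring

theorem poissonMeasure_zero_one (r : NNReal) :
    poissonMeasure r {0, 1} = ENNReal.ofReal (Real.exp (-r) * (1 + r)) := by
  have h : ({0, 1} : Set ℕ) = {0} ∪ {1} := rfl
  rw [h, measure_union (by simp) (measurableSet_singleton _), poissonMeasure_singleton,
    poissonMeasure_singleton, ← ENNReal.ofReal_add (by positivity) (by positivity)]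
  congr 1
  simp
  ring

/-- Once the set of vertices of degree two is fixed, the event is a box: the remaining low vertices
have degree 0 or 1. The sum over all such sets gives the binomial coefficient in `lowWeight`. -/
theorem pi_poissonMeasure_kernel (r : NNReal) {κ : Fin n → ℕ} (hκ : ∀ u, κ u = 0 ∨ 3 ≤ κ u)
    (j : ℕ) :
    (Measure.pi fun _ : Fin n => poissonMeasure r)
        {d | kernelPart d = κ ∧ degreeTwoCount d = j} =
      ENNReal.ofReal (kernelWeight κ r * lowWeight (lowVertices κ).card j r) := by
  classical
  let B (T : Finset (Fin n)) (u : Fin n) : Set ℕ :=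
    if κ u ≠ 0 then {κ u} else if u ∈ T then {2} else {0, 1}
  have hB (T : Finset (Fin n)) (hT : T ⊆ lowVertices κ) (d : Fin n → ℕ) :
      d ∈ Set.univ.pi (B T) ↔ kernelPart d = κ ∧ (Finset.univ.filter fun u => d u = 2) = T := by
    have h (u : Fin n) : d u ∈ B T u ↔ kernelPart d u = κ u ∧ (d u = 2 ↔ u ∈ T) := by
      have h1 := hκ u
      have h2 (hu : u ∈ T) : κ u = 0 := by simpa [lowVertices] using hT hu
      simp only [B, kernelPart]
      split_ifs <;> simp_all <;> omega
    simp only [Set.mem_univ_pi, h, forall_and, funext_iff, Finset.ext_iff, Finset.mem_filter,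
      Finset.mem_univ, true_and]
  have hS : {d : Fin n → ℕ | kernelPart d = κ ∧ degreeTwoCount d = j} =
      ⋃ T ∈ (lowVertices κ).powersetCard j, Set.univ.pi (B T) := by
    ext d
    simp only [Set.mem_ofPred_eq, Set.mem_iUnion, exists_prop, Finset.mem_powersetCard]
    constructor
    · rintro ⟨h1, h2⟩
      have h3 : (Finset.univ.filter fun u => d u = 2) ⊆ lowVertices κ := by
        intro u hu
        have hu : d u = 2 := by simpa using hu
        simp [lowVertices, ← h1, kernelPart, hu]
      exact ⟨_, ⟨h3, by rw [← degreeTwoCount_eq, h2]⟩, (hB _ h3 d).2 ⟨h1, rfl⟩⟩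
    · rintro ⟨T, ⟨hT, hj⟩, hd⟩
      obtain ⟨h1, h2⟩ := (hB T hT d).1 hd
      exact ⟨h1, by rw [degreeTwoCount_eq, h2, hj]⟩
  have hp (T : Finset (Fin n)) (u : Fin n) : poissonMeasure r (B T u) =
      ENNReal.ofReal (Real.exp (-(r : ℝ)) * ((r : ℝ) ^ κ u / (κ u).factorial) *
        (if u ∈ lowVertices κ then (if u ∈ T then (r : ℝ) ^ 2 / 2 else 1 + (r : ℝ)) else 1 : ℝ)) := by
    by_cases h1 : κ u = 0
    · have h2 : u ∈ lowVertices κ := by simp [lowVertices, h1]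
      rw [if_pos h2]
      by_cases h3 : u ∈ T
      · simp only [B, h1, ne_eq, not_true_eq_false, if_false, if_pos h3, poissonMeasure_singleton]
        congr 1
        simp
        ring
      · simp only [B, h1, ne_eq, not_true_eq_false, if_false, if_neg h3, poissonMeasure_zero_one]
        congr 1
        simp
    · have h2 : u ∉ lowVertices κ := by simp [lowVertices, h1]
      simp only [B, if_neg h2, ne_eq, h1, not_false_eq_true, if_true, poissonMeasure_singleton]
      congr 1
      ring
  have hm (T : Finset (Fin n)) (hT : T ∈ (lowVertices κ).powersetCard j) :
      (Measure.pi fun _ : Fin n => poissonMeasure r) (Set.univ.pi (B T)) =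
        ENNReal.ofReal (kernelWeight κ r *
          (((r : ℝ) ^ 2 / 2) ^ j * (1 + r) ^ ((lowVertices κ).card - j))) := by
    obtain ⟨h1, h2⟩ := Finset.mem_powersetCard.1 hT
    rw [Measure.pi_pi]
    simp only [hp]
    rw [← ENNReal.ofReal_prod_of_nonneg fun u _ => by split_ifs <;> positivity]
    congr 1
    rw [Finset.prod_mul_distrib, Finset.prod_mul_distrib, Finset.prod_const, Finset.card_univ,
      Fintype.card_fin, ← Real.exp_nat_mul, Finset.prod_ite_mem, Finset.univ_inter,
      Finset.prod_ite, Finset.prod_const, Finset.prod_const, Finset.filter_mem_eq_inter,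
      Finset.inter_eq_right.2 h1, h2, Finset.filter_not, Finset.filter_mem_eq_inter,
      Finset.inter_eq_right.2 h1, Finset.card_sdiff_of_subset h1, h2, kernelWeight, mul_neg]
  rw [hS, measure_biUnion_finset _ fun T _ => .univ_pi fun u => .of_discrete,
    Finset.sum_congr rfl hm, Finset.sum_const, Finset.card_powersetCard, lowWeight,
    ← ENNReal.ofReal_nsmul]
  · congr 1
    rw [nsmul_eq_mul]
    ring
  · intro T hT T' hT' hne
    refine Set.disjoint_left.2 fun d hd hd' => hne ?_
    rw [← ((hB T (Finset.mem_powersetCard.1 hT).1 d).1 hd).2,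
      ((hB T' (Finset.mem_powersetCard.1 hT').1 d).1 hd').2]

theorem kernelPart_eq_zero_or (d : Fin n → ℕ) (u : Fin n) :
    kernelPart d u = 0 ∨ 3 ≤ kernelPart d u := by
  unfold kernelPart
  split_ifs <;> omega

/-- The law of the kernel degrees and of the number of vertices of degree two. -/
noncomputable def kernelLaw (κ : Fin n → ℕ) (j : ℕ) (x : ℝ) : ℝ≥0∞ :=
  (Measure.pi fun _ : Fin n => poissonMeasure x.toNNReal)
    {d | kernelPart d = κ ∧ degreeTwoCount d = j}

theorem kernelLaw_eq {κ : Fin n → ℕ} (hκ : ∀ u, κ u = 0 ∨ 3 ≤ κ u) (j : ℕ) (x : ℝ) :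
    kernelLaw κ j x =
      ENNReal.ofReal (kernelWeight κ (max x 0) * lowWeight (lowVertices κ).card j (max x 0)) := by
  rw [kernelLaw, pi_poissonMeasure_kernel _ hκ, Real.coe_toNNReal']

theorem kernelLaw_eq_zero {κ : Fin n → ℕ} (hκ : ¬ ∀ u, κ u = 0 ∨ 3 ≤ κ u) (j : ℕ) (x : ℝ) :
    kernelLaw κ j x = 0 := by
  have h : {d : Fin n → ℕ | kernelPart d = κ ∧ degreeTwoCount d = j} = ∅ := by
    ext d
    simp only [Set.mem_ofPred_eq, Set.mem_empty_iff_false, iff_false, not_and]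
    rintro rfl
    exact absurd (kernelPart_eq_zero_or d) hκ
  rw [kernelLaw, h, measure_empty]

theorem measurable_kernelLaw (κ : Fin n → ℕ) (j : ℕ) : Measurable (kernelLaw κ j) := by
  by_cases hκ : ∀ u, κ u = 0 ∨ 3 ≤ κ u
  · simp only [funext (kernelLaw_eq hκ j)]
    have h : Continuous fun x : ℝ =>
        kernelWeight κ (max x 0) * lowWeight (lowVertices κ).card j (max x 0) :=
      ((continuous_kernelWeight κ).mul (continuous_lowWeight _ j)).comp
        (continuous_id.max continuous_const)
    exact h.measurable.ennreal_ofReal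
  · simp only [funext (kernelLaw_eq_zero hκ j)]
    exact measurable_const

theorem lintegral_kernel (x : ℝ) (Ψ : (Fin n → ℕ) → ℕ → ℝ≥0∞) :
    ∫⁻ d, Ψ (kernelPart d) (degreeTwoCount d)
        ∂(Measure.pi fun _ : Fin n => poissonMeasure x.toNNReal) =
      ∑' κ, ∑' j, Ψ κ j * kernelLaw κ j x := by
  let P := Measure.pi fun _ : Fin n => poissonMeasure x.toNNReal
  have h : Measurable fun d : Fin n → ℕ => (kernelPart d, degreeTwoCount d) :=
    measurable_of_countable _
  have h1 := lintegral_map (μ := P) (f := fun y : (Fin n → ℕ) × ℕ => Ψ y.1 y.2)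
    (measurable_of_countable _) h
  refine h1.symm.trans ?_
  rw [lintegral_countable', ENNReal.tsum_prod']
  refine tsum_congr fun κ => tsum_congr fun j => ?_
  rw [Measure.map_apply h (measurableSet_singleton _), kernelLaw]
  congr 2
  ext d
  simp

end KernelPart

/-! ### The dual parameter -/

/-- With this monotonicity the dual parameter is located by testing explicit candidates. -/
theorem mul_exp_neg_lt_of_lt {x y : ℝ} (hxy : x < y) (hy : y ≤ 1) :
    x * Real.exp (-x) < y * Real.exp (-y) := by
  have h1 : Real.exp (-x) = Real.exp (y - x) * Real.exp (-y) := by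
    rw [← Real.exp_add]
    congr 1
    ring
  have h2 : 1 - (y - x) < Real.exp (-(y - x)) := by
    have := Real.add_one_lt_exp (x := -(y - x)) (by linarith)
    linarith
  have h3 : 1 < Real.exp (y - x) := Real.one_lt_exp_iff.2 (by linarith)
  have h4 : Real.exp (-(y - x)) * Real.exp (y - x) = 1 := by
    rw [← Real.exp_add]
    simp
  have h5 : x * Real.exp (y - x) < y := by
    nlinarith
  rw [h1, ← mul_assoc]
  exact mul_lt_mul_of_pos_right h5 (Real.exp_pos _)

/-- The dual parameter `μ` of the branching parameter `1 + ε`. -/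
structure IsDual (ε μ : ℝ) : Prop where
  pos : 0 < ε
  le : ε ≤ 1 / 100
  lt_one : μ < 1
  eq : μ * Real.exp (-μ) = (1 + ε) * Real.exp (-(1 + ε))

namespace IsDual

variable {ε μ : ℝ}

theorem one_sub_le (h : IsDual ε μ) : 1 - μ ≤ ε := by
  have h0 := h.pos
  have h1 := h.le
  by_contra! hlt
  have h2 := mul_exp_neg_lt_of_lt (x := μ) (y := 1 - ε) (by linarith) (by linarith)
  rw [h.eq] at h2
  have h3 : Real.exp (-(1 - ε)) = Real.exp (2 * ε) * Real.exp (-(1 + ε)) := by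
    rw [← Real.exp_add]
    congr 1
    ring
  rw [h3, ← mul_assoc] at h2
  have h4 := lt_of_mul_lt_mul_right h2 (Real.exp_pos _).le
  -- The candidate is sharp to second order, as (1 - ε) exp(2ε) = 1 + ε - (2/3)ε³ + …, so the
  -- exponential is needed up to its cubic term.
  have h5 := Real.exp_bound' (x := 2 * ε) (by linarith) (by linarith) (n := 4) (by norm_num)
  simp only [Finset.sum_range_succ, Finset.sum_range_zero, Nat.factorial] at h5
  norm_num at h5
  nlinarith [pow_pos h0 2, pow_pos h0 3, pow_pos h0 4, pow_pos h0 5]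

theorem le_one_sub (h : IsDual ε μ) : ε / 2 ≤ 1 - μ := by
  have h0 := h.pos
  have h1 := h.le
  by_contra! hlt
  have h2 := mul_exp_neg_lt_of_lt (x := 1 - ε / 2) (y := μ) (by linarith) h.lt_one.le
  rw [h.eq] at h2
  have h3 : Real.exp (-(1 - ε / 2)) = Real.exp (3 / 2 * ε) * Real.exp (-(1 + ε)) := by
    rw [← Real.exp_add]
    congr 1
    ring
  rw [h3, ← mul_assoc] at h2
  have h4 := lt_of_mul_lt_mul_right h2 (Real.exp_pos _).le
  have h5 := Real.quadratic_le_exp_of_nonneg (x := 3 / 2 * ε) (by linarith)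
  nlinarith [pow_pos h0 2, pow_pos h0 3]

theorem pos_right (h : IsDual ε μ) : 0 < μ := by
  linarith [h.one_sub_le, h.le]

theorem exp_neg (h : IsDual ε μ) : Real.exp (-(1 + ε - μ)) * (1 + ε) = μ := by
  have h1 : Real.exp (-(1 + ε - μ)) = Real.exp (-(1 + ε)) / Real.exp (-μ) := by
    rw [← Real.exp_sub]
    congr 1
    ring
  rw [h1, div_mul_eq_mul_div, mul_comm, ← h.eq, mul_div_cancel_right₀ _ (Real.exp_ne_zero _)]

end IsDual

/-! ### Integrating a binomial probability over its parameter -/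

-- The sum is the probability that a binomial variable with N + 1 trials exceeds j. Its derivative
-- in the success probability telescopes to a single binomial probability.
open Polynomial in
theorem derivative_sum_bernsteinPolynomial {N j : ℕ} (h : j ≤ N) :
    derivative (∑ i ∈ Finset.Ico j (N + 1), bernsteinPolynomial ℝ (N + 1) (i + 1)) =
      (N + 1) * bernsteinPolynomial ℝ N j := by
  rw [derivative_sum]
  simp only [bernsteinPolynomial.derivative_succ_aux]
  have h1 := Finset.sum_Ico_sub (bernsteinPolynomial ℝ N) (Nat.le_succ_of_le h)
  rw [bernsteinPolynomial.eq_zero_of_lt ℝ N.lt_succ_self, zero_sub] at h1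
  rw [← Finset.mul_sum, ← neg_eq_iff_eq_neg.2 h1, ← Finset.sum_neg_distrib]
  simp only [neg_sub]

theorem sum_bernsteinPolynomial_eval_mem {N j : ℕ} {q : ℝ} (h0 : 0 ≤ q) (h1 : q ≤ 1) :
    (∑ i ∈ Finset.Ico j (N + 1), bernsteinPolynomial ℝ (N + 1) (i + 1)).eval q ∈ Set.Icc (0 : ℝ) 1 := by
  have h (i : ℕ) : 0 ≤ (bernsteinPolynomial ℝ (N + 1) i).eval q := by
    have : 0 ≤ 1 - q := by linarith
    simp only [bernsteinPolynomial, Polynomial.eval_mul, Polynomial.eval_pow, Polynomial.eval_X,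
      Polynomial.eval_sub, Polynomial.eval_one, Polynomial.eval_natCast]
    positivity
  rw [Polynomial.eval_finsetSum]
  refine ⟨Finset.sum_nonneg fun i _ => h _, ?_⟩
  have h2 := congrArg (Polynomial.eval q) (bernsteinPolynomial.sum ℝ (N + 1))
  rw [Polynomial.eval_finsetSum, Polynomial.eval_one, Finset.sum_range_succ'] at h2
  rw [← h2]
  refine le_add_of_le_of_nonneg (Finset.sum_le_sum_of_subset_of_nonneg ?_ fun i _ _ => h _) (h _)
  intro i hi
  simp at hi ⊢
  omega

/-- The probability that a Poisson variable of mean `x` equals two, given that it is at most two. -/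
noncomputable def twoProb (x : ℝ) : ℝ := x ^ 2 / 2 / (1 + x + x ^ 2 / 2)

theorem one_le_lowTotal {x : ℝ} (hx : 0 ≤ x) : 1 ≤ 1 + x + x ^ 2 / 2 := by
  nlinarith [sq_nonneg x]

theorem lowWeight_eq {N j : ℕ} {x : ℝ} (hx : 0 ≤ x) :
    lowWeight N j x = (1 + x + x ^ 2 / 2) ^ N * (bernsteinPolynomial ℝ N j).eval (twoProb x) := by
  rcases lt_or_ge N j with h | h
  · simp [lowWeight, bernsteinPolynomial, Nat.choose_eq_zero_of_lt h]
  · have h0 := one_le_lowTotal hx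
    have h1 : 1 - twoProb x = (1 + x) / (1 + x + x ^ 2 / 2) := by
      rw [twoProb, eq_div_iff (by linarith), sub_mul, div_mul_cancel₀ _ (by linarith)]
      ring
    have h2 : (1 + x + x ^ 2 / 2) ^ N =
        (1 + x + x ^ 2 / 2) ^ j * (1 + x + x ^ 2 / 2) ^ (N - j) := by
      rw [← pow_add, Nat.add_sub_cancel' h]
    simp only [bernsteinPolynomial, Polynomial.eval_mul, Polynomial.eval_pow, Polynomial.eval_X,
      Polynomial.eval_sub, Polynomial.eval_one, Polynomial.eval_natCast]
    rw [h1, h2, twoProb, div_pow (x ^ 2 / 2), div_pow (1 + x), lowWeight]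
    have h3 : (1 + x + x ^ 2 / 2) ≠ 0 := by linarith
    generalize 1 + x + x ^ 2 / 2 = g at *
    field_simp

theorem hasDerivAt_twoProb {x : ℝ} (hx : 0 ≤ x) :
    HasDerivAt twoProb ((x + x ^ 2 / 2) / (1 + x + x ^ 2 / 2) ^ 2) x := by
  have h0 := one_le_lowTotal hx
  have h1 : HasDerivAt (fun x : ℝ => x ^ 2 / 2) x x := by
    have := (hasDerivAt_pow 2 x).div_const 2
    simpa using this
  have h2 : HasDerivAt (fun x : ℝ => 1 + x + x ^ 2 / 2) (1 + x) x := by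
    exact ((hasDerivAt_id x).const_add 1).add h1
  have h3 := h1.div h2 (by linarith)
  convert! h3 using 1
  congr 1
  ring

theorem twoProb_mem {x : ℝ} (hx : 0 ≤ x) : twoProb x ∈ Set.Icc (0 : ℝ) 1 := by
  have h0 := one_le_lowTotal hx
  exact ⟨by unfold twoProb; positivity, div_le_one_of_le₀ (by linarith) (by linarith)⟩

theorem continuousOn_twoProb {s : Set ℝ} (hs : ∀ x ∈ s, 0 ≤ x) : ContinuousOn twoProb s :=
  fun x hx => (hasDerivAt_twoProb (hs x hx)).continuousAt.continuousWithinAt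

theorem bernsteinPolynomial_eval_nonneg (N j : ℕ) {q : ℝ} (h0 : 0 ≤ q) (h1 : q ≤ 1) :
    0 ≤ (bernsteinPolynomial ℝ N j).eval q := by
  have : 0 ≤ 1 - q := by linarith
  simp only [bernsteinPolynomial, Polynomial.eval_mul, Polynomial.eval_pow, Polynomial.eval_X,
    Polynomial.eval_sub, Polynomial.eval_one, Polynomial.eval_natCast]
  positivity

/-- Change of variables to the success probability: the derivative of `twoProb` is at least a/4 on
the interval, and the primitive is a binomial tail, which increases by at most 1. -/
theorem lintegral_twoProb_le {a b : ℝ} (ha : 0 < a) (hab : a ≤ b) (hb : b ≤ 1 / 2) (N j : ℕ) :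
    ∫⁻ x in Set.Icc a b, ENNReal.ofReal ((bernsteinPolynomial ℝ N j).eval (twoProb x)) ≤
      ENNReal.ofReal (4 / (a * (N + 1))) := by
  rcases lt_or_ge N j with h | h
  · simp [bernsteinPolynomial, Nat.choose_eq_zero_of_lt h]
  set S := ∑ i ∈ Finset.Ico j (N + 1), bernsteinPolynomial ℝ (N + 1) (i + 1) with hS
  have hd (x : ℝ) (hx : x ∈ Set.uIcc a b) : HasDerivAt (fun x => S.eval (twoProb x))
      (((N + 1) * (bernsteinPolynomial ℝ N j).eval (twoProb x)) *
        ((x + x ^ 2 / 2) / (1 + x + x ^ 2 / 2) ^ 2)) x := by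
    rw [Set.uIcc_of_le hab] at hx
    have h1 := (S.hasDerivAt (twoProb x)).comp x (hasDerivAt_twoProb (ha.le.trans hx.1))
    rw [hS, derivative_sum_bernsteinPolynomial h] at h1
    refine HasDerivAt.congr_deriv (f := fun x => S.eval (twoProb x)) h1 ?_
    simp
  have hq : ContinuousOn twoProb (Set.uIcc a b) := continuousOn_twoProb fun x hx => by
    rw [Set.uIcc_of_le hab] at hx
    exact ha.le.trans hx.1
  have hc : ContinuousOn (fun x => (bernsteinPolynomial ℝ N j).eval (twoProb x)) (Set.uIcc a b) :=
    (Polynomial.continuous _).comp_continuousOn hq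
  have hc' : ContinuousOn (fun x => ((N + 1) * (bernsteinPolynomial ℝ N j).eval (twoProb x)) *
        ((x + x ^ 2 / 2) / (1 + x + x ^ 2 / 2) ^ 2)) (Set.uIcc a b) := by
    refine (continuousOn_const.mul hc).mul (ContinuousOn.div (by fun_prop) (by fun_prop) ?_)
    intro x hx
    rw [Set.uIcc_of_le hab] at hx
    have := one_le_lowTotal (ha.le.trans hx.1)
    positivity
  have h2 := intervalIntegral.integral_eq_sub_of_hasDerivAt hd hc'.intervalIntegrable
  have h3 : ∫ x in a..b, a * (N + 1) / 4 * (bernsteinPolynomial ℝ N j).eval (twoProb x) ≤ 1 := by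
    refine (intervalIntegral.integral_mono_on hab (continuousOn_const.mul hc).intervalIntegrable
      hc'.intervalIntegrable fun x hx => ?_).trans (h2.trans_le ?_)
    · have hx0 : 0 ≤ x := ha.le.trans hx.1
      have h4 := one_le_lowTotal hx0
      have h5 : a / 4 ≤ (x + x ^ 2 / 2) / (1 + x + x ^ 2 / 2) ^ 2 := by
        rw [le_div_iff₀ (by positivity)]
        have : (1 + x + x ^ 2 / 2) ≤ 2 := by nlinarith [hx.2]
        have : (1 + x + x ^ 2 / 2) ^ 2 ≤ 4 := by nlinarith
        nlinarith [hx.1, sq_nonneg x]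
      have h6 := bernsteinPolynomial_eval_nonneg N j (twoProb_mem hx0).1 (twoProb_mem hx0).2
      calc a * (N + 1) / 4 * (bernsteinPolynomial ℝ N j).eval (twoProb x)
            = ((N + 1) * (bernsteinPolynomial ℝ N j).eval (twoProb x)) * (a / 4) := by ring
        _ ≤ _ := mul_le_mul_of_nonneg_left h5 (by positivity)
    · have h4 := sum_bernsteinPolynomial_eval_mem (N := N) (j := j) (twoProb_mem (ha.le.trans hab)).1
        (twoProb_mem (ha.le.trans hab)).2
      have h5 := sum_bernsteinPolynomial_eval_mem (N := N) (j := j) (twoProb_mem ha.le).1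
        (twoProb_mem ha.le).2
      linarith [h4.2, h5.1]
  rw [intervalIntegral.integral_const_mul] at h3
  rw [← ofReal_integral_eq_lintegral_ofReal, integral_Icc_eq_integral_Ioc,
    ← intervalIntegral.integral_of_le hab]
  · refine ENNReal.ofReal_le_ofReal ?_
    rw [le_div_iff₀ (by positivity)]
    linarith
  · rw [Set.uIcc_of_le hab] at hc
    exact hc.integrableOn_Icc
  · filter_upwards [ae_restrict_mem measurableSet_Icc] with x hx
    have hx0 : 0 ≤ x := ha.le.trans hx.1
    exact bernsteinPolynomial_eval_nonneg N j (twoProb_mem hx0).1 (twoProb_mem hx0).2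

/-! ### Bounding a density by its integral -/

/-- Adding the values at x + t and x - t removes the first-order change of F. So a large value at x
forces a large integral, although the maximum of F is not located. -/
theorem ofReal_mul_le_lintegral {F : ℝ → ℝ} (hF : Measurable F) (hF0 : ∀ x, 0 ≤ F x) {x τ c : ℝ}
    (hτ : 0 ≤ τ) (h : ∀ t ∈ Set.Icc 0 τ, c * F x ≤ F (x + t) + F (x - t)) :
    ENNReal.ofReal (τ * (c * F x)) ≤ 2 * ∫⁻ y, ENNReal.ofReal (F y) := by
  calc ENNReal.ofReal (τ * (c * F x))
      = ∫⁻ _ in Set.Icc 0 τ, ENNReal.ofReal (c * F x) := by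
        rw [setLIntegral_const, Real.volume_Icc, sub_zero, ENNReal.ofReal_mul hτ, mul_comm]
    _ ≤ ∫⁻ t in Set.Icc 0 τ, (ENNReal.ofReal (F (x + t)) + ENNReal.ofReal (F (x - t))) := by
        refine setLIntegral_mono (by fun_prop) fun t ht => ?_
        rw [← ENNReal.ofReal_add (hF0 _) (hF0 _)]
        exact ENNReal.ofReal_le_ofReal (h t ht)
    _ ≤ ∫⁻ t, (ENNReal.ofReal (F (x + t)) + ENNReal.ofReal (F (x - t))) :=
        setLIntegral_le_lintegral _ _
    _ = 2 * ∫⁻ y, ENNReal.ofReal (F y) := by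
        rw [lintegral_add_left (by fun_prop), two_mul,
          lintegral_add_left_eq_self (fun y => ENNReal.ofReal (F y)) x,
          lintegral_sub_left_eq_self (fun y => ENNReal.ofReal (F y)) x]

/-! ### A lower bound for negative binomial probabilities -/

/-- The Stirling sequence decreases, and its first term is e/√2. -/
theorem factorial_le_stirling {m : ℕ} (hm : m ≠ 0) :
    (m.factorial : ℝ) ≤ Real.exp 1 * √m * (m / Real.exp 1) ^ m := by
  obtain ⟨m, rfl⟩ := Nat.exists_eq_succ_of_ne_zero hm
  have h := Stirling.stirlingSeq'_antitone (Nat.zero_le m)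
  simp only [Function.comp, Nat.succ_eq_add_one, zero_add, Stirling.stirlingSeq_one] at h
  have h2 : (0 : ℝ) < √2 := by positivity
  rw [Stirling.stirlingSeq, div_le_div_iff₀ (by positivity) h2, Real.sqrt_mul (by norm_num)] at h
  have h3 : Real.exp 1 * (√2 * √((m + 1 : ℕ) : ℝ) * (((m + 1 : ℕ) : ℝ) / Real.exp 1) ^ (m + 1)) =
      Real.exp 1 * √((m + 1 : ℕ) : ℝ) * (((m + 1 : ℕ) : ℝ) / Real.exp 1) ^ (m + 1) * √2 := by ring
  rw [h3] at h
  exact le_of_mul_le_mul_right h h2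

theorem add_mul_multichoose {m : ℕ} (hm : m ≠ 0) (k : ℕ) :
    (m + k) * m.multichoose k = m * (m + k).choose k := by
  obtain ⟨m, rfl⟩ := Nat.exists_eq_succ_of_ne_zero hm
  have h := Nat.add_one_mul_choose_eq (m + k) m
  have h1 : (m + k).choose k = (m + k).choose m := (Nat.choose_symm_add).symm
  have h2 : (m + k + 1).choose k = (m + k + 1).choose (m + 1) :=
    Nat.choose_symm_of_eq_add (by omega)
  have h3 : m.succ + k - 1 = m + k := by omega
  have h4 : m.succ + k = m + k + 1 := by omega
  rw [Nat.multichoose_eq, h3, h4, h1, h2, h, mul_comm]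

theorem div_pow_le_exp {x : ℝ} (hx : 0 ≤ x) (m : ℕ) : x ^ m ≤ Real.exp (m * (x - 1)) := by
  rw [Real.exp_nat_mul]
  refine pow_le_pow_left₀ hx ?_ m
  have := Real.add_one_le_exp (x - 1)
  linarith

/-- Stirling's formula gives the factor in front. The exponent bounds the relative entropy of the
proportions m : k with respect to 1 - μ : μ by the corresponding χ² distance. -/
theorem le_multichoose_mul {m k : ℕ} (hm : m ≠ 0) (hk : k ≠ 0) {μ : ℝ} (h0 : 0 < μ) (h1 : μ < 1) :
    √m / (4 * (m + k)) * Real.exp (-((k * (1 - μ) - m * μ) ^ 2 / ((m + k) * μ * (1 - μ)))) ≤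
      m.multichoose k * ((1 - μ) ^ m * μ ^ k) := by
  have ha : (0 : ℝ) < m := by positivity
  have hb : (0 : ℝ) < k := by positivity
  have hμ : 0 < 1 - μ := by linarith
  have hN := Stirling.le_factorial_stirling (m + k)
  have hm' := factorial_le_stirling hm
  have hk' := factorial_le_stirling hk
  have hC : ((m + k).choose k : ℝ) * (m.factorial * k.factorial) = (m + k).factorial := by
    have := Nat.add_choose_mul_factorial_mul_factorial m k
    rw [← mul_assoc]
    exact_mod_cast this
  have hM : ((m + k : ℕ) : ℝ) * m.multichoose k = m * (m + k).choose k := by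
    exact_mod_cast add_mul_multichoose hm k
  push_cast at hN hM
  set a : ℝ := (m : ℝ) with ha'
  set b : ℝ := (k : ℝ) with hb'
  set C : ℝ := ((m + k).choose k : ℝ) with hC'
  have hC0 : 0 ≤ C := by positivity
  set X := (b * (1 - μ) - a * μ) ^ 2 / ((a + b) * μ * (1 - μ)) with hX
  have hE : a ^ m * b ^ k ≤ Real.exp X * ((a + b) ^ (m + k) * ((1 - μ) ^ m * μ ^ k)) := by
    -- By log y ≤ y - 1 for both proportions; the two linear terms add up exactly to X.
    have e1 := div_pow_le_exp (x := a / ((a + b) * (1 - μ))) (by positivity) m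
    have e2 := div_pow_le_exp (x := b / ((a + b) * μ)) (by positivity) k
    have e3 : X = m * (a / ((a + b) * (1 - μ)) - 1) + k * (b / ((a + b) * μ) - 1) := by
      rw [hX, ← ha', ← hb']
      field_simp
      ring
    have e4 := mul_le_mul e1 e2 (by positivity) (Real.exp_pos _).le
    rw [← Real.exp_add, ← e3, div_pow, div_pow, div_mul_div_comm, div_le_iff₀ (by positivity)] at e4
    refine e4.trans_eq ?_
    rw [mul_pow, mul_pow, pow_add]
    ring
  have hS : √(2 * Real.pi * (a + b)) * (a + b) ^ (m + k) ≤
      C * (Real.exp 1 ^ 2 * (√a * √b) * (a ^ m * b ^ k)) := by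
    have e0 : (0 : ℝ) < Real.exp 1 ^ (m + k) := by positivity
    have e1 : √(2 * Real.pi * (a + b)) * ((a + b) / Real.exp 1) ^ (m + k) ≤
        C * ((Real.exp 1 * √a * (a / Real.exp 1) ^ m) * (Real.exp 1 * √b * (b / Real.exp 1) ^ k)) :=
      hN.trans (hC.symm.trans_le (mul_le_mul_of_nonneg_left
        (mul_le_mul hm' hk' (by positivity) (by positivity)) hC0))
    have e2 := mul_le_mul_of_nonneg_right e1 e0.le
    refine le_trans (le_of_eq ?_) (e2.trans_eq ?_)
    · rw [div_pow]
      field_simp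
    · rw [div_pow, div_pow, pow_add]
      field_simp
  have hT : √(2 * Real.pi * (a + b)) ≤
      C * (Real.exp 1 ^ 2 * (√a * √b) * (Real.exp X * ((1 - μ) ^ m * μ ^ k))) := by
    refine le_of_mul_le_mul_right (hS.trans ?_) (by positivity : 0 < (a + b) ^ (m + k))
    rw [mul_assoc C]
    refine mul_le_mul_of_nonneg_left ?_ hC0
    rw [mul_assoc (_ * _)]
    refine mul_le_mul_of_nonneg_left (hE.trans_eq (by ring)) (by positivity)
  have hpi : 2 * √b ≤ √(2 * Real.pi * (a + b)) := by
    refine Real.le_sqrt_of_sq_le ?_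
    rw [mul_pow, Real.sq_sqrt hb.le]
    nlinarith [Real.pi_gt_three]
  have he : Real.exp 1 ^ 2 ≤ 8 := by
    have := Real.exp_one_lt_d9
    nlinarith [Real.exp_pos 1]
  have hsb : 0 < √b := Real.sqrt_pos.2 hb
  have hP : 1 ≤ C * (4 * √a * (Real.exp X * ((1 - μ) ^ m * μ ^ k))) := by
    refine le_of_mul_le_mul_right (a := 2 * √b) ?_ (by positivity)
    rw [one_mul]
    refine (hpi.trans hT).trans ?_
    rw [mul_assoc C]
    refine mul_le_mul_of_nonneg_left ?_ hC0
    have : (0 : ℝ) ≤ (√a * √b) * (Real.exp X * ((1 - μ) ^ m * μ ^ k)) := by positivity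
    nlinarith
  have hsa : √a * √a = a := Real.mul_self_sqrt ha.le
  rw [Real.exp_neg, div_mul_eq_mul_div, div_le_iff₀ (by positivity), mul_inv_le_iff₀ (Real.exp_pos _)]
  calc √a ≤ √a * (C * (4 * √a * (Real.exp X * ((1 - μ) ^ m * μ ^ k)))) :=
        le_mul_of_one_le_right (by positivity) hP
    _ = (√a * √a) * C * (4 * (Real.exp X * ((1 - μ) ^ m * μ ^ k))) := by ring
    _ = _ := by
        rw [hsa, ← hM]
        ring

/-! ### Comparing the weight at two symmetric points -/

theorem exp_neg_two_mul_le {s : ℝ} (h0 : 0 ≤ s) (h1 : s ≤ 1 / 2) : Real.exp (-(2 * s)) ≤ 1 - s := by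
  have h2 := Real.quadratic_le_exp_of_nonneg (x := 2 * s) (by linarith)
  rw [Real.exp_neg, inv_le_comm₀ (Real.exp_pos _) (by linarith)]
  refine le_trans ?_ h2
  rw [inv_le_iff_one_le_mul₀ (by linarith)]
  nlinarith [pow_nonneg h0 2, pow_nonneg h0 3]

theorem gaussianPDFReal_mul (μ : ℝ) (v : NNReal) (x t : ℝ) :
    gaussianPDFReal μ v (x + t) * gaussianPDFReal μ v (x - t) =
      Real.exp (-(t ^ 2 / v)) * gaussianPDFReal μ v x ^ 2 := by
  simp only [gaussianPDFReal]
  have h : Real.exp (-(x + t - μ) ^ 2 / (2 * v)) * Real.exp (-(x - t - μ) ^ 2 / (2 * v)) =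
      Real.exp (-(t ^ 2 / v)) * (Real.exp (-(x - μ) ^ 2 / (2 * v))) ^ 2 := by
    rw [← Real.exp_add, sq (Real.exp _), ← Real.exp_add, ← Real.exp_add]
    congr 1
    ring
  linear_combination (√(2 * Real.pi * v))⁻¹ ^ 2 * h

/-- The exponential factors cancel and (x + t)(x - t) = x²(1 - t²/x²), so only a loss of second
order per half-edge remains. -/
theorem kernelWeight_mul_ge {n : ℕ} (κ : Fin n → ℕ) {x t : ℝ} (hx : 0 < x) (ht : t ^ 2 / x ^ 2 ≤ 1 / 2) :
    Real.exp (-(2 * (t ^ 2 / x ^ 2) * ∑ u, (κ u : ℝ))) * kernelWeight κ x ^ 2 ≤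
      kernelWeight κ (x + t) * kernelWeight κ (x - t) := by
  have h1 : Real.exp (-(2 * (t ^ 2 / x ^ 2) * ∑ u, (κ u : ℝ))) =
      ∏ u, Real.exp (-(2 * (t ^ 2 / x ^ 2))) ^ κ u := by
    rw [Finset.prod_pow_eq_pow_sum, ← Real.exp_nat_mul]
    congr 1
    push_cast
    ring
  have h2 : Real.exp (-(n * (x + t))) * Real.exp (-(n * (x - t))) = Real.exp (-(n * x)) ^ 2 := by
    rw [← Real.exp_add, sq, ← Real.exp_add]
    congr 1
    ring
  have h3 : kernelWeight κ (x + t) * kernelWeight κ (x - t) =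
      Real.exp (-(n * x)) ^ 2 * ∏ u, (((x + t) * (x - t)) ^ κ u / ((κ u).factorial : ℝ) ^ 2) := by
    rw [← h2, kernelWeight, kernelWeight, mul_mul_mul_comm, ← Finset.prod_mul_distrib]
    congr 1
    exact Finset.prod_congr rfl fun u _ => by rw [mul_pow, div_mul_div_comm, sq]
  have h4 : kernelWeight κ x ^ 2 = Real.exp (-(n * x)) ^ 2 *
      ∏ u, ((x * x) ^ κ u / ((κ u).factorial : ℝ) ^ 2) := by
    rw [kernelWeight, mul_pow, ← Finset.prod_pow]
    congr 1
    exact Finset.prod_congr rfl fun u _ => by rw [mul_pow, div_pow, sq (x ^ κ u)]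
  rw [h1, h3, h4, mul_left_comm, ← Finset.prod_mul_distrib]
  refine mul_le_mul_of_nonneg_left (Finset.prod_le_prod (fun u _ => by positivity) fun u _ => ?_)
    (by positivity)
  rw [← mul_div_assoc, ← mul_pow]
  refine div_le_div_of_nonneg_right (pow_le_pow_left₀ (by positivity) ?_ _) (by positivity)
  have h5 := exp_neg_two_mul_le (s := t ^ 2 / x ^ 2) (by positivity) ht
  calc _ ≤ (1 - t ^ 2 / x ^ 2) * (x * x) := mul_le_mul_of_nonneg_right h5 (by positivity)
    _ = _ := by
      field_simp
      ring

/-- With g(x) = 1 + x + x²/2 one has g(x + t) g(x - t) = g(x)² - t²(x + x²/2) + t⁴/4. The factor x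
in the loss is essential: with N ≤ n factors, t² ≤ 1/(εn) and x of order ε the total loss stays
bounded. -/
theorem lowTotal_mul_ge (N : ℕ) {x t : ℝ} (hx : 0 ≤ x) (hx1 : x ≤ 1) (ht : 2 * t ^ 2 * x ≤ 1 / 2) :
    Real.exp (-(4 * t ^ 2 * x * N)) * ((1 + x + x ^ 2 / 2) ^ N) ^ 2 ≤
      (1 + (x + t) + (x + t) ^ 2 / 2) ^ N * (1 + (x - t) + (x - t) ^ 2 / 2) ^ N := by
  have h1 : Real.exp (-(4 * t ^ 2 * x * N)) = Real.exp (-(2 * (2 * t ^ 2 * x))) ^ N := by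
    rw [← Real.exp_nat_mul]
    congr 1
    ring
  rw [h1, ← pow_mul, mul_comm N 2, pow_mul, ← mul_pow, ← mul_pow]
  refine pow_le_pow_left₀ (by positivity) ?_ N
  have h2 := exp_neg_two_mul_le (s := 2 * t ^ 2 * x) (by positivity) ht
  have h3 := one_le_lowTotal hx
  refine (mul_le_mul_of_nonneg_right h2 (by positivity)).trans ?_
  have h4 : 1 ≤ (1 + x + x ^ 2 / 2) ^ 2 := by nlinarith
  have h5 : 0 ≤ t ^ 2 * x := by positivity
  have h6 : t ^ 2 * x * (1 + x / 2) ≤ t ^ 2 * x * 2 := mul_le_mul_of_nonneg_left (by linarith) h5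
  nlinarith [mul_le_mul_of_nonneg_left h4 h5, pow_nonneg (sq_nonneg t) 2]

/-! ### Comparing the two models for given kernel degrees -/

/-- The parameters are such that `ε ^ 3 * n` is large compared to `K`. -/
structure Regime (n : ℕ) (ε μ K : ℝ) : Prop extends IsDual ε μ where
  one_le : 1 ≤ K
  large : (1000 * K) ^ 2 ≤ ε ^ 3 * n

/-- The law of the mean degree. -/
noncomputable def meanLaw (n : ℕ) (ε μ : ℝ) : Measure ℝ :=
  gaussianReal (1 + ε - μ) (1 / (ε * n)).toNNReal

/-- The typical values of the mean degree. -/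
def typicalMeans (n : ℕ) (ε μ K : ℝ) : Set ℝ :=
  Set.Icc (1 + ε - μ - K / √(ε * n)) (1 + ε - μ + K / √(ε * n))

/-- The typical kernel degrees. -/
def TypicalKernel {n : ℕ} (ε : ℝ) (κ : Fin n → ℕ) : Prop :=
  ε ^ 3 * n / 8 ≤ ∑ u, (κ u : ℝ) ∧ ∑ u, (κ u : ℝ) ≤ 21 * (ε ^ 3 * n)

/-- The typical numbers of vertices of degree two for given kernel degrees. -/
def TypicalCount {n : ℕ} (ε μ K : ℝ) (κ : Fin n → ℕ) (k : ℕ) : Prop :=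
  |k - μ / (2 * (1 - μ)) * ∑ u, (κ u : ℝ)| ≤ K * √(ε * n)

/-- The joint density of the mean degree and the kernel degrees. -/
noncomputable def jointWeight (n : ℕ) (ε μ : ℝ) (κ : Fin n → ℕ) (x : ℝ) : ℝ :=
  (Set.Ioi 0).indicator (fun x => gaussianPDFReal (1 + ε - μ) (1 / (ε * n)).toNNReal x *
    (kernelWeight κ x * (1 + x + x ^ 2 / 2) ^ (lowVertices κ).card)) x

theorem jointWeight_of_pos {n : ℕ} {ε μ : ℝ} (κ : Fin n → ℕ) {x : ℝ} (hx : 0 < x) :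
    jointWeight n ε μ κ x = gaussianPDFReal (1 + ε - μ) (1 / (ε * n)).toNNReal x *
      (kernelWeight κ x * (1 + x + x ^ 2 / 2) ^ (lowVertices κ).card) :=
  Set.indicator_of_mem (Set.mem_Ioi.2 hx) _

theorem jointWeight_nonneg {n : ℕ} {ε μ : ℝ} (κ : Fin n → ℕ) (x : ℝ) : 0 ≤ jointWeight n ε μ κ x :=
  Set.indicator_nonneg (fun x hx => mul_nonneg (gaussianPDFReal_nonneg _ _ _)
    (mul_nonneg (kernelWeight_nonneg κ (le_of_lt hx))
      (pow_nonneg (by linarith [one_le_lowTotal (le_of_lt hx)]) _))) x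

theorem measurable_jointWeight {n : ℕ} {ε μ : ℝ} (κ : Fin n → ℕ) :
    Measurable (jointWeight n ε μ κ) := by
  refine Measurable.indicator ?_ measurableSet_Ioi
  exact (measurable_gaussianPDFReal _ _).mul
    ((continuous_kernelWeight κ).measurable.mul (by fun_prop))

namespace Regime

variable {n : ℕ} {ε μ K : ℝ}

theorem n_pos (h : Regime n ε μ K) : (0 : ℝ) < n := by
  have h0 := h.pos
  have h1 := h.large
  have h2 := h.one_le
  by_contra! hn
  have : (n : ℝ) = 0 := le_antisymm hn (Nat.cast_nonneg n)
  rw [this] at h1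
  nlinarith

theorem sqrt_pos (h : Regime n ε μ K) : 0 < √(ε * n) :=
  Real.sqrt_pos.2 (mul_pos h.pos h.n_pos)

theorem sqrt_mul_self (h : Regime n ε μ K) : √(ε * n) * √(ε * n) = ε * n :=
  Real.mul_self_sqrt (mul_pos h.pos h.n_pos).le

theorem le_mul_sqrt (h : Regime n ε μ K) : 1000 * K ≤ ε * √(ε * n) := by
  have h1 := h.large
  have h2 : (ε * √(ε * n)) ^ 2 = ε ^ 3 * n := by
    rw [mul_pow, sq √_, h.sqrt_mul_self]
    ring
  rw [← h2] at h1
  exact (abs_le_of_sq_le_sq' h1 (mul_pos h.pos h.sqrt_pos).le).2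

theorem div_sqrt_le (h : Regime n ε μ K) : K / √(ε * n) ≤ ε / 1000 := by
  rw [div_le_div_iff₀ h.sqrt_pos (by norm_num)]
  linarith [h.le_mul_sqrt]

theorem typicalMeans_subset (h : Regime n ε μ K) :
    typicalMeans n ε μ K ⊆ Set.Icc ε (3 * ε) := by
  have h1 := h.div_sqrt_le
  have h2 := h.one_sub_le
  have h3 := h.le_one_sub
  have h4 := h.pos
  exact Set.Icc_subset_Icc (by linarith) (by linarith)

theorem variance_ne_zero (h : Regime n ε μ K) : (1 / (ε * n)).toNNReal ≠ 0 := by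
  have := mul_pos h.pos h.n_pos
  have h1 : 0 < 1 / (ε * n) := by positivity
  exact (Real.toNNReal_pos.2 h1).ne'

theorem card_lowVertices_le (κ : Fin n → ℕ) : ((lowVertices κ).card : ℝ) ≤ n := by
  have := Finset.card_le_univ (lowVertices κ)
  rw [Fintype.card_fin] at this
  exact_mod_cast this

/-- In a window of width 1/√(εn) the product of the values at x ± t is at least e⁻⁵⁶ times the
square of the value at x; the arithmetic-geometric mean inequality turns this into a bound for their
sum. -/
theorem jointWeight_le_add (h : Regime n ε μ K) {κ : Fin n → ℕ} (hκ : TypicalKernel ε κ) {x : ℝ}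
    (hx : x ∈ Set.Icc ε (3 * ε)) {t : ℝ} (ht : t ∈ Set.Icc 0 (1 / √(ε * n))) :
    2 * Real.exp (-28) * jointWeight n ε μ κ x ≤
      jointWeight n ε μ κ (x + t) + jointWeight n ε μ κ (x - t) := by
  have hε := h.pos
  have hε1 := h.le
  have hs := h.sqrt_pos
  have hss := h.sqrt_mul_self
  have hsK := h.le_mul_sqrt
  have hK := h.one_le
  have hn := h.n_pos
  have hx0 : 0 < x := hε.trans_le hx.1
  have hts : t * √(ε * n) ≤ 1 := (le_div_iff₀ hs).1 ht.2
  have ht2 : t ^ 2 * (ε * n) ≤ 1 := by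
    rw [← hss]
    nlinarith [mul_nonneg ht.1 hs.le]
  have htε : t ≤ ε / 1000 := by
    refine ht.2.trans (le_trans ?_ h.div_sqrt_le)
    exact div_le_div_of_nonneg_right hK hs.le
  have h1 : t ^ 2 / x ^ 2 ≤ 1 / 2 := by
    rw [div_le_iff₀ (by positivity)]
    nlinarith [ht.1, hx.1]
  have h2 : 2 * t ^ 2 * x ≤ 1 / 2 := by
    have : t ^ 2 ≤ 1 / 100 := by nlinarith [ht.1]
    nlinarith [hx.2]
  have e1 := gaussianPDFReal_mul (1 + ε - μ) (1 / (ε * n)).toNNReal x t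
  have e2 := kernelWeight_mul_ge κ hx0 h1
  have e3 := lowTotal_mul_ge (lowVertices κ).card hx0.le (by linarith [hx.2]) h2
  have hv : (((1 / (ε * n)).toNNReal : NNReal) : ℝ) = 1 / (ε * n) :=
    Real.coe_toNNReal _ (by positivity)
  have f1 : Real.exp (-1) ≤ Real.exp (-(t ^ 2 / ((1 / (ε * n)).toNNReal : NNReal))) := by
    refine Real.exp_le_exp.2 (neg_le_neg ?_)
    rw [hv, div_div_eq_mul_div, div_one]
    exact ht2
  -- The kernel has at most 21 ε³n half-edges and x ≥ ε, so the exponent is at most 42 t²εn ≤ 42.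
  have f2 : Real.exp (-42) ≤ Real.exp (-(2 * (t ^ 2 / x ^ 2) * ∑ u, (κ u : ℝ))) := by
    refine Real.exp_le_exp.2 (neg_le_neg ?_)
    have : t ^ 2 / x ^ 2 ≤ t ^ 2 / ε ^ 2 :=
      div_le_div_of_nonneg_left (by positivity) (by positivity) (pow_le_pow_left₀ hε.le hx.1 2)
    calc 2 * (t ^ 2 / x ^ 2) * ∑ u, (κ u : ℝ) ≤ 2 * (t ^ 2 / ε ^ 2) * (21 * (ε ^ 3 * n)) :=
          mul_le_mul (by linarith) hκ.2 (Finset.sum_nonneg fun _ _ => by positivity) (by positivity)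
      _ = 42 * (t ^ 2 * (ε * n)) := by
          field_simp
          ring
      _ ≤ 42 := by linarith
  have f3 : Real.exp (-13) ≤ Real.exp (-(4 * t ^ 2 * x * (lowVertices κ).card)) := by
    refine Real.exp_le_exp.2 (neg_le_neg ?_)
    have hN := card_lowVertices_le κ
    calc 4 * t ^ 2 * x * (lowVertices κ).card ≤ 4 * t ^ 2 * (3 * ε) * n :=
          mul_le_mul (mul_le_mul_of_nonneg_left hx.2 (by positivity)) hN (by positivity)
            (by positivity)
      _ = 12 * (t ^ 2 * (ε * n)) := by ring
      _ ≤ 13 := by linarith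
  have hxt : 0 < x - t := by linarith [hx.1]
  have hxt' : 0 < x + t := by linarith [ht.1]
  have n1 := gaussianPDFReal_nonneg (1 + ε - μ) (1 / (ε * n)).toNNReal x
  have n2 := kernelWeight_nonneg κ hx0.le
  have n2a := kernelWeight_nonneg κ hxt.le
  have n2b := kernelWeight_nonneg κ hxt'.le
  have n3 := one_le_lowTotal hx0.le
  have key : (Real.exp (-28)) ^ 2 * jointWeight n ε μ κ x ^ 2 ≤
      jointWeight n ε μ κ (x + t) * jointWeight n ε μ κ (x - t) := by
    rw [jointWeight_of_pos κ hx0, jointWeight_of_pos κ hxt, jointWeight_of_pos κ hxt']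
    -- The three losses 1, 42 and 13 add up to 56. The last one is really 12, rounded up to make the
    -- total even.
    have hE : Real.exp (-28) ^ 2 = Real.exp (-1) * (Real.exp (-42) * Real.exp (-13)) := by
      rw [sq, ← Real.exp_add, ← Real.exp_add, ← Real.exp_add]
      norm_num
    rw [hE, mul_mul_mul_comm (gaussianPDFReal _ _ (x + t)), e1, mul_pow, mul_pow,
      mul_mul_mul_comm (Real.exp (-1)), mul_mul_mul_comm (kernelWeight κ (x + t))]
    refine mul_le_mul (mul_le_mul_of_nonneg_right f1 (by positivity)) ?_ (by positivity)
      (by positivity)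
    rw [mul_mul_mul_comm (Real.exp (-42))]
    refine mul_le_mul ((mul_le_mul_of_nonneg_right f2 (by positivity)).trans e2)
      ((mul_le_mul_of_nonneg_right f3 (by positivity)).trans e3) (by positivity) (by positivity)
  have m0 := jointWeight_nonneg (ε := ε) (μ := μ) κ x
  have m1 := jointWeight_nonneg (ε := ε) (μ := μ) κ (x + t)
  have m2 := jointWeight_nonneg (ε := ε) (μ := μ) κ (x - t)
  refine (abs_le_of_sq_le_sq' ?_ (by positivity)).2
  nlinarith [sq_nonneg (jointWeight n ε μ κ (x + t) - jointWeight n ε μ κ (x - t))]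

theorem ofReal_jointWeight_le (h : Regime n ε μ K) {κ : Fin n → ℕ} (hκ : TypicalKernel ε κ) {x : ℝ}
    (hx : x ∈ Set.Icc ε (3 * ε)) :
    ENNReal.ofReal (jointWeight n ε μ κ x) ≤
      ENNReal.ofReal (Real.exp 28 * √(ε * n)) *
        ∫⁻ y, ENNReal.ofReal (jointWeight n ε μ κ y) := by
  have hs := h.sqrt_pos
  have h1 := ofReal_mul_le_lintegral (measurable_jointWeight (ε := ε) (μ := μ) κ)
    (jointWeight_nonneg κ) (x := x) (τ := 1 / √(ε * n)) (c := 2 * Real.exp (-28)) (by positivity)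
    fun t ht => h.jointWeight_le_add hκ hx ht
  have h2 : jointWeight n ε μ κ x = (Real.exp 28 * √(ε * n) / 2) *
      (1 / √(ε * n) * (2 * Real.exp (-28) * jointWeight n ε μ κ x)) := by
    rw [Real.exp_neg]
    field_simp
  rw [h2, ENNReal.ofReal_mul (by positivity)]
  refine (mul_le_mul_right h1 _).trans_eq ?_
  rw [← mul_assoc]
  congr 1
  rw [← ENNReal.ofReal_ofNat, ← ENNReal.ofReal_mul (by positivity)]
  congr 1
  ring

theorem lintegral_meanLaw (h : Regime n ε μ K) (g : ℝ → ℝ≥0∞) (hg : Measurable g) :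
    ∫⁻ x, g x ∂meanLaw n ε μ = ∫⁻ x,
      ENNReal.ofReal (gaussianPDFReal (1 + ε - μ) (1 / (ε * n)).toNNReal x) * g x := by
  rw [meanLaw, gaussianReal_of_var_ne_zero _ h.variance_ne_zero,
    lintegral_withDensity_eq_lintegral_mul _ (measurable_gaussianPDF _ _) hg]
  rfl

theorem lintegral_jointWeight_le (h : Regime n ε μ K) {κ : Fin n → ℕ}
    (hκ : ∀ u, κ u = 0 ∨ 3 ≤ κ u) :
    ∫⁻ y, ENNReal.ofReal (jointWeight n ε μ κ y) ≤
      ∑' j, ∫⁻ x, kernelLaw κ j x ∂meanLaw n ε μ := by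
  rw [← lintegral_tsum fun j => (measurable_kernelLaw κ j).aemeasurable,
    h.lintegral_meanLaw _ (Measurable.tsum fun j => measurable_kernelLaw κ j)]
  refine lintegral_mono fun x => ?_
  rcases le_or_gt x 0 with hx | hx
  · rw [jointWeight, Set.indicator_of_notMem (by simpa using hx), ENNReal.ofReal_zero]
    exact zero_le
  · rw [jointWeight_of_pos κ hx, ENNReal.ofReal_mul (gaussianPDFReal_nonneg _ _ _)]
    refine mul_le_mul_right ?_ _
    rw [← sum_lowWeight, Finset.mul_sum, ENNReal.ofReal_sum_of_nonneg fun j _ =>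
      mul_nonneg (kernelWeight_nonneg κ hx.le) (lowWeight_nonneg _ j hx.le)]
    refine le_trans (Finset.sum_le_sum fun j _ => ?_) (ENNReal.sum_le_tsum _)
    rw [kernelLaw_eq hκ, max_eq_left hx.le]

/-- Given κ and Λ = x, the number of vertices of degree two is binomial with success probability
`twoProb x`. The density of Λ costs √(εn), the integrated binomial probability gains 4 / (ε(N + 1)),
and the product is of order 1/√(εn). -/
theorem lintegral_kernelLaw_le (h : Regime n ε μ K) {κ : Fin n → ℕ}
    (hκ : ∀ u, κ u = 0 ∨ 3 ≤ κ u) (hκ' : TypicalKernel ε κ) (j : ℕ) :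
    ∫⁻ x in typicalMeans n ε μ K, kernelLaw κ j x ∂meanLaw n ε μ ≤
      ENNReal.ofReal (8 * Real.exp 28 / √(ε * n)) *
        ∫⁻ y, ENNReal.ofReal (jointWeight n ε μ κ y) := by
  have hε := h.pos
  have hε1 := h.le
  have hs := h.sqrt_pos
  have hss := h.sqrt_mul_self
  have hn := h.n_pos
  set I := ∫⁻ y, ENNReal.ofReal (jointWeight n ε μ κ y)
  set N := (lowVertices κ).card with hN
  -- Each kernel vertex uses at least three of at most 21 ε³n half-edges, so most vertices are low.
  have hcard : (n : ℝ) / 2 ≤ N := by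
    have h1 : ∑ u, (κ u : ℝ) ≥ 3 * (n - N) := by
      have h2 : ∀ u, (3 : ℝ) - 3 * (if κ u = 0 then 1 else 0) ≤ κ u := fun u => by
        rcases hκ u with hu | hu
        · simp [hu]
        · have : κ u ≠ 0 := by omega
          rw [if_neg this]
          have : (3 : ℝ) ≤ κ u := by exact_mod_cast hu
          linarith
      have h3 := Finset.sum_le_sum fun u (_ : u ∈ Finset.univ) => h2 u
      rw [Finset.sum_sub_distrib, ← Finset.mul_sum, Finset.sum_boole] at h3
      simp only [Finset.sum_const, Finset.card_univ, Fintype.card_fin, nsmul_eq_mul] at h3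
      have h4 : (Finset.univ.filter fun u => κ u = 0).card = N := rfl
      rw [h4] at h3
      linarith
    have h5 := hκ'.2
    have h6 : ε ^ 3 ≤ 1 / 100 := by
      have : ε ^ 2 ≤ 1 := by nlinarith
      nlinarith
    nlinarith
  have hset : typicalMeans n ε μ K ⊆ Set.Icc ε (3 * ε) := h.typicalMeans_subset
  have hm : MeasurableSet (typicalMeans n ε μ K) := measurableSet_Icc
  calc ∫⁻ x in typicalMeans n ε μ K, kernelLaw κ j x ∂meanLaw n ε μ
      = ∫⁻ x, ENNReal.ofReal (gaussianPDFReal (1 + ε - μ) (1 / (ε * n)).toNNReal x) *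
          (typicalMeans n ε μ K).indicator (kernelLaw κ j) x := by
        rw [← lintegral_indicator hm, h.lintegral_meanLaw _ ((measurable_kernelLaw κ j).indicator hm)]
    _ ≤ ∫⁻ x, (Set.Icc ε (3 * ε)).indicator (fun x =>
          ENNReal.ofReal (Real.exp 28 * √(ε * n)) * I *
            ENNReal.ofReal ((bernsteinPolynomial ℝ N j).eval (twoProb x))) x := by
        refine lintegral_mono fun x => ?_
        by_cases hx : x ∈ typicalMeans n ε μ K
        · rw [Set.indicator_of_mem hx, Set.indicator_of_mem (hset hx)]
          have hx0 : 0 < x := hε.trans_le (hset hx).1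
          have h1 : gaussianPDFReal (1 + ε - μ) (1 / (ε * n)).toNNReal x *
              (kernelWeight κ x * lowWeight N j x) =
              jointWeight n ε μ κ x * (bernsteinPolynomial ℝ N j).eval (twoProb x) := by
            rw [jointWeight_of_pos κ hx0, lowWeight_eq hx0.le]
            ring
          rw [kernelLaw_eq hκ, max_eq_left hx0.le,
            ← ENNReal.ofReal_mul (gaussianPDFReal_nonneg _ _ _), h1,
            ENNReal.ofReal_mul (jointWeight_nonneg κ x)]
          exact mul_le_mul_left (h.ofReal_jointWeight_le hκ' (hset hx)) _
        · rw [Set.indicator_of_notMem hx, mul_zero]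
          exact zero_le
    _ = ENNReal.ofReal (Real.exp 28 * √(ε * n)) * I * ∫⁻ x in Set.Icc ε (3 * ε),
            ENNReal.ofReal ((bernsteinPolynomial ℝ N j).eval (twoProb x)) := by
        rw [lintegral_indicator measurableSet_Icc, lintegral_const_mul'' ]
        refine ContinuousOn.aemeasurable ?_ measurableSet_Icc
        exact ENNReal.continuous_ofReal.comp_continuousOn ((Polynomial.continuous _).comp_continuousOn
          (continuousOn_twoProb fun x hx => hε.le.trans hx.1))
    _ ≤ ENNReal.ofReal (Real.exp 28 * √(ε * n)) * I * ENNReal.ofReal (4 / (ε * (N + 1))) :=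
        mul_le_mul_right (lintegral_twoProb_le hε (by linarith) (by linarith) N j) _
    _ ≤ ENNReal.ofReal (8 * Real.exp 28 / √(ε * n)) * I := by
        rw [mul_right_comm, ← ENNReal.ofReal_mul (by positivity)]
        refine mul_le_mul_left (ENNReal.ofReal_le_ofReal ?_) _
        have h1 : 4 / (ε * (N + 1)) ≤ 8 / (ε * n) := by
          rw [div_le_div_iff₀ (by positivity) (by positivity)]
          nlinarith
        calc _ ≤ Real.exp 28 * √(ε * n) * (8 / (ε * n)) :=
              mul_le_mul_of_nonneg_left h1 (by positivity)
          _ = _ := by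
            have h2 : 8 / (ε * n) = 8 / √(ε * n) / √(ε * n) := by rw [div_div, hss]
            rw [h2]
            field_simp

theorem tsum_insertionCount_le {m : ℕ} (hm : 2 ≤ m) (k : ℕ) :
    ∑' j, ENNReal.ofReal (insertionCount j k / insertionNorm m j) ≤
      ENNReal.ofReal (2 / m.multichoose k) := by
  have hc : (0 : ℝ) < m.multichoose k := by
    have : 0 < m.multichoose k := by
      rw [Nat.multichoose_eq]
      exact Nat.choose_pos (by omega)
    exact_mod_cast this
  refine ENNReal.tsum_le_of_sum_range_le fun J => ?_
  rw [← ENNReal.ofReal_sum_of_nonneg fun j _ =>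
    div_nonneg (Nat.cast_nonneg _) (insertionNorm_pos m j).le]
  refine ENNReal.ofReal_le_ofReal ?_
  rw [le_div_iff₀ hc, Finset.sum_mul]
  refine le_trans (le_of_eq (Finset.sum_congr rfl fun j _ => ?_)) (sum_insertionProb_le hm k J)
  rw [insertionProb, div_mul_eq_mul_div]

end Regime

/-- The constant in the comparison of the two models. -/
noncomputable def comparisonConst (K : ℝ) : ℝ :=
  16 * Real.exp 28 * (400 * Real.exp (70 * (2 * K + 1) ^ 2))

theorem comparisonConst_pos (K : ℝ) : 0 < comparisonConst K := by
  unfold comparisonConst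
  positivity

namespace Regime

variable {n : ℕ} {ε μ K : ℝ}

/-- With s = √(εn), m is of order (εs)² and k of order εs². Then √m / (m + k) is of order 1/s, and
the squared deviation divided by the variance stays bounded in terms of K. -/
theorem le_multichoose (h : Regime n ε μ K) {κ : Fin n → ℕ} (hκ : TypicalKernel ε κ) {k : ℕ}
    (hk : TypicalCount ε μ (2 * K) κ k) :
    (400 * Real.exp (70 * (2 * K + 1) ^ 2) * √(ε * n))⁻¹ ≤
      ((∑ u, κ u + 1) / 2).multichoose k * ((1 - μ) ^ ((∑ u, κ u + 1) / 2) * μ ^ k) := by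
  have hε := h.pos
  have hε1 := h.le
  have hs := h.sqrt_pos
  have hss := h.sqrt_mul_self
  have hn := h.n_pos
  have hK := h.one_le
  have hsK := h.le_mul_sqrt
  have hμ1 := h.one_sub_le
  have hμ2 := h.le_one_sub
  have hμ0 := h.pos_right
  obtain ⟨hM1, hM2⟩ := hκ
  rw [TypicalCount] at hk
  set m := (∑ u, κ u + 1) / 2 with hm
  have hm1 : ∑ u, κ u ≤ 2 * m := by omega
  have hm2 : 2 * m ≤ ∑ u, κ u + 1 := by omega
  have hm1' : ∑ u, (κ u : ℝ) ≤ 2 * m := by exact_mod_cast hm1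
  have hm2' : 2 * (m : ℝ) ≤ ∑ u, (κ u : ℝ) + 1 := by exact_mod_cast hm2
  set M := ∑ u, (κ u : ℝ) with hM
  set s := √(ε * n) with hs'
  set θ := μ / (2 * (1 - μ)) with hθ
  have hμ3 : 0 < 1 - μ := by linarith
  have hT : ε ^ 3 * n = (ε * s) ^ 2 := by rw [mul_pow, sq s, hss]; ring
  have hεs : 1000 ≤ ε * s := by linarith
  rw [hT] at hM1 hM2
  have hm0 : (ε * s) ^ 2 / 16 ≤ m := by linarith
  have hm3 : (m : ℝ) ≤ 11 * (ε * s) ^ 2 := by nlinarith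
  have hθ1 : θ ≤ 1 / ε := by
    rw [hθ, div_le_div_iff₀ (by positivity) hε]
    have := mul_le_mul_of_nonneg_right h.lt_one.le hε.le
    linarith
  have hθ2 : 1 / (4 * ε) ≤ θ := by
    rw [hθ, div_le_div_iff₀ (by positivity) (by positivity)]
    nlinarith
  have hθ0 : 0 ≤ θ := le_trans (by positivity) hθ2
  have hεi : 1 / ε ≤ s := by
    rw [div_le_iff₀ hε]
    linarith
  have hk1 := abs_le.1 hk
  have hs2 : 1000 * (K * s) ≤ ε * s * s := by nlinarith
  have hθM1 : θ * M ≤ 21 * (ε * s * s) := by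
    calc θ * M ≤ 1 / ε * (21 * (ε * s) ^ 2) := mul_le_mul hθ1 hM2 (by positivity) (by positivity)
      _ = _ := by field_simp
  have hθM2 : ε * s * s / 32 ≤ θ * M := by
    calc ε * s * s / 32 = 1 / (4 * ε) * ((ε * s) ^ 2 / 8) := by field_simp; norm_num
      _ ≤ _ := mul_le_mul hθ2 hM1 (by positivity) hθ0
  have hkl : ε * s * s / 40 ≤ k := by linarith
  have hku : (k : ℝ) ≤ 22 * (ε * s * s) := by linarith
  have hpos : 0 < ε * s * s := by positivity
  have hk0 : k ≠ 0 := by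
    rintro rfl
    rw [Nat.cast_zero] at hkl
    linarith
  have hm00 : m ≠ 0 := by
    intro h0
    rw [h0, Nat.cast_zero] at hm0
    nlinarith
  refine le_trans ?_ (le_multichoose_mul hm00 hk0 hμ0 h.lt_one)
  have hmk : (m : ℝ) + k ≤ 23 * (ε * s * s) := by
    have : (ε * s) ^ 2 = ε * (ε * s * s) := by ring
    nlinarith
  have hsm : ε * s / 4 ≤ √m := by
    refine Real.le_sqrt_of_sq_le ?_
    rw [div_pow]
    linarith
  have hmpos : (0 : ℝ) < m := by positivity
  have hkpos : (0 : ℝ) < k := by positivity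
  have hA : (400 * s)⁻¹ ≤ √m / (4 * (m + k)) := by
    rw [le_div_iff₀ (by positivity), inv_mul_le_iff₀ (by positivity)]
    have := mul_le_mul_of_nonneg_left hsm (by positivity : 0 ≤ 400 * s)
    linarith
  have hX : ((k : ℝ) * (1 - μ) - m * μ) ^ 2 / ((m + k) * μ * (1 - μ)) ≤ 70 * (2 * K + 1) ^ 2 := by
    have h1 : (k : ℝ) * (1 - μ) - m * μ = (1 - μ) * (k - θ * (2 * m)) := by
      rw [hθ]
      field_simp
    -- Rounding makes 2m exceed the degree sum by at most one, which costs θ ≤ 1/ε ≤ s. This is the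
    -- 1 in 2K + 1.
    have h2 : |k - θ * (2 * m)| ≤ (2 * K + 1) * s := by
      have h3 : θ * M ≤ θ * (2 * m) := mul_le_mul_of_nonneg_left hm1' hθ0
      have h4 : θ * (2 * m) ≤ θ * (M + 1) := mul_le_mul_of_nonneg_left hm2' hθ0
      rw [abs_le]
      constructor <;> linarith
    have h3 : (k - θ * (2 * m)) ^ 2 ≤ ((2 * K + 1) * s) ^ 2 := by
      rw [← sq_abs]
      exact pow_le_pow_left₀ (abs_nonneg _) h2 2
    rw [h1, mul_pow, div_le_iff₀ (by positivity)]
    have h5 : ε * s * s / 40 * (99 / 100) ≤ (m + k) * μ :=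
      mul_le_mul (by linarith) (by linarith) (by norm_num) (by positivity)
    have h6 : (1 - μ) * s ^ 2 ≤ 70 * ((m + k) * μ) := by
      have h7 : (1 - μ) * s ^ 2 ≤ ε * s ^ 2 := mul_le_mul_of_nonneg_right hμ1 (sq_nonneg s)
      linarith
    calc (1 - μ) ^ 2 * (k - θ * (2 * m)) ^ 2 ≤ (1 - μ) ^ 2 * ((2 * K + 1) * s) ^ 2 :=
          mul_le_mul_of_nonneg_left h3 (by positivity)
      _ = (1 - μ) * (2 * K + 1) ^ 2 * ((1 - μ) * s ^ 2) := by ring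
      _ ≤ (1 - μ) * (2 * K + 1) ^ 2 * (70 * ((m + k) * μ)) :=
          mul_le_mul_of_nonneg_left h6 (by positivity)
      _ = _ := by ring
  calc (400 * Real.exp (70 * (2 * K + 1) ^ 2) * s)⁻¹
      = (400 * s)⁻¹ * Real.exp (-(70 * (2 * K + 1) ^ 2)) := by
        rw [Real.exp_neg, ← mul_inv]
        ring
    _ ≤ _ := mul_le_mul hA (Real.exp_le_exp.2 (neg_le_neg hX)) (Real.exp_pos _).le (by positivity)

/-- The bound of order P(κ)/√(εn) is uniform in j, so the sum over j falls only on the urn weights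
and is at most 2 / `multichoose`. The lower bound for the negative binomial probability absorbs both
factors. -/
theorem tsum_lintegral_kernelLaw_le (h : Regime n ε μ K) {κ : Fin n → ℕ}
    (hκ : TypicalKernel ε κ) {k : ℕ} (hk : TypicalCount ε μ (2 * K) κ k) :
    ∑' j, ENNReal.ofReal (insertionCount j k / insertionNorm ((∑ u, κ u + 1) / 2) j) *
        ∫⁻ x in typicalMeans n ε μ K, kernelLaw κ j x ∂meanLaw n ε μ ≤
      ENNReal.ofReal (comparisonConst K) *
        (ENNReal.ofReal ((1 - μ) ^ ((∑ u, κ u + 1) / 2) * μ ^ k) *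
          ∑' j, ∫⁻ x, kernelLaw κ j x ∂meanLaw n ε μ) := by
  by_cases hκ0 : ∀ u, κ u = 0 ∨ 3 ≤ κ u
  swap
  · simp [kernelLaw_eq_zero hκ0]
  have hs := h.sqrt_pos
  have hNB := h.le_multichoose hκ hk
  have hm : 2 ≤ (∑ u, κ u + 1) / 2 := by
    have h1 := hκ.1
    have h2 := h.large
    have h3 := h.one_le
    have h4 : (3 : ℝ) ≤ ∑ u, (κ u : ℝ) := by nlinarith
    have h5 : 3 ≤ ∑ u, κ u := by exact_mod_cast h4
    omega
  set m := (∑ u, κ u + 1) / 2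
  set Q := ∑' j, ∫⁻ x, kernelLaw κ j x ∂meanLaw n ε μ
  have hc : (0 : ℝ) < m.multichoose k := by
    have : 0 < m.multichoose k := by
      rw [Nat.multichoose_eq]
      exact Nat.choose_pos (by omega)
    exact_mod_cast this
  calc _ ≤ ∑' j, ENNReal.ofReal (insertionCount j k / insertionNorm m j) *
        (ENNReal.ofReal (8 * Real.exp 28 / √(ε * n)) * Q) :=
        ENNReal.tsum_le_tsum fun j => mul_le_mul_right ((h.lintegral_kernelLaw_le hκ0 hκ j).trans
          (mul_le_mul_right (h.lintegral_jointWeight_le hκ0) _)) _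
    _ = (∑' j, ENNReal.ofReal (insertionCount j k / insertionNorm m j)) *
        (ENNReal.ofReal (8 * Real.exp 28 / √(ε * n)) * Q) := ENNReal.tsum_mul_right
    _ ≤ ENNReal.ofReal (2 / m.multichoose k) *
        (ENNReal.ofReal (8 * Real.exp 28 / √(ε * n)) * Q) :=
        mul_le_mul_left (tsum_insertionCount_le hm k) _
    _ ≤ _ := by
        rw [← mul_assoc, ← mul_assoc, ← ENNReal.ofReal_mul (by positivity),
          ← ENNReal.ofReal_mul (comparisonConst_pos K).le]
        refine mul_le_mul_left (ENNReal.ofReal_le_ofReal ?_) _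
        rw [div_mul_eq_mul_div, div_le_iff₀ hc, comparisonConst]
        have h1 : (0 : ℝ) < 400 * Real.exp (70 * (2 * K + 1) ^ 2) * √(ε * n) := by positivity
        have h2 := (inv_le_iff_one_le_mul₀ h1).1 hNB
        calc 2 * (8 * Real.exp 28 / √(ε * n)) = 16 * Real.exp 28 / √(ε * n) * 1 := by ring
          _ ≤ 16 * Real.exp 28 / √(ε * n) * _ := mul_le_mul_of_nonneg_left h2 (by positivity)
          _ = _ := by
            field_simp

end Regime

/-! ### Moments of the Poisson distribution -/

theorem hasSum_poisson_descFactorial (r : NNReal) (k : ℕ) :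
    HasSum (fun i => Real.exp (-r) * r ^ i / i.factorial * (i.descFactorial k : ℝ)) ((r : ℝ) ^ k) := by
  rw [← hasSum_nat_add_iff' k]
  have h0 : ∑ i ∈ Finset.range k,
      Real.exp (-r) * r ^ i / i.factorial * (i.descFactorial k : ℝ) = 0 :=
    Finset.sum_eq_zero fun i hi => by
      rw [Nat.descFactorial_of_lt (Finset.mem_range.1 hi), Nat.cast_zero, mul_zero]
  rw [h0, sub_zero]
  have h1 := (hasSum_one_poissonMeasure r).mul_left ((r : ℝ) ^ k)
  rw [mul_one] at h1
  refine h1.congr_fun fun i => ?_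
  have h2 : ((i + k).factorial : ℝ) = i.factorial * (i + k).descFactorial k := by
    have := Nat.factorial_mul_descFactorial (Nat.le_add_left k i)
    rw [Nat.add_sub_cancel] at this
    exact_mod_cast this.symm
  have h3 : ((i + k).descFactorial k : ℝ) ≠ 0 := by
    have := Nat.descFactorial_pos (n := i + k) (k := k)
    exact_mod_cast (this.2 (Nat.le_add_left k i)).ne'
  have h4 : (i.factorial : ℝ) ≠ 0 := by positivity
  rw [h2, pow_add]
  field_simp

/-- The indicator of a vertex of degree two. -/
def twoIndicator (i : ℕ) : ℝ := if i = 2 then 1 else 0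

/-- The contribution of a vertex to the sum of the kernel degrees. -/
def kernelDegree (i : ℕ) : ℝ := if 3 ≤ i then i else 0

theorem hasSum_twoIndicator (r : NNReal) :
    HasSum (fun i => Real.exp (-r) * r ^ i / i.factorial * twoIndicator i)
      (Real.exp (-r) * r ^ 2 / 2) := by
  convert! hasSum_single (f := fun i => Real.exp (-r) * r ^ i / i.factorial * twoIndicator i) 2 ?_
    using 1
  · simp [twoIndicator]
  · intro i hi
    simp [twoIndicator, hi]

/-- The expected contribution of a vertex to the sum of the kernel degrees. -/
noncomputable def kernelMean (x : ℝ) : ℝ := x - (1 + x) * x * Real.exp (-x)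

/-- A kernel degree is the full degree minus the contributions of the degrees one and two. -/
theorem hasSum_kernelDegree (r : NNReal) :
    HasSum (fun i => Real.exp (-r) * r ^ i / i.factorial * kernelDegree i) (kernelMean r) := by
  have h1 := hasSum_poisson_descFactorial r 1
  have h2 : HasSum (fun i => Real.exp (-r) * r ^ i / i.factorial * (if i = 1 then 1 else 0 : ℝ))
      (Real.exp (-r) * r) := by
    convert! hasSum_single (f := fun i =>
      Real.exp (-r) * r ^ i / i.factorial * (if i = 1 then 1 else 0 : ℝ)) 1 ?_ using 1
    · simp
    · intro i hi
      simp [hi]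
  have h3 := (h1.sub h2).sub ((hasSum_twoIndicator r).mul_left 2)
  convert! h3 using 1
  · funext i
    have : kernelDegree i = i.descFactorial 1 - (if i = 1 then 1 else 0) - 2 * twoIndicator i := by
      rcases i with _ | _ | _ | i <;> simp [kernelDegree, twoIndicator]
    rw [this]
    ring
  · rw [kernelMean]
    ring

/-- Sharp at 3. Comparison with the third factorial moment shows that the second moment is O(x³), as
small as the mean. -/
theorem kernelDegree_sq_le (i : ℕ) : kernelDegree i ^ 2 ≤ 3 / 2 * (i.descFactorial 3 : ℝ) := by
  rcases i with _ | _ | _ | i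
  · simp [kernelDegree]
  · simp [kernelDegree]
  · simp [kernelDegree]
  · simp only [kernelDegree, Nat.descFactorial]
    rw [if_pos (by omega)]
    have : (0 : ℝ) ≤ i := Nat.cast_nonneg i
    have e1 : i + 1 + 1 + 1 - 2 = i + 1 := by omega
    have e2 : i + 1 + 1 + 1 - 1 = i + 2 := by omega
    rw [e1, e2]
    push_cast
    nlinarith [pow_nonneg this 3, pow_nonneg this 2]

/-- The variance is bounded through a dominating function `w` whose mean is explicit, so the second
moment of `g` itself need not be computed. -/
theorem pi_poissonMeasure_chebyshev (n : ℕ) {r : NNReal} {g w : ℕ → ℝ} {a b c : ℝ}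
    (ha : HasSum (fun i => Real.exp (-r) * r ^ i / i.factorial * g i) a)
    (hb : HasSum (fun i => Real.exp (-r) * r ^ i / i.factorial * w i) b)
    (hw : ∀ i, g i ^ 2 ≤ w i) (hc : 0 < c) :
    (Measure.pi fun _ : Fin n => poissonMeasure r) {d | c ≤ |∑ u, g (d u) - n * a|} ≤
      ENNReal.ofReal (n * b / c ^ 2) := by
  have hp (i : ℕ) : 0 ≤ Real.exp (-r) * r ^ i / i.factorial := by positivity
  have hs : Summable fun i => Real.exp (-r) * r ^ i / i.factorial * g i ^ 2 :=
    hb.summable.of_nonneg_of_le (fun i => mul_nonneg (hp i) (sq_nonneg _))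
      fun i => mul_le_mul_of_nonneg_left (hw i) (hp i)
  have hL : MemLp g 2 (poissonMeasure r) := by
    rw [memLp_two_iff_integrable_sq (by fun_prop), integrable_poissonMeasure_iff]
    simpa using hs
  have hE : ∫ i, g i ∂poissonMeasure r = a := by
    rw [integral_poissonMeasure]
    simpa using ha.tsum_eq
  have hV : Var[g; poissonMeasure r] ≤ b := by
    refine (variance_le_expectation_sq hL.1).trans ?_
    rw [integral_poissonMeasure]
    refine (Summable.tsum_le_tsum (fun i => ?_) ?_ hb.summable).trans_eq hb.tsum_eq
    · exact mul_le_mul_of_nonneg_left (hw i) (hp i)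
    · simpa using hs
  set P := Measure.pi fun _ : Fin n => poissonMeasure r
  have hX (u : Fin n) : MemLp (fun d : Fin n → ℕ => g (d u)) 2 P :=
    hL.comp_measurePreserving (measurePreserving_eval (fun _ : Fin n => poissonMeasure r) u)
  have hS : MemLp (∑ u, fun d : Fin n → ℕ => g (d u)) 2 P := memLp_finsetSum' _ fun u _ => hX u
  have hM : P[∑ u, fun d : Fin n → ℕ => g (d u)] = n * a := by
    simp only [Finset.sum_apply]
    rw [integral_finsetSum _ fun u _ => (hX u).integrable one_le_two]
    have h1 (u : Fin n) : ∫ d, g (d u) ∂P = a := by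
      rw [← hE]
      exact integral_comp_eval (μ := fun _ : Fin n => poissonMeasure r) (f := g) hL.1
    simp [h1]
  have hV' : Var[∑ u, fun d : Fin n → ℕ => g (d u); P] ≤ n * b := by
    refine (variance_sum_pi (μ := fun _ : Fin n => poissonMeasure r) (X := fun _ => g)
      fun _ => hL).trans_le ?_
    refine (Finset.sum_le_sum fun _ _ => hV).trans_eq ?_
    simp
  have h := meas_ge_le_variance_div_sq hS hc
  rw [hM] at h
  simp only [Finset.sum_apply] at h
  exact h.trans (ENNReal.ofReal_le_ofReal (div_le_div_of_nonneg_right hV' (sq_nonneg c)))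

theorem lintegral_degreeTwoCount (n : ℕ) (r : NNReal) :
    ∫⁻ d, (degreeTwoCount d : ℝ≥0∞) ∂(Measure.pi fun _ : Fin n => poissonMeasure r) =
      ENNReal.ofReal (n * (Real.exp (-r) * r ^ 2 / 2)) := by
  have h1 (d : Fin n → ℕ) : (degreeTwoCount d : ℝ≥0∞) =
      ∑ u, ({2} : Set ℕ).indicator 1 (d u) := by
    rw [degreeTwoCount_eq, Finset.card_filter, Nat.cast_sum]
    refine Finset.sum_congr rfl fun u _ => ?_
    by_cases h : d u = 2 <;> simp [h]
  simp only [h1]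
  rw [lintegral_finsetSum _ fun u _ => measurable_of_countable _]
  have h2 (u : Fin n) : ∫⁻ d, ({2} : Set ℕ).indicator 1 (d u)
      ∂(Measure.pi fun _ : Fin n => poissonMeasure r) =
        ENNReal.ofReal (Real.exp (-r) * r ^ 2 / 2) := by
    rw [(measurePreserving_eval (fun _ : Fin n => poissonMeasure r) u).lintegral_comp
      (f := ({2} : Set ℕ).indicator (1 : ℕ → ℝ≥0∞)) (measurable_of_countable _),
      lintegral_indicator_one (measurableSet_singleton 2), poissonMeasure_singleton]
    simp
  simp only [h2]
  rw [Finset.sum_const, Finset.card_univ, Fintype.card_fin, ← ENNReal.ofReal_nsmul, nsmul_eq_mul]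

theorem sum_kernelDegree {n : ℕ} (d : Fin n → ℕ) :
    ∑ u, kernelDegree (d u) = ∑ u, (kernelPart d u : ℝ) :=
  Finset.sum_congr rfl fun u _ => by
    unfold kernelDegree kernelPart
    split_ifs <;> simp

theorem sum_twoIndicator {n : ℕ} (d : Fin n → ℕ) :
    ∑ u, twoIndicator (d u) = degreeTwoCount d := by
  rw [degreeTwoCount_eq, Finset.card_filter, Nat.cast_sum]
  exact Finset.sum_congr rfl fun u _ => by
    unfold twoIndicator
    split_ifs <;> simp

/-! ### Typical degrees -/

instance (n : ℕ) (ε μ : ℝ) : IsProbabilityMeasure (meanLaw n ε μ) := by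
  unfold meanLaw
  infer_instance

theorem one_sub_one_add_mul_exp_neg_le {x : ℝ} (hx : 0 ≤ x) : 1 - (1 + x) * Real.exp (-x) ≤ x ^ 2 := by
  have := Real.add_one_le_exp (-x)
  nlinarith

theorem le_one_sub_one_add_mul_exp_neg {x : ℝ} (hx : 0 ≤ x) :
    x ^ 2 / 2 - x ^ 3 / 2 ≤ 1 - (1 + x) * Real.exp (-x) := by
  have h1 := Real.quadratic_le_exp_of_nonneg hx
  have h2 : Real.exp (-x) ≤ 1 - x + x ^ 2 / 2 := by
    rw [Real.exp_neg, inv_le_iff_one_le_mul₀ (Real.exp_pos x)]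
    have h3 : 0 ≤ 1 - x + x ^ 2 / 2 := by nlinarith [sq_nonneg (x - 1)]
    have h4 := mul_le_mul_of_nonneg_left h1 h3
    nlinarith [sq_nonneg (x ^ 2)]
  nlinarith

theorem kernelMean_eq (x : ℝ) : kernelMean x = x * (1 - (1 + x) * Real.exp (-x)) := by
  rw [kernelMean]
  ring

theorem hasDerivAt_kernelMean (x : ℝ) :
    HasDerivAt kernelMean (1 - (1 + x) * Real.exp (-x) + x ^ 2 * Real.exp (-x)) x := by
  have h1 : HasDerivAt (fun x : ℝ => Real.exp (-x)) (Real.exp (-x) * -1) x :=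
    (hasDerivAt_neg x).exp
  have h2 : HasDerivAt (fun x : ℝ => (1 + x) * x) (1 * x + (1 + x) * 1) x :=
    ((hasDerivAt_id x).const_add 1).mul (hasDerivAt_id x)
  refine ((hasDerivAt_id x).sub (h2.mul h1)).congr_deriv ?_
  ring

/-- The expected difference between the contributions of a vertex to the number of vertices of degree
two and to the multiple `θ` of the sum of the kernel degrees. -/
noncomputable def meanDiff (θ x : ℝ) : ℝ := Real.exp (-x) * x ^ 2 / 2 - θ * kernelMean x

theorem hasDerivAt_meanDiff (θ x : ℝ) :
    HasDerivAt (meanDiff θ) (Real.exp (-x) * (x - x ^ 2 / 2) -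
      θ * (1 - (1 + x) * Real.exp (-x) + x ^ 2 * Real.exp (-x))) x := by
  have h1 : HasDerivAt (fun x : ℝ => Real.exp (-x)) (Real.exp (-x) * -1) x :=
    (hasDerivAt_neg x).exp
  have h2 := (h1.mul (hasDerivAt_pow 2 x)).div_const 2
  refine (h2.sub ((hasDerivAt_kernelMean x).const_mul θ)).congr_deriv ?_
  push_cast
  ring

/-- This is where the duality enters. With λ = 1 + ε - μ it reads e^(-λ)(1 + ε) = μ, whence 1 - (1 +
λ)e^(-λ) = (1 - μ)λ/(1 + ε). Thus the mean number of vertices of degree two equals θ times the mean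
sum of the kernel degrees, and θM is the negative binomial mean up to rounding. -/
theorem IsDual.meanDiff_eq_zero {ε μ : ℝ} (h : IsDual ε μ) :
    meanDiff (μ / (2 * (1 - μ))) (1 + ε - μ) = 0 := by
  have h1 := h.exp_neg
  have h2 : 1 - μ ≠ 0 := by linarith [h.lt_one]
  rw [meanDiff, kernelMean_eq]
  set e := Real.exp (-(1 + ε - μ))
  field_simp
  linear_combination (1 + ε - μ) * h1

namespace Regime

variable {n : ℕ} {ε μ K x : ℝ}

theorem mono (h : Regime n ε μ (20 * K)) (hK : 1 ≤ K) : Regime n ε μ K where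
  toIsDual := h.toIsDual
  one_le := hK
  large := (pow_le_pow_left₀ (by linarith) (by linarith) 2).trans h.large

theorem mean_mem (h : Regime n ε μ K) (hx : x ∈ typicalMeans n ε μ K) :
    x ∈ Set.Icc ε (21 / 10 * ε) := by
  have h1 := h.div_sqrt_le
  have h2 := h.one_sub_le
  have h3 := h.le_one_sub
  have h4 := h.pos
  exact ⟨by linarith [hx.1], by linarith [hx.2]⟩

theorem theta_le (h : Regime n ε μ K) : μ / (2 * (1 - μ)) ≤ 1 / ε := by
  have hε := h.pos
  have hμ2 := h.le_one_sub
  have hμ3 : 0 < 1 - μ := by linarith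
  rw [div_le_div_iff₀ (by positivity) hε]
  have := mul_le_mul_of_nonneg_right h.lt_one.le hε.le
  linarith

theorem theta_nonneg (h : Regime n ε μ K) : 0 ≤ μ / (2 * (1 - μ)) := by
  have := h.lt_one
  have := h.pos_right
  exact div_nonneg (by linarith) (by linarith)

/-- The difference vanishes at the centre of the interval, and its derivative there is O(ε):
although θ is of order 1/ε, the derivative of `kernelMean` is O(ε²). -/
theorem abs_meanDiff_le (h : Regime n ε μ K) (hx : x ∈ typicalMeans n ε μ K) :
    |meanDiff (μ / (2 * (1 - μ))) x| ≤ 11 * ε * (K / √(ε * n)) := by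
  have hε := h.pos
  have hε1 := h.le
  have hθ1 := h.theta_le
  have hθ0 := h.theta_nonneg
  set θ := μ / (2 * (1 - μ)) with hθ
  have hs := h.sqrt_pos
  have hK := h.one_le
  have hx0 : 1 + ε - μ ∈ typicalMeans n ε μ K := by
    have : 0 ≤ K / √(ε * n) := by positivity
    exact ⟨by linarith, by linarith⟩
  have hb (y : ℝ) (hy : y ∈ typicalMeans n ε μ K) :
      ‖Real.exp (-y) * (y - y ^ 2 / 2) -
        θ * (1 - (1 + y) * Real.exp (-y) + y ^ 2 * Real.exp (-y))‖ ≤ 11 * ε := by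
    obtain ⟨hy1, hy2⟩ := h.mean_mem hy
    have hy0 : 0 ≤ y := hε.le.trans hy1
    have e1 : Real.exp (-y) ≤ 1 := Real.exp_le_one_iff.2 (by linarith)
    have e0 := Real.exp_pos (-y)
    have e2 := one_sub_one_add_mul_exp_neg_le hy0
    have e3 := le_one_sub_one_add_mul_exp_neg hy0
    have e4 : 0 ≤ y ^ 2 / 2 - y ^ 3 / 2 := by nlinarith [sq_nonneg y]
    have e5 : 0 ≤ y - y ^ 2 / 2 := by nlinarith
    have e6 : Real.exp (-y) * (y - y ^ 2 / 2) ≤ 21 / 10 * ε := by nlinarith [sq_nonneg y]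
    have e7 : 1 - (1 + y) * Real.exp (-y) + y ^ 2 * Real.exp (-y) ≤ 2 * y ^ 2 := by
      nlinarith [sq_nonneg y]
    have e8 : 0 ≤ 1 - (1 + y) * Real.exp (-y) + y ^ 2 * Real.exp (-y) := by
      have : 0 ≤ y ^ 2 * Real.exp (-y) := by positivity
      linarith
    have e9 : θ * (1 - (1 + y) * Real.exp (-y) + y ^ 2 * Real.exp (-y)) ≤ 89 / 10 * ε := by
      have f1 : y ^ 2 ≤ (21 / 10 * ε) ^ 2 := pow_le_pow_left₀ hy0 hy2 2
      calc _ ≤ 1 / ε * (2 * (21 / 10 * ε) ^ 2) :=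
            mul_le_mul hθ1 (by linarith) e8 (by positivity)
        _ = 882 / 100 * ε := by field_simp; norm_num
        _ ≤ _ := by linarith
    rw [Real.norm_eq_abs, abs_le]
    have f2 := mul_nonneg hθ0 e8
    have f3 := mul_nonneg e0.le e5
    constructor <;> linarith
  have h1 := Convex.norm_image_sub_le_of_norm_hasDerivWithin_le (f := meanDiff θ)
    (fun y _ => (hasDerivAt_meanDiff θ y).hasDerivWithinAt) hb (convex_Icc _ _) hx0 hx
  rw [hθ, h.meanDiff_eq_zero, sub_zero, Real.norm_eq_abs, Real.norm_eq_abs] at h1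
  refine h1.trans (mul_le_mul_of_nonneg_left ?_ (by positivity))
  rw [abs_le]
  exact ⟨by linarith [hx.1], by linarith [hx.2]⟩

theorem measure_not_typicalMeans_le (h : Regime n ε μ K) :
    meanLaw n ε μ (typicalMeans n ε μ K)ᶜ ≤ ENNReal.ofReal (1 / K ^ 2) := by
  have hs := h.sqrt_pos
  have hK := h.one_le
  have hεn : 0 < ε * n := mul_pos h.pos h.n_pos
  have hc : 0 < K / √(ε * n) := by positivity
  have h1 := meas_ge_le_variance_div_sq (μ := meanLaw n ε μ) (X := id)
    (memLp_id_gaussianReal 2) hc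
  have h2 : Var[id; meanLaw n ε μ] = 1 / (ε * n) := by
    rw [meanLaw, variance_id_gaussianReal, Real.coe_toNNReal _ (by positivity)]
  have h3 : (meanLaw n ε μ)[id] = 1 + ε - μ := integral_id_gaussianReal
  rw [h2, h3] at h1
  refine (measure_mono fun x hx => ?_).trans (h1.trans_eq ?_)
  · rw [Set.mem_ofPred_eq, id]
    by_contra! hlt
    refine hx ?_
    have := abs_lt.1 hlt
    exact ⟨by linarith [this.1], by linarith [this.2]⟩
  · rw [div_pow, sq √_, h.sqrt_mul_self]
    congr 1
    field_simp
    exact div_self hεn.ne'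

theorem coe_mean (h : Regime n ε μ K) (hx : x ∈ typicalMeans n ε μ K) :
    ((x.toNNReal : NNReal) : ℝ) = x :=
  Real.coe_toNNReal _ (h.pos.le.trans (h.mean_mem hx).1)

theorem cube_le (h : Regime n ε μ K) (hx : x ∈ typicalMeans n ε μ K) : x ^ 3 ≤ 93 / 10 * ε ^ 3 := by
  have hε := h.pos
  obtain ⟨h1, h2⟩ := h.mean_mem hx
  have := pow_le_pow_left₀ (hε.le.trans h1) h2 3
  nlinarith [pow_pos hε 3]

theorem kernelMean_mem (h : Regime n ε μ K) (hx : x ∈ typicalMeans n ε μ K) :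
    kernelMean x ∈ Set.Icc (48 / 100 * ε ^ 3) (93 / 10 * ε ^ 3) := by
  have hε := h.pos
  have hε1 := h.le
  have hcube := h.cube_le hx
  obtain ⟨hx1, hx2⟩ := h.mean_mem hx
  have hx0 : 0 ≤ x := hε.le.trans hx1
  rw [kernelMean_eq]
  constructor
  · have e1 : 485 / 1000 * x ^ 2 ≤ x ^ 2 / 2 - x ^ 3 / 2 := by
      have e2 : x ^ 2 * x ≤ x ^ 2 * (3 / 100) :=
        mul_le_mul_of_nonneg_left (by linarith) (sq_nonneg x)
      have e3 : x ^ 2 * x = x ^ 3 := by ring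
      have e4 : 0 ≤ x ^ 2 := sq_nonneg x
      linarith
    have e3 : ε ^ 3 ≤ x ^ 3 := pow_le_pow_left₀ hε.le hx1 3
    have e4 := mul_le_mul_of_nonneg_left (e1.trans (le_one_sub_one_add_mul_exp_neg hx0)) hx0
    have e5 : x * (485 / 1000 * x ^ 2) = 485 / 1000 * x ^ 3 := by ring
    have e6 : 0 < ε ^ 3 := pow_pos hε 3
    linarith
  · have e1 := mul_le_mul_of_nonneg_left (one_sub_one_add_mul_exp_neg_le hx0) hx0
    have e2 : x * x ^ 2 = x ^ 3 := by ring
    linarith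

theorem measure_not_typicalKernel_le (h : Regime n ε μ K) (hx : x ∈ typicalMeans n ε μ K) :
    (Measure.pi fun _ : Fin n => poissonMeasure x.toNNReal)
      {d | ¬ TypicalKernel ε (kernelPart d)} ≤ ENNReal.ofReal (1 / K ^ 2) := by
  have hε := h.pos
  have hε1 := h.le
  have hn := h.n_pos
  have hK := h.one_le
  have hcube := h.cube_le hx
  have hL := h.large
  obtain ⟨hx1, hx2⟩ := h.mean_mem hx
  have hx0 : 0 ≤ x := hε.le.trans hx1
  have hT : 0 < ε ^ 3 * n := by positivity
  have hc : 0 < 3 / 10 * (ε ^ 3 * n) := by positivity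
  have hb : HasSum (fun i => Real.exp (-(x.toNNReal : ℝ)) * (x.toNNReal : ℝ) ^ i / i.factorial *
      (3 / 2 * (i.descFactorial 3 : ℝ))) (3 / 2 * x ^ 3) := by
    have h1 := (hasSum_poisson_descFactorial x.toNNReal 3).mul_left (3 / 2)
    rw [h.coe_mean hx] at h1 ⊢
    exact h1.congr_fun fun i => by ring
  have h1 := pi_poissonMeasure_chebyshev n (hasSum_kernelDegree x.toNNReal) hb kernelDegree_sq_le hc
  rw [h.coe_mean hx] at h1
  refine (measure_mono fun d hd => ?_).trans (h1.trans (ENNReal.ofReal_le_ofReal ?_))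
  · rw [Set.mem_ofPred_eq] at hd ⊢
    by_contra! hlt
    refine hd ?_
    rw [sum_kernelDegree] at hlt
    have h2 := abs_lt.1 hlt
    obtain ⟨h3, h4⟩ := h.kernelMean_mem hx
    have h5 := mul_le_mul_of_nonneg_left h3 hn.le
    have h6 := mul_le_mul_of_nonneg_left h4 hn.le
    exact ⟨by linarith [h2.1], by linarith [h2.2]⟩
  · rw [div_le_div_iff₀ (by positivity) (by positivity)]
    have e1 : n * (3 / 2 * x ^ 3) ≤ 14 * (ε ^ 3 * n) := by
      have := mul_le_mul_of_nonneg_left hcube hn.le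
      linarith
    generalize ε ^ 3 * n = T at *
    have e3 : K ^ 2 ≤ T / 1000000 := by linarith
    calc n * (3 / 2 * x ^ 3) * K ^ 2 ≤ (14 * T) * (T / 1000000) :=
          mul_le_mul e1 e3 (by positivity) (by positivity)
      _ = 14 / 1000000 * T ^ 2 := by ring
      _ ≤ 9 / 100 * T ^ 2 := mul_le_mul_of_nonneg_right (by norm_num) (sq_nonneg T)
      _ = _ := by ring

/-- The variable `degreeTwoCount d` - θM is a sum of independent terms with second moment O(ε),
since θ²x³ is O(ε) as well. Its fluctuations are therefore of order √(εn). -/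
theorem measure_not_typicalCount_le (h : Regime n ε μ K) (hx : x ∈ typicalMeans n ε μ K) :
    (Measure.pi fun _ : Fin n => poissonMeasure x.toNNReal)
      {d | ¬ TypicalCount ε μ (20 * K) (kernelPart d) (degreeTwoCount d)} ≤
        ENNReal.ofReal (1 / K ^ 2) := by
  have hε := h.pos
  have hε1 := h.le
  have hn := h.n_pos
  have hK := h.one_le
  have hs := h.sqrt_pos
  have hss := h.sqrt_mul_self
  have hcube := h.cube_le hx
  have hdiff := h.abs_meanDiff_le hx
  have hθ1 := h.theta_le
  have hθ0 := h.theta_nonneg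
  obtain ⟨hx1, hx2⟩ := h.mean_mem hx
  have hx0 : 0 ≤ x := hε.le.trans hx1
  simp only [TypicalCount]
  set θ := μ / (2 * (1 - μ)) with hθ
  -- The 20 is split into 11, for the drift of the mean when Λ varies, and 9 for Chebyshev's
  -- inequality.
  have hc : 0 < 9 * (K * √(ε * n)) := by positivity
  have ha : HasSum (fun i => Real.exp (-(x.toNNReal : ℝ)) * (x.toNNReal : ℝ) ^ i / i.factorial *
      (twoIndicator i - θ * kernelDegree i)) (meanDiff θ x) := by
    have h1 := (hasSum_twoIndicator x.toNNReal).sub ((hasSum_kernelDegree x.toNNReal).mul_left θ)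
    rw [h.coe_mean hx] at h1 ⊢
    exact h1.congr_fun fun i => by ring
  have hb : HasSum (fun i => Real.exp (-(x.toNNReal : ℝ)) * (x.toNNReal : ℝ) ^ i / i.factorial *
      (twoIndicator i + θ ^ 2 * (3 / 2 * (i.descFactorial 3 : ℝ))))
        (Real.exp (-x) * x ^ 2 / 2 + θ ^ 2 * (3 / 2) * x ^ 3) := by
    have h1 := (hasSum_twoIndicator x.toNNReal).add
      ((hasSum_poisson_descFactorial x.toNNReal 3).mul_left (θ ^ 2 * (3 / 2)))
    rw [h.coe_mean hx] at h1 ⊢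
    exact h1.congr_fun fun i => by ring
  have hw (i : ℕ) : (twoIndicator i - θ * kernelDegree i) ^ 2 ≤
      twoIndicator i + θ ^ 2 * (3 / 2 * (i.descFactorial 3 : ℝ)) := by
    have h1 := mul_le_mul_of_nonneg_left (kernelDegree_sq_le i) (sq_nonneg θ)
    -- The supports are disjoint, so the square has no mixed term.
    have h2 : twoIndicator i * kernelDegree i = 0 := by
      by_cases hi : i = 2 <;> simp [twoIndicator, kernelDegree, hi]
    have h3 : twoIndicator i ^ 2 = twoIndicator i := by
      by_cases hi : i = 2 <;> simp [twoIndicator, hi]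
    nlinarith
  refine (measure_mono fun d hd => ?_).trans
    ((pi_poissonMeasure_chebyshev n ha hb hw hc).trans (ENNReal.ofReal_le_ofReal ?_))
  · rw [Set.mem_ofPred_eq] at hd ⊢
    rw [Finset.sum_sub_distrib, ← Finset.mul_sum, sum_kernelDegree, sum_twoIndicator]
    have h2 : |n * meanDiff θ x| ≤ 11 * (K * √(ε * n)) := by
      rw [abs_mul, abs_of_pos hn]
      refine (mul_le_mul_of_nonneg_left hdiff hn.le).trans_eq ?_
      have : n * (11 * ε * (K / √(ε * n))) = 11 * K * (ε * n / √(ε * n)) := by ring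
      have h3 : ε * n / √(ε * n) = √(ε * n) := by rw [div_eq_iff hs.ne', hss]
      rw [this, h3]
      ring
    rw [not_le] at hd
    have h3 := abs_sub_abs_le_abs_sub (degreeTwoCount d - θ * ∑ u, (kernelPart d u : ℝ))
      (n * meanDiff θ x)
    linarith
  · rw [div_le_div_iff₀ (by positivity) (by positivity)]
    have e1 : Real.exp (-x) * x ^ 2 / 2 ≤ 3 * ε := by
      have f1 : Real.exp (-x) ≤ 1 := Real.exp_le_one_iff.2 (by linarith)
      have f2 : x ^ 2 ≤ (21 / 10 * ε) ^ 2 := pow_le_pow_left₀ hx0 hx2 2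
      have f3 : Real.exp (-x) * x ^ 2 ≤ 1 * x ^ 2 := mul_le_mul_of_nonneg_right f1 (sq_nonneg x)
      nlinarith
    have e2 : θ ^ 2 * (3 / 2) * x ^ 3 ≤ 14 * ε := by
      have f1 : θ ^ 2 ≤ (1 / ε) ^ 2 := pow_le_pow_left₀ hθ0 hθ1 2
      calc θ ^ 2 * (3 / 2) * x ^ 3 ≤ (1 / ε) ^ 2 * (3 / 2) * (93 / 10 * ε ^ 3) :=
            mul_le_mul (mul_le_mul_of_nonneg_right f1 (by norm_num)) hcube (by positivity)
              (by positivity)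
        _ = 279 / 20 * ε := by field_simp; norm_num
        _ ≤ _ := by linarith
    have e3 : n * (Real.exp (-x) * x ^ 2 / 2 + θ ^ 2 * (3 / 2) * x ^ 3) ≤ n * (17 * ε) :=
      mul_le_mul_of_nonneg_left (by linarith) hn.le
    have e4 : 1 * (9 * (K * √(ε * n))) ^ 2 = 81 * (n * ε) * K ^ 2 := by
      have : (9 * (K * √(ε * n))) ^ 2 = 81 * (√(ε * n) * √(ε * n)) * K ^ 2 := by ring
      rw [one_mul, this, hss]
      ring
    rw [e4]
    refine mul_le_mul_of_nonneg_right (e3.trans ?_) (sq_nonneg K)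
    have : 0 ≤ n * ε := by positivity
    linarith

theorem lintegral_degreeTwoCount_le (h : Regime n ε μ K) (hx : x ∈ typicalMeans n ε μ K) :
    ∫⁻ d, (degreeTwoCount d : ℝ≥0∞) ∂(Measure.pi fun _ : Fin n => poissonMeasure x.toNNReal) ≤
      ENNReal.ofReal (3 * (ε ^ 2 * n)) := by
  have hε := h.pos
  have hn := h.n_pos
  obtain ⟨hx1, hx2⟩ := h.mean_mem hx
  have hx0 : 0 ≤ x := hε.le.trans hx1
  rw [lintegral_degreeTwoCount, h.coe_mean hx]
  refine ENNReal.ofReal_le_ofReal ?_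
  have f1 : Real.exp (-x) ≤ 1 := Real.exp_le_one_iff.2 (by linarith)
  have f2 : x ^ 2 ≤ (21 / 10 * ε) ^ 2 := pow_le_pow_left₀ hx0 hx2 2
  have f3 : Real.exp (-x) * x ^ 2 ≤ 1 * x ^ 2 := mul_le_mul_of_nonneg_right f1 (sq_nonneg x)
  have f4 : Real.exp (-x) * x ^ 2 / 2 ≤ 3 * ε ^ 2 := by nlinarith
  have := mul_le_mul_of_nonneg_left f4 hn.le
  linarith

end Regime

/-! ### Comparing the two models -/

/-- The probability of `f` when `j` vertices of degree two are inserted into a random kernel with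
degrees `κ`. -/
noncomputable def configurationWeight {n : ℕ} (f : MultiGraph → ℝ≥0∞) (κ : Fin n → ℕ) (j : ℕ) :
    ℝ≥0∞ :=
  ∑' k, ENNReal.ofReal (insertionCount j k / insertionNorm ((∑ u, κ u + 1) / 2) j) *
    kernelSum κ f k

/-- The probability of `f` when the edges of a random kernel with degrees `κ` are replaced by paths
of geometric lengths. -/
noncomputable def geometricWeight {n : ℕ} (μ : ℝ) (f : MultiGraph → ℝ≥0∞) (κ : Fin n → ℕ) :
    ℝ≥0∞ :=
  ∑' k, ENNReal.ofReal ((1 - μ) ^ ((∑ u, κ u + 1) / 2) * μ ^ k) * kernelSum κ f k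

open Classical in
/-- The part of `configurationWeight` which comes from typical parameters. -/
noncomputable def typicalWeight {n : ℕ} (ε μ K : ℝ) (f : MultiGraph → ℝ≥0∞) (κ : Fin n → ℕ) (j : ℕ) :
    ℝ≥0∞ :=
  ∑' k, if TypicalKernel ε κ ∧ TypicalCount ε μ (2 * K) κ k then
    ENNReal.ofReal (insertionCount j k / insertionNorm ((∑ u, κ u + 1) / 2) j) * kernelSum κ f k
  else 0

section Pointwise

variable {n : ℕ} {f : MultiGraph → ℝ≥0∞} (d : Fin n → ℕ)

theorem insertionProb_eq_zero {m j k : ℕ} (h : j < k) : insertionProb m j k = 0 := by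
  rw [insertionProb, insertionCount_eq_zero h]
  simp

theorem tsum_ofReal_insertionProb_mul (m j : ℕ) {g : ℕ → ℝ} (hg : ∀ k ≤ j, 0 ≤ g k) :
    ∑' k, ENNReal.ofReal (insertionProb m j k * g k) =
      ENNReal.ofReal (∑ k ∈ Finset.range (j + 1), insertionProb m j k * g k) := by
  rw [tsum_eq_sum (s := Finset.range (j + 1)), ENNReal.ofReal_sum_of_nonneg]
  · exact fun k hk => mul_nonneg (insertionProb_nonneg m j k)
      (hg k (Nat.lt_succ_iff.1 (Finset.mem_range.1 hk)))
  · intro k hk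
    rw [insertionProb_eq_zero (by simpa using hk), zero_mul, ENNReal.ofReal_zero]

theorem mul_kernelSum_le (hf : ∀ G, f G ≤ 1) (j k : ℕ) :
    ENNReal.ofReal (insertionCount j k / insertionNorm ((∑ u, kernelPart d u + 1) / 2) j) *
        kernelSum (kernelPart d) f k ≤
      ENNReal.ofReal (insertionProb ((∑ u, kernelPart d u + 1) / 2) j k) := by
  rw [← kernelLinks_eq, kernelSum_kernelPart]
  refine (mul_le_mul_right (kernelSum_le d hf k) _).trans_eq ?_
  rw [← ENNReal.ofReal_natCast, ← ENNReal.ofReal_mul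
    (div_nonneg (Nat.cast_nonneg _) (insertionNorm_pos _ j).le), insertionProb, div_mul_eq_mul_div]

theorem configurationWeight_le_one (hf : ∀ G, f G ≤ 1) (j : ℕ) :
    configurationWeight f (kernelPart d) j ≤ 1 := by
  refine (ENNReal.tsum_le_tsum fun k => mul_kernelSum_le d hf j k).trans_eq ?_
  have h := tsum_ofReal_insertionProb_mul ((∑ u, kernelPart d u + 1) / 2) j (g := fun _ => 1)
    fun _ _ => zero_le_one
  simp only [mul_one] at h
  rw [h, sum_insertionProb, ENNReal.ofReal_one]

/-- If j is within K√(εn) of θM and k is not within 2K√(εn), then more than K√(εn) vertices lie on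
disjoint cycles. By Markov's inequality this has probability at most j / ((2m + 1) K√(εn)), and 2m +
1 ≥ M ≥ ε³n/8. -/
theorem configurationWeight_le {ε μ K : ℝ} (hf : ∀ G, f G ≤ 1) {j : ℕ} (hK : 0 < K * √(ε * n))
    (hd : TypicalKernel ε (kernelPart d)) (hj : TypicalCount ε μ K (kernelPart d) j)
    (hε : 0 < ε ^ 3 * n) :
    configurationWeight f (kernelPart d) j ≤
      ENNReal.ofReal (8 / (ε ^ 3 * n) / (K * √(ε * n))) * j +
        typicalWeight ε μ K f (kernelPart d) j := by
  classical
  set m := (∑ u, kernelPart d u + 1) / 2 with hm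
  have h1 := tsum_ofReal_insertionProb_mul m j (g := fun k => (j - k) * (K * √(ε * n))⁻¹)
    fun k hk => mul_nonneg (sub_nonneg.2 (Nat.cast_le.2 hk)) (by positivity)
  have h2 : ∑ k ∈ Finset.range (j + 1), insertionProb m j k * ((j - k) * (K * √(ε * n))⁻¹) ≤
      8 / (ε ^ 3 * n) / (K * √(ε * n)) * j := by
    simp only [← mul_assoc]
    rw [← Finset.sum_mul, sum_insertionProb_mul_sub, ← div_eq_mul_inv, div_div, div_div,
      div_mul_eq_mul_div]
    have h3 : ∑ u, (kernelPart d u : ℝ) ≤ 2 * m + 1 := by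
      have : ∑ u, kernelPart d u ≤ 2 * m + 1 := by omega
      exact_mod_cast this
    have h4 := hd.1
    have h5 : (0 : ℝ) ≤ j := Nat.cast_nonneg j
    rw [div_le_div_iff₀ (by positivity) (by positivity)]
    calc j * (ε ^ 3 * n * (K * √(ε * n))) = (j * (K * √(ε * n))) * (ε ^ 3 * n) := by ring
      _ ≤ (j * (K * √(ε * n))) * (8 * (2 * m + 1)) :=
          mul_le_mul_of_nonneg_left (by linarith) (by positivity)
      _ = _ := by ring
  calc configurationWeight f (kernelPart d) j
      ≤ ∑' k, (ENNReal.ofReal (insertionProb m j k * ((j - k) * (K * √(ε * n))⁻¹)) +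
          if TypicalKernel ε (kernelPart d) ∧ TypicalCount ε μ (2 * K) (kernelPart d) k then
            ENNReal.ofReal (insertionCount j k / insertionNorm m j) * kernelSum (kernelPart d) f k
          else 0) := by
        refine ENNReal.tsum_le_tsum fun k => ?_
        split_ifs with hk
        · exact le_add_self
        · rw [add_zero]
          refine (mul_kernelSum_le d hf j k).trans ?_
          rcases lt_or_ge j k with hjk | hjk
          · rw [← hm, insertionProb_eq_zero hjk, ENNReal.ofReal_zero]
            exact zero_le
          · refine ENNReal.ofReal_le_ofReal (le_mul_of_one_le_right (insertionProb_nonneg _ _ _) ?_)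
            rw [← div_eq_mul_inv, one_le_div hK]
            have hk' : ¬ TypicalCount ε μ (2 * K) (kernelPart d) k := fun h => hk ⟨hd, h⟩
            rw [TypicalCount, not_le] at hk'
            rw [TypicalCount] at hj
            have h3 : |(k : ℝ) - j| = j - k := by
              rw [abs_sub_comm, abs_of_nonneg (sub_nonneg.2 (Nat.cast_le.2 hjk))]
            have h4 := abs_sub_le (k : ℝ) j (μ / (2 * (1 - μ)) * ∑ u, (kernelPart d u : ℝ))
            rw [h3] at h4
            linarith
    _ = ENNReal.ofReal (∑ k ∈ Finset.range (j + 1),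
          insertionProb m j k * ((j - k) * (K * √(ε * n))⁻¹)) +
            typicalWeight ε μ K f (kernelPart d) j := by
        rw [ENNReal.tsum_add, h1]
        rfl
    _ ≤ _ := by
        refine add_le_add_left ((ENNReal.ofReal_le_ofReal h2).trans_eq ?_) _
        rw [ENNReal.ofReal_mul (by positivity), ENNReal.ofReal_natCast]

end Pointwise

theorem lintegral_kernel_meanLaw {n : ℕ} (ε μ : ℝ) (s : Set ℝ) (Ψ : (Fin n → ℕ) → ℕ → ℝ≥0∞) :
    ∫⁻ x in s, ∫⁻ d, Ψ (kernelPart d) (degreeTwoCount d)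
        ∂(Measure.pi fun _ : Fin n => poissonMeasure x.toNNReal) ∂meanLaw n ε μ =
      ∑' κ, ∑' j, Ψ κ j * ∫⁻ x in s, kernelLaw κ j x ∂meanLaw n ε μ := by
  simp only [lintegral_kernel]
  have hm (κ : Fin n → ℕ) (j : ℕ) : Measurable fun x => Ψ κ j * kernelLaw κ j x :=
    (measurable_kernelLaw κ j).const_mul _
  rw [lintegral_tsum fun κ => (Measurable.tsum fun j => hm κ j).aemeasurable]
  refine tsum_congr fun κ => ?_
  rw [lintegral_tsum fun j => (hm κ j).aemeasurable]
  exact tsum_congr fun j => lintegral_const_mul _ (measurable_kernelLaw κ j)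

theorem poissonConfigurationProb_eq (n : ℕ) (ε μ : ℝ) {A : Set MultiGraph}
    (hA : ∀ G H, MultiGraph.Iso G H → G ∈ A → H ∈ A) :
    poissonConfigurationProb n ε μ A =
      ∫⁻ x, ∫⁻ d, configurationWeight (A.indicator 1) (kernelPart d) (degreeTwoCount d)
        ∂(Measure.pi fun _ : Fin n => poissonMeasure x.toNNReal) ∂meanLaw n ε μ := by
  have hf (G H : MultiGraph) (h : MultiGraph.Iso G H) :
      A.indicator (1 : MultiGraph → ℝ≥0∞) G = A.indicator 1 H := by
    by_cases hG : G ∈ A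
    · rw [Set.indicator_of_mem hG, Set.indicator_of_mem (hA G H h hG)]
      rfl
    · rw [Set.indicator_of_notMem hG, Set.indicator_of_notMem fun hH => hG (hA H G h.symm hH)]
  rw [poissonConfigurationProb, degreeExp, meanLaw]
  refine lintegral_congr fun x => lintegral_congr fun d => ?_
  rw [unifExp_deleteCycles d hf, configurationWeight, ← kernelLinks_eq]
  simp only [kernelSum_kernelPart]

namespace IsDual

variable {ε μ : ℝ}

theorem poissonGeometricProb_eq (h : IsDual ε μ) (n : ℕ) (A : Set MultiGraph) :
    poissonGeometricProb n ε μ A =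
      ∑' κ, ∑' j, geometricWeight μ (A.indicator 1) κ *
        ∫⁻ x, kernelLaw (n := n) κ j x ∂meanLaw n ε μ := by
  have h1 := lintegral_kernel_meanLaw (n := n) ε μ Set.univ
    fun κ _ => geometricWeight μ (A.indicator 1) κ
  simp only [Measure.restrict_univ] at h1
  rw [← h1, poissonGeometricProb, degreeExp, meanLaw]
  refine lintegral_congr fun x => lintegral_congr fun d => ?_
  rw [unifExp_geomExpansionProb d (sub_pos.2 h.lt_one) (by linarith [h.pos_right]),
    geometricWeight, ← kernelLinks_eq, sub_sub_cancel]
  simp only [kernelSum_kernelPart]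

end IsDual

namespace Regime

variable {n : ℕ} {ε μ K : ℝ} {f : MultiGraph → ℝ≥0∞}

theorem tsum_typicalWeight_le (h : Regime n ε μ K) (κ : Fin n → ℕ) :
    ∑' j, typicalWeight ε μ K f κ j *
        ∫⁻ x in typicalMeans n ε μ K, kernelLaw κ j x ∂meanLaw n ε μ ≤
      ENNReal.ofReal (comparisonConst K) *
        ∑' j, geometricWeight μ f κ * ∫⁻ x, kernelLaw κ j x ∂meanLaw n ε μ := by
  classical
  simp only [typicalWeight, ← ENNReal.tsum_mul_right]
  rw [ENNReal.tsum_comm, ENNReal.tsum_mul_left, geometricWeight, ← ENNReal.tsum_mul_right,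
    ← ENNReal.tsum_mul_left]
  refine ENNReal.tsum_le_tsum fun k => ?_
  by_cases hk : TypicalKernel ε κ ∧ TypicalCount ε μ (2 * K) κ k
  · simp only [if_pos hk]
    have h1 := mul_le_mul_left (h.tsum_lintegral_kernelLaw_le hk.1 hk.2) (kernelSum κ f k)
    rw [← ENNReal.tsum_mul_right] at h1
    refine (le_of_eq (tsum_congr fun j => ?_)).trans (h1.trans_eq ?_)
    · ring
    · ring
  · simp only [if_neg hk, zero_mul, tsum_zero]
    exact zero_le

/-- Each 1/K² pays for one bad event: atypical kernel degrees, an atypical number of vertices of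
degree two, too many vertices on disjoint cycles. -/
theorem lintegral_configurationWeight_le (h : Regime n ε μ (20 * K)) (hK : 1 ≤ K)
    (hf : ∀ G, f G ≤ 1) {x : ℝ} (hx : x ∈ typicalMeans n ε μ K) :
    ∫⁻ d, configurationWeight f (kernelPart d) (degreeTwoCount d)
        ∂(Measure.pi fun _ : Fin n => poissonMeasure x.toNNReal) ≤
      ENNReal.ofReal (3 / K ^ 2) +
        ∫⁻ d, typicalWeight ε μ (20 * K) f (kernelPart d) (degreeTwoCount d)
          ∂(Measure.pi fun _ : Fin n => poissonMeasure x.toNNReal) := by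
  have h' := h.mono hK
  have hs := h.sqrt_pos
  have hε := h.pos
  have hn := h.n_pos
  have hsK := h.le_mul_sqrt
  set P := Measure.pi fun _ : Fin n => poissonMeasure x.toNNReal
  set a := ENNReal.ofReal (8 / (ε ^ 3 * n) / (20 * K * √(ε * n))) with ha
  have hpt (d : Fin n → ℕ) : configurationWeight f (kernelPart d) (degreeTwoCount d) ≤
      {d | ¬ TypicalKernel ε (kernelPart d)}.indicator 1 d +
        ({d | ¬ TypicalCount ε μ (20 * K) (kernelPart d) (degreeTwoCount d)}.indicator 1 d +
          (a * degreeTwoCount d +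
            typicalWeight ε μ (20 * K) f (kernelPart d) (degreeTwoCount d))) := by
    by_cases h1 : TypicalKernel ε (kernelPart d)
    · by_cases h2 : TypicalCount ε μ (20 * K) (kernelPart d) (degreeTwoCount d)
      · refine le_trans ?_ (le_add_self.trans le_add_self)
        exact configurationWeight_le d hf (by positivity) h1 h2 (by positivity)
      · refine le_trans ?_ le_add_self
        rw [Set.indicator_of_mem (by exact h2)]
        exact (configurationWeight_le_one d hf _).trans le_self_add
    · rw [Set.indicator_of_mem (by exact h1)]
      exact (configurationWeight_le_one d hf _).trans le_self_add
  refine (lintegral_mono hpt).trans ?_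
  have hm {g : (Fin n → ℕ) → ℝ≥0∞} : Measurable g := measurable_of_countable _
  rw [lintegral_add_left hm, lintegral_add_left hm, lintegral_add_left hm,
    lintegral_indicator_one (Set.to_countable _).measurableSet,
    lintegral_indicator_one (Set.to_countable _).measurableSet, lintegral_const_mul _ hm,
    ← add_assoc, ← add_assoc]
  refine add_le_add_left ?_ _
  have h1 : a * ∫⁻ d, (degreeTwoCount d : ℝ≥0∞) ∂P ≤ ENNReal.ofReal (1 / K ^ 2) := by
    refine (mul_le_mul_right (h'.lintegral_degreeTwoCount_le hx) _).trans ?_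
    rw [ha, ← ENNReal.ofReal_mul (by positivity)]
    refine ENNReal.ofReal_le_ofReal ?_
    -- On average O(ε²n / (ε³n)) = O(1/ε) vertices lie on cycles. Relative to K√(εn) this is small
    -- because ε√(εn) is at least 20000 K.
    have e1 : 8 / (ε ^ 3 * n) / (20 * K * √(ε * n)) * (3 * (ε ^ 2 * n)) =
        6 / (5 * K * (ε * √(ε * n))) := by
      field_simp
      norm_num
    rw [e1, div_le_div_iff₀ (by positivity) (by positivity)]
    have e2 : 5 * K * (1000 * (20 * K)) ≤ 5 * K * (ε * √(ε * n)) :=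
      mul_le_mul_of_nonneg_left hsK (by positivity)
    nlinarith [sq_nonneg K]
  refine (add_le_add (add_le_add (h'.measure_not_typicalKernel_le hx)
    (h'.measure_not_typicalCount_le hx)) h1).trans_eq ?_
  rw [← ENNReal.ofReal_add (by positivity) (by positivity),
    ← ENNReal.ofReal_add (by positivity) (by positivity)]
  congr 1
  ring

theorem poissonConfigurationProb_le (h : Regime n ε μ (20 * K)) (hK : 1 ≤ K) {A : Set MultiGraph}
    (hA : ∀ G H, MultiGraph.Iso G H → G ∈ A → H ∈ A) :
    poissonConfigurationProb n ε μ A ≤ ENNReal.ofReal (4 / K ^ 2) +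
      ENNReal.ofReal (comparisonConst (20 * K)) * poissonGeometricProb n ε μ A := by
  have h' := h.mono hK
  have hf (G : MultiGraph) : A.indicator (1 : MultiGraph → ℝ≥0∞) G ≤ 1 :=
    Set.indicator_le_self' (fun _ _ => zero_le) G
  set f : MultiGraph → ℝ≥0∞ := A.indicator 1
  have hm : MeasurableSet (typicalMeans n ε μ K) := measurableSet_Icc
  -- Typical counts have tolerance 20K, so the comparison is carried out with 20K. Its interval of
  -- means only has to contain the one used for truncation.
  have hsub : typicalMeans n ε μ K ⊆ typicalMeans n ε μ (20 * K) := by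
    have : 0 ≤ K / √(ε * n) := div_nonneg (by linarith) (Real.sqrt_nonneg _)
    have h2 : 20 * K / √(ε * n) = 20 * (K / √(ε * n)) := by ring
    unfold typicalMeans
    rw [h2]
    exact Set.Icc_subset_Icc (by linarith) (by linarith)
  let Q (x : ℝ) := ∫⁻ d, configurationWeight f (kernelPart d) (degreeTwoCount d)
        ∂(Measure.pi fun _ : Fin n => poissonMeasure x.toNNReal)
  let R (x : ℝ) := ∫⁻ d, typicalWeight ε μ (20 * K) f (kernelPart d) (degreeTwoCount d)
          ∂(Measure.pi fun _ : Fin n => poissonMeasure x.toNNReal)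
  have hQ (x : ℝ) : Q x ≤ 1 := by
    refine (lintegral_mono fun d => configurationWeight_le_one d hf _).trans ?_
    simp
  rw [poissonConfigurationProb_eq n ε μ hA]
  calc ∫⁻ x, Q x ∂meanLaw n ε μ
      = ∫⁻ x in typicalMeans n ε μ K, Q x ∂meanLaw n ε μ +
          ∫⁻ x in (typicalMeans n ε μ K)ᶜ, Q x ∂meanLaw n ε μ := (lintegral_add_compl Q hm).symm
    _ ≤ (ENNReal.ofReal (3 / K ^ 2) + ∫⁻ x in typicalMeans n ε μ (20 * K), R x ∂meanLaw n ε μ) +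
          ENNReal.ofReal (1 / K ^ 2) := by
        refine add_le_add ?_ ?_
        · calc _ ≤ ∫⁻ x in typicalMeans n ε μ K, (ENNReal.ofReal (3 / K ^ 2) + R x)
                ∂meanLaw n ε μ := setLIntegral_mono' hm fun x hx =>
                  h.lintegral_configurationWeight_le hK hf hx
            _ = ENNReal.ofReal (3 / K ^ 2) * meanLaw n ε μ (typicalMeans n ε μ K) +
                ∫⁻ x in typicalMeans n ε μ K, R x ∂meanLaw n ε μ := by
              rw [lintegral_add_left measurable_const, setLIntegral_const]
            _ ≤ _ := add_le_add (mul_le_of_le_one_right' prob_le_one) (lintegral_mono_set hsub)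
        · calc _ ≤ ∫⁻ x in (typicalMeans n ε μ K)ᶜ, 1 ∂meanLaw n ε μ := lintegral_mono hQ
            _ = meanLaw n ε μ (typicalMeans n ε μ K)ᶜ := by simp
            _ ≤ _ := h'.measure_not_typicalMeans_le
    _ = ENNReal.ofReal (4 / K ^ 2) + ∫⁻ x in typicalMeans n ε μ (20 * K), R x ∂meanLaw n ε μ := by
        rw [add_right_comm, ← ENNReal.ofReal_add (by positivity) (by positivity)]
        congr 2
        ring
    _ ≤ _ := by
        refine add_le_add_right ?_ _
        rw [lintegral_kernel_meanLaw, h.poissonGeometricProb_eq, ← ENNReal.tsum_mul_left]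
        exact ENNReal.tsum_le_tsum fun κ => h.tsum_typicalWeight_le κ

end Regime

/-! ### The contiguity theorem -/

theorem theorem4p2 (ε μ : ℕ → ℝ)
    (hε : Tendsto ε atTop (𝓝 0))
    (hεn : Tendsto (fun n : ℕ => ε n ^ 3 * n) atTop atTop)
    (hμ : ∀ᶠ n in atTop,
      μ n < 1 ∧ μ n * Real.exp (-μ n) = (1 + ε n) * Real.exp (-(1 + ε n)))
    (A : ℕ → Set MultiGraph)
    (hA : ∀ n G H, MultiGraph.Iso G H → G ∈ A n → H ∈ A n)
    (h : Tendsto (fun n => poissonGeometricProb n (ε n) (μ n) (A n)) atTop (𝓝 0)) :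
    Tendsto (fun n => poissonConfigurationProb n (ε n) (μ n) (A n)) atTop (𝓝 0) := by
  rw [ENNReal.tendsto_nhds_zero] at h ⊢
  intro δ hδ
  -- The order matters: K is chosen from δ alone, which fixes the comparison constant, and only then
  -- is the geometric probability made small relative to that constant.
  obtain ⟨K, hK1, hK⟩ : ∃ K : ℝ, 1 ≤ K ∧ ENNReal.ofReal (4 / K ^ 2) ≤ δ / 2 := by
    have h1 : Tendsto (fun K : ℝ => ENNReal.ofReal (4 / K ^ 2)) atTop (𝓝 0) := by
      rw [← ENNReal.ofReal_zero]
      exact ENNReal.tendsto_ofReal (tendsto_const_nhds.div_atTop (tendsto_pow_atTop two_ne_zero))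
    have h2 := (ENNReal.tendsto_nhds_zero.1 h1) (δ / 2) (ENNReal.half_pos hδ.ne')
    obtain ⟨K, hK⟩ := (h2.and (eventually_ge_atTop 1)).exists
    exact ⟨K, hK.2, hK.1⟩
  set C := ENNReal.ofReal (comparisonConst (20 * K))
  have hC0 : C ≠ 0 := (ENNReal.ofReal_pos.2 (comparisonConst_pos _)).ne'
  have hC : C ≠ ⊤ := ENNReal.ofReal_ne_top
  have hη : 0 < δ / 2 / C := ENNReal.div_pos (ENNReal.half_pos hδ.ne').ne' hC
  have hpos : ∀ᶠ n : ℕ in atTop, 0 < ε n := by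
    filter_upwards [hεn.eventually_gt_atTop 0] with n hn
    by_contra! hle
    have h1 : ε n ^ 3 ≤ 0 := by
      have : ε n ^ 3 = ε n * ε n ^ 2 := by ring
      rw [this]
      exact mul_nonpos_of_nonpos_of_nonneg hle (sq_nonneg _)
    exact absurd hn (not_lt.2 (mul_nonpos_of_nonpos_of_nonneg h1 (Nat.cast_nonneg n)))
  filter_upwards [h _ hη, hμ, hpos, hε.eventually_le_const (by norm_num : (0 : ℝ) < 1 / 100),
    hεn.eventually_ge_atTop ((1000 * (20 * K)) ^ 2)] with n hn hμn hposn hεn' hlarge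
  have hR : Regime n (ε n) (μ n) (20 * K) :=
    { pos := hposn, le := hεn', lt_one := hμn.1, eq := hμn.2, one_le := by linarith, large := hlarge }
  calc _ ≤ ENNReal.ofReal (4 / K ^ 2) + C * poissonGeometricProb n (ε n) (μ n) (A n) :=
        hR.poissonConfigurationProb_le hK1 (hA n)
    _ ≤ δ / 2 + C * (δ / 2 / C) := add_le_add hK (mul_le_mul_right hn C)
    _ = δ := by
        rw [ENNReal.mul_div_cancel hC0 hC, ENNReal.add_halves]
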